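/- **Model.** Let $E\ge 0$, $F>0$, $\lambda\neq 0$, $\beta\in\mathbb R$, $\tau>0$. On $\ell^2(\mathbb Z)$ with basis $(|x\rangle)_{x\in\mathbb Z}$ let $T=\sum_x|x+1\rangle\langle x|$, $X=\sum_x x\,|x\rangle\langle x|$, $-\Delta=2-T-T^*$ and let $h_S=-\Delta-FX$ (self-adjoint on the domain of $X$). On $\mathbb C^2$, with ground state $|0\rangle$ and excited state $|1\rangle$, let $b=|0\rangle\langle 1|$, $h_E=E\,b^*b$ and $\rho_\beta=e^{-\beta h_E}/\mathrm{Tr}(e^{-\beta h_E})$. On $\ell^2(\mathbb Z)\otimes\mathbb C^2$ let $$h=h_S\otimes 1+1\otimes h_E+\lambda\,(T\otimes b^*+T^*\otimes b),$$ and for a trace class operator $\rho$ on $\ell^2(\mathbb Z)$ let $$\mathcal L_\beta(\rho)=\mathrm{Tr}_{\mathbb C^2}\big[e^{-i\tau h}(\rho\otimes\rho_\beta)e^{i\tau h}\big].$$ Put $\omega_0=\sqrt{(E-F)^2+4\lambda^2}$, assume $\omega_0\tau\notin 2\pi\mathbb Z$, and set $$p=\frac{4\lambda^2}{\omega_0^2}\sin^2\Big(\frac{\omega_0\tau}{2}\Big),\quad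 v_d=\frac p\tau\tanh\Big(\frac{\beta E}2\Big),\quad D=\frac p{2\tau}\Big(1-p\tanh^2\Big(\frac{\beta E}{2}\Big)\Big).$$ **Theorem.** One has $p\in(0,1]$. Let $\rho$ be a density matrix on $\ell^2(\mathbb Z)$ (positive, trace one), and for $n\ge0$ let $\mu_n$ be the spectral measure of $X$ in the state $\mathcal L_\beta^n(\rho)$, i.e. the probability measure on $\mathbb R$ with $\mu_n(B)=\mathrm{Tr}(1_B(X)\,\mathcal L_\beta^n(\rho))$. Write $\langle f(X)\rangle_n=\int f\,d\mu_n$. 1. (Central limit theorem.) For every bounded continuous $f:\mathbb R\to\mathbb R$, $$\lim_{n\to\infty}\int f\Big(\frac{x-v_dn\tau}{\sqrt{2Dn\tau}}\Big)d\mu_n(x)=\int f(x)\,e^{-x^2/2}\frac{dx}{\sqrt{2\pi}}.$$ 2. (Moments.) If $\mathrm{Tr}(X^2\rho)<\infty$, then every $\mu_n$ has finite second moment, and $$\lim_{n\to\infty}\frac{\langle X\rangle_n}{n\tau}=v_d,\qquad \lim_{n\to\infty}\frac{\langle (X-v_dn\tau)^2\rangle_n}{n\tau}=2D.$$ 3.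 (Large deviation principle.) Let $$e(\alpha)=\log\Big((1-p)+p\,\frac{\cosh(\frac12\beta E+\alpha)}{\cosh\frac12\beta E}\Big),\qquad I(x)=\sup_{\alpha\in\mathbb R}\big(\alpha x-e(\alpha)\big)\in[0,\infty].$$ If $\mathrm{Tr}(e^{\alpha|X|}\rho)<\infty$ for all $\alpha>0$, then for every interval $J\subset\mathbb R$ (with $\log 0=-\infty$, $\inf\emptyset=+\infty$) $$-\inf_{x\in \mathrm{int} J}I(x)\le\liminf_{n\to\infty}\frac1n\log\mu_n(nJ)\le\limsup_{n\to\infty}\frac1n\log\mu_n(nJ)\le-\inf_{x\in\overline J}I(x),$$ and $$\lim_{n\to\infty}\frac1n\log\mu_n(nJ)=-\inf_{x\in J}I(x)$$ whenever the interior of $J$ meets $(-1,1)$ or the closure of $J$ does not meet $[-1,1]$. -/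

import Mathlib

open Filter Topology MeasureTheory
open scoped ENNReal Pointwise Matrix

noncomputable section

namespace TightBinding

/-! ## One-parameter unitary groups -/

/-- `U` is the strongly continuous one-parameter unitary group `t ↦ exp (-i t A)`: its
infinitesimal generator, with the domain on which `t ↦ U t ψ` is differentiable at `0`,
is exactly `-i A`. -/
structure IsUnitaryGroup {K : Type*} [NormedAddCommGroup K] [InnerProductSpace ℂ K]
    [CompleteSpace K] (A : K →ₗ.[ℂ] K) (U : ℝ → K →L[ℂ] K) : Prop where
  map_zero : U 0 = 1
  map_add : ∀ s t, U (s + t) = U s * U t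
  unitary : ∀ t, U t ∈ unitary (K →L[ℂ] K)
  continuous : ∀ ψ, Continuous fun t => U t ψ
  generator : ∀ ψ φ : K,
    (ψ, φ) ∈ A.graph ↔ HasDerivAt (fun t => U t ψ) (-(Complex.I • φ)) 0

open Classical in
/-- `expNegI A t = exp (-i t A)` for a self-adjoint operator `A`. A one-parameter unitary group is
determined by its generator, so the choice below is unique; it exists exactly when `A` is
self-adjoint (Stone). -/
def expNegI {K : Type*} [NormedAddCommGroup K] [InnerProductSpace ℂ K] [CompleteSpace K]
    (A : K →ₗ.[ℂ] K) : ℝ → K →L[ℂ] K :=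
  if h : ∃ U, IsUnitaryGroup A U then h.choose else fun _ => 1

/-! ## The particle -/

/-- The Hilbert space `ℓ²(ℤ)` of the particle. -/
abbrev HS : Type := lp (fun _ : ℤ => ℂ) 2

/-- The basis vector `|x⟩`. -/
def ket (x : ℤ) : HS := lp.single 2 x (1 : ℂ)

theorem memℓp_shift (a : ℤ) (ψ : HS) : Memℓp (fun x : ℤ => ψ (x + a)) 2 := by
  have h := (memℓp_gen_iff (p := 2) (by norm_num)).1 (lp.memℓp ψ)
  exact memℓp_gen ((Equiv.addRight a).summable_iff.2 h)

/-- The operator `ψ ↦ ψ(· + a)` on `ℓ²(ℤ)`. -/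
def shift (a : ℤ) : HS →L[ℂ] HS :=
  LinearMap.mkContinuous
    { toFun := fun ψ => ⟨fun x => ψ (x + a), memℓp_shift a ψ⟩
      map_add' := fun _ _ => rfl
      map_smul' := fun _ _ => rfl } 1 (fun ψ => by
        rw [one_mul, lp.norm_eq_tsum_rpow (by norm_num), lp.norm_eq_tsum_rpow (by norm_num)]
        exact le_of_eq (congrArg (fun r : ℝ => r ^ (1 / (2 : ℝ≥0∞).toReal))
          ((Equiv.addRight a).tsum_eq (fun x : ℤ => ‖ψ x‖ ^ (2 : ℝ≥0∞).toReal))))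

/-- The translation operator `T = ∑ₓ |x+1⟩⟨x|`, that is `(T ψ)(x) = ψ(x-1)`. -/
def transl : HS →L[ℂ] HS := shift (-1)

/-- The position operator `X = ∑ₓ x |x⟩⟨x|` on its maximal domain. -/
def position : HS →ₗ.[ℂ] HS where
  domain :=
    { carrier := {ψ | Memℓp (fun x : ℤ => (x : ℂ) * ψ x) 2}
      zero_mem' := by
        have : (fun x : ℤ => (x : ℂ) * (0 : HS) x) = 0 := by funext x; simp
        simpa only [Set.mem_ofPred_eq, this] using zero_memℓp
      add_mem' := fun {ψ φ} hψ hφ => by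
        have : (fun x : ℤ => (x : ℂ) * (ψ + φ) x)
            = (fun x : ℤ => (x : ℂ) * ψ x) + fun x : ℤ => (x : ℂ) * φ x := by
          funext x; simp [mul_add]
        simpa only [Set.mem_ofPred_eq, this] using hψ.add hφ
      smul_mem' := fun c ψ hψ => by
        have : (fun x : ℤ => (x : ℂ) * (c • ψ) x) = c • fun x : ℤ => (x : ℂ) * ψ x := by
          funext x; simp [mul_left_comm]
        simpa only [Set.mem_ofPred_eq, this] using hψ.const_smul c }
  toFun :=
    { toFun := fun ψ => ⟨fun x : ℤ => (x : ℂ) * (ψ : HS) x, ψ.2⟩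
      map_add' := fun ψ φ => by ext x; exact mul_add _ _ _
      map_smul' := fun c ψ => by ext x; simp [mul_left_comm] }

/-- `-Δ = ∑ₓ (2 |x⟩⟨x| - |x+1⟩⟨x| - |x⟩⟨x+1|)`. -/
def negLaplacian : HS →L[ℂ] HS := (2 : ℂ) • 1 - transl - transl.adjoint

/-- The Hamiltonian `h_S = -Δ - F X` of the particle, on the domain of `X`. -/
def hamS (F : ℝ) : HS →ₗ.[ℂ] HS := (negLaplacian : HS →ₗ[ℂ] HS) +ᵥ (-((F : ℂ) • position))

/-! ## The two-level atom; index `0` is the ground state and index `1` the excited state -/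

/-- The annihilation operator `b = |0⟩⟨1|`; its adjoint is the creation operator. -/
def annih : Matrix (Fin 2) (Fin 2) ℂ := !![0, 1; 0, 0]

/-- The Hamiltonian `h_E = E b* b`. -/
def hamE (E : ℝ) : Matrix (Fin 2) (Fin 2) ℂ := (E : ℂ) • (annihᴴ * annih)

/-- The thermal state `exp (-β h_E) / Tr exp (-β h_E)`. -/
def thermal (E β : ℝ) : Matrix (Fin 2) (Fin 2) ℂ :=
  (NormedSpace.exp (-(β : ℂ) • hamE E)).trace⁻¹ • NormedSpace.exp (-(β : ℂ) • hamE E)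

/-! ## The coupled system -/

/-- The Hilbert space `ℓ²(ℤ) ⊗ ℂ²`, written as `ℓ²(ℤ) ⊕ ℓ²(ℤ)`: the vector `ψ ⊗ χ` is the pair
`(χ 0 • ψ, χ 1 • ψ)`. -/
abbrev HTot : Type := PiLp 2 (fun _ : Fin 2 => HS)

/-- `1 ⊗ ⟨σ|`. -/
def bra (σ : Fin 2) : HTot →L[ℂ] HS := PiLp.proj (𝕜 := ℂ) 2 (fun _ : Fin 2 => HS) σ

/-- `1 ⊗ |σ⟩`. -/
def incl (σ : Fin 2) : HS →L[ℂ] HTot := (bra σ).adjoint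

/-- The bounded operator `A ⊗ B = ∑_{σ,σ'} B_{σσ'} (1 ⊗ |σ⟩) A (1 ⊗ ⟨σ'|)`. -/
def tens (A : HS →L[ℂ] HS) (B : Matrix (Fin 2) (Fin 2) ℂ) : HTot →L[ℂ] HTot :=
  ∑ σ, ∑ σ', B σ σ' • (incl σ ∘L A ∘L bra σ')

/-- The operator `A ⊗ 1` for an unbounded operator `A` on `ℓ²(ℤ)`. -/
def ampl (A : HS →ₗ.[ℂ] HS) : HTot →ₗ.[ℂ] HTot where
  domain :=
    { carrier := {Ψ | ∀ σ, bra σ Ψ ∈ A.domain}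
      zero_mem' := fun σ => by rw [map_zero]; exact A.domain.zero_mem
      add_mem' := fun {Ψ Φ} hΨ hΦ σ => by rw [map_add]; exact A.domain.add_mem (hΨ σ) (hΦ σ)
      smul_mem' := fun c Ψ hΨ σ => by rw [map_smul]; exact A.domain.smul_mem c (hΨ σ) }
  toFun :=
    { toFun := fun Ψ => WithLp.toLp 2 fun σ => A ⟨bra σ (Ψ : HTot), Ψ.2 σ⟩
      map_add' := fun Ψ Φ => by
        ext1 σ
        exact A.map_add ⟨bra σ (Ψ : HTot), Ψ.2 σ⟩ ⟨bra σ (Φ : HTot), Φ.2 σ⟩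
      map_smul' := fun c Ψ => by
        ext1 σ
        exact A.map_smul c ⟨bra σ (Ψ : HTot), Ψ.2 σ⟩ }

/-- The coupling `v = T ⊗ b* + T* ⊗ b`. -/
def coupling : HTot →L[ℂ] HTot := tens transl annihᴴ + tens transl.adjoint annih

/-- The coupled Hamiltonian `h = h_S ⊗ 1 + 1 ⊗ h_E + λ v`. -/
def hamTot (E F lam : ℝ) : HTot →ₗ.[ℂ] HTot :=
  ((tens 1 (hamE E) + (lam : ℂ) • coupling : HTot →L[ℂ] HTot) : HTot →ₗ[ℂ] HTot) +ᵥ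
    ampl (hamS F)

/-- The partial trace over the atom. -/
def partialTrace (R : HTot →L[ℂ] HTot) : HS →L[ℂ] HS := ∑ σ, bra σ ∘L R ∘L incl σ

/-- The reduced dynamics map
`L_β(ρ) = Tr_E (exp (-i τ h) (ρ ⊗ ρ_β) exp (i τ h))`. -/
def reducedMap (E F lam β τ : ℝ) (ρ : HS →L[ℂ] HS) : HS →L[ℂ] HS :=
  partialTrace (expNegI (hamTot E F lam) τ ∘L tens ρ (thermal E β) ∘L
    expNegI (hamTot E F lam) (-τ))

/-! ## States and the law of the position -/

/-- The diagonal matrix element `⟨x|ρ|x⟩`. For a positive operator `ρ` and `f ≥ 0`, the trace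
`Tr (f(X) ρ)` is the sum of `f x * diag ρ x` over `x`. -/
def diag (ρ : HS →L[ℂ] HS) (x : ℤ) : ℝ := (inner ℂ (ket x) (ρ (ket x))).re

/-- Density matrices: positive trace class operators of trace one. -/
def IsDensityMatrix (ρ : HS →L[ℂ] HS) : Prop := ρ.IsPositive ∧ HasSum (diag ρ) 1

/-- The spectral measure `B ↦ Tr (1_B(X) ρ)` of the position observable in the state `ρ`. -/
def positionLaw (ρ : HS →L[ℂ] HS) : Measure ℝ :=
  Measure.sum fun x : ℤ => ENNReal.ofReal (diag ρ x) • Measure.dirac (x : ℝ)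

/-- The law `μ_n` of the position in the state `ρ(n) = L_β^n(ρ)`. -/
def lawAt (E F lam β τ : ℝ) (ρ : HS →L[ℂ] HS) (n : ℕ) : Measure ℝ :=
  positionLaw ((reducedMap E F lam β τ)^[n] ρ)

/-! ## Parameters of the limit theorems -/

/-- `ω₀ = √((E - F)² + 4 λ²)`. -/
def rabi (E F lam : ℝ) : ℝ := Real.sqrt ((E - F) ^ 2 + 4 * lam ^ 2)

/-- `p = (4 λ² / ω₀²) sin² (ω₀ τ / 2)`. -/
def kickProb (E F lam τ : ℝ) : ℝ :=
  4 * lam ^ 2 / rabi E F lam ^ 2 * Real.sin (rabi E F lam * τ / 2) ^ 2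

/-- The drift velocity `v_d = (p / τ) tanh (β E / 2)`. -/
def drift (E F lam β τ : ℝ) : ℝ := kickProb E F lam τ / τ * Real.tanh (β * E / 2)

/-- The diffusion constant `D = (p / (2 τ)) (1 - p tanh² (β E / 2))`. -/
def diffusion (E F lam β τ : ℝ) : ℝ :=
  kickProb E F lam τ / (2 * τ) * (1 - kickProb E F lam τ * Real.tanh (β * E / 2) ^ 2)

/-- `e(α) = log ((1 - p) + p cosh (β E / 2 + α) / cosh (β E / 2))`. -/
def logMGF (E F lam β τ α : ℝ) : ℝ :=
  Real.log ((1 - kickProb E F lam τ) +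
    kickProb E F lam τ * (Real.cosh (β * E / 2 + α) / Real.cosh (β * E / 2)))

/-- The rate function `I(x) = sup_α (α x - e(α))`, with values in the extended reals. -/
def rate (E F lam β τ x : ℝ) : EReal := ⨆ α : ℝ, ((α * x - logMGF E F lam β τ α : ℝ) : EReal)

/-- `(1/n) log μ(n J)`, with `log 0 = -∞`. -/
def logProb (μ : Measure ℝ) (J : Set ℝ) (n : ℕ) : EReal :=
  (((n : ℝ)⁻¹ : ℝ) : EReal) * ENNReal.log (μ ((n : ℝ) • J))

end TightBinding

end

noncomputable section

namespace TightBinding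

/-! ## Unitary groups -/

section UnitaryGroup

variable {K : Type*} [NormedAddCommGroup K] [InnerProductSpace ℂ K] [CompleteSpace K]

/-! The model is exactly solvable, and the position behaves as a classical random walk. Translating
by one site changes `hamS` by the constant `F`, so conjugation by `twist` decouples particle and
atom: the atom then evolves under the 2×2 matrix with diagonal `0`, `E - F` and off-diagonal entries
`lam`, whose propagator is `rabiMat`. The particle Hamiltonian is itself conjugate, through `gauge`,
to `2 - F X`. Hence `totProp` is explicit, and `expNegI_hamTot` identifies it with the abstractly
chosen group: the generator is computed by splitting off norm-differentiable factors
(`hasDerivAt_mul_iff`), and uniqueness is `IsUnitaryGroup.eq_of_dense`.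

Because the thermal state is diagonal, tracing out the atom leaves no interference between the jumps
`0, 1, -1` (`reducedMap_eq`). The resulting random shift commutes with the free evolution
(`randomShift_conj_stark`), so all free evolution can be moved to the start. By `lawAt_eq`, the law
after `n` interactions is that of a lattice walk after `n` independent steps, started from the
position law of the freely evolved state at time `n * τ`.

The initial law therefore depends on `n`. Bloch oscillations make this harmless: the free propagator
is a boost times the exponential of a hopping operator with coefficients bounded by `2 / F` at all
times, so one summable function dominates every initial law, even after multiplication by polynomial
or exponential weights (`exists_summable_bound`).

What remains is probability. The central limit theorem follows from characteristic functions, the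
initial factor tending to `1`. The moments obey an exact recursion. For large deviations, Chernoff's
inequality gives the upper bound and exponential tilting (`withDensity_iterate_walkMeasure`) with
Chebyshev's inequality the lower one; convexity of the rate function treats the endpoints `±1` and
compares the infima over interior and closure. -/

theorem norm_apply_of_mem_unitary {V : K →L[ℂ] K} (hV : V ∈ unitary (K →L[ℂ] K)) (ψ : K) :
    ‖V ψ‖ = ‖ψ‖ := by
  have h : V.adjoint (V ψ) = ψ := by
    have := Unitary.star_mul_self_of_mem hV
    rw [ContinuousLinearMap.star_eq_adjoint] at this
    exact congrArg (fun W : K →L[ℂ] K => W ψ) this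
  have h2 : inner ℂ (V ψ) (V ψ) = inner ℂ ψ ψ := by
    rw [← ContinuousLinearMap.adjoint_inner_left, h]
  rw [@norm_eq_sqrt_re_inner ℂ, @norm_eq_sqrt_re_inner ℂ _ _ _ _ ψ, h2]

namespace IsUnitaryGroup

variable {A : K →ₗ.[ℂ] K} {U V : ℝ → K →L[ℂ] K}

theorem norm_apply (h : IsUnitaryGroup A U) (t : ℝ) (ψ : K) : ‖U t ψ‖ = ‖ψ‖ :=
  norm_apply_of_mem_unitary (h.unitary t) ψ

theorem hasDerivAt_apply (h : IsUnitaryGroup A U) {ψ φ : K} (hψ : (ψ, φ) ∈ A.graph) (t : ℝ) :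
    HasDerivAt (fun s => U s ψ) (-(Complex.I • U t φ)) t := by
  have h0 := (h.generator ψ φ).1 hψ
  have h1 : HasDerivAt (fun s => U t (U s ψ)) (U t (-(Complex.I • φ))) 0 :=
    (((U t).restrictScalars ℝ).hasFDerivAt.comp_hasDerivAt (0 : ℝ) h0)
  have h2 : HasDerivAt (fun s => U t (U (s - t) ψ)) (U t (-(Complex.I • φ))) t := by
    have := HasDerivAt.comp_sub_const (x := t) (a := t) (f := fun s => U t (U s ψ))
      (f' := U t (-(Complex.I • φ))) (by simpa using h1)
    exact this
  rw [map_neg, map_smul] at h2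
  refine h2.congr_of_eventuallyEq (Eventually.of_forall fun s => ?_)
  change U s ψ = (U t * U (s - t)) ψ
  rw [← h.map_add, add_sub_cancel]

theorem apply_mem_graph (h : IsUnitaryGroup A U) {ψ φ : K} (hψ : (ψ, φ) ∈ A.graph) (t : ℝ) :
    (U t ψ, U t φ) ∈ A.graph := by
  rw [h.generator]
  have h2 : HasDerivAt (fun s => U (s + t) ψ) (-(Complex.I • U t φ)) 0 := by
    refine HasDerivAt.comp_add_const (x := 0) (a := t) (f := fun s => U s ψ) ?_
    simpa using h.hasDerivAt_apply hψ t
  refine h2.congr_of_eventuallyEq (Eventually.of_forall fun s => ?_)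
  change (U s * U t) ψ = U (s + t) ψ
  rw [← h.map_add]

/-- The norm is constant along the orbit, so the derivative of its square vanishes at time `0`. This
supplies the symmetry of `A` without assuming it. -/
theorem re_inner_generator (h : IsUnitaryGroup A U) {ψ φ : K} (hψ : (ψ, φ) ∈ A.graph) :
    (inner ℂ ψ (-(Complex.I • φ))).re = 0 := by
  let _ : InnerProductSpace ℝ K := InnerProductSpace.rclikeToReal ℂ K
  have h0 := ((h.generator ψ φ).1 hψ).norm_sq
  have h1 : (fun s => ‖U s ψ‖ ^ 2) = fun _ => ‖ψ‖ ^ 2 := by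
    funext s; rw [h.norm_apply]
  rw [h1, h.map_zero] at h0
  have h2 := h0.unique (hasDerivAt_const (0 : ℝ) (‖ψ‖ ^ 2))
  have h3 : (inner ℝ ψ (-(Complex.I • φ)) : ℝ) = (inner ℂ ψ (-(Complex.I • φ))).re := rfl
  rw [← h3]
  simpa using h2

/-- Both orbits of a domain vector stay in the domain, so their difference does too, and
`re_inner_generator` makes the derivative of its squared norm zero. Density and boundedness extend
the equality to the whole space. -/
theorem eq_of_dense (hU : IsUnitaryGroup A U) (hV : IsUnitaryGroup A V)
    (hd : Dense (A.domain : Set K)) : U = V := by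
  let _ : InnerProductSpace ℝ K := InnerProductSpace.rclikeToReal ℂ K
  funext t
  refine ContinuousLinearMap.coeFn_injective
    ((U t).continuous.ext_on hd (V t).continuous fun ψ hψ => ?_)
  have hg : (ψ, A ⟨ψ, hψ⟩) ∈ A.graph := A.mem_graph ⟨ψ, hψ⟩
  have hz : ∀ s, HasDerivAt (fun r => ‖U r ψ - V r ψ‖ ^ 2) 0 s := fun s => by
    have h1 := ((hU.hasDerivAt_apply hg s).sub (hV.hasDerivAt_apply hg s)).norm_sq
    have h2 := hU.re_inner_generator
      (A.graph.sub_mem (hU.apply_mem_graph hg s) (hV.apply_mem_graph hg s))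
    have h3 : (inner ℝ (U s ψ - V s ψ)
        (-(Complex.I • U s (A ⟨ψ, hψ⟩)) - -(Complex.I • V s (A ⟨ψ, hψ⟩))) : ℝ) = 0 := by
      rw [← h2]
      change (inner ℂ _ _).re = _
      congr 2
      simp only [smul_sub]
      abel
    change HasDerivAt (fun r => ‖U r ψ - V r ψ‖ ^ 2) (2 * inner ℝ (U s ψ - V s ψ) _) s at h1
    rwa [h3, mul_zero] at h1
  have hc := is_const_of_deriv_eq_zero (fun s => (hz s).differentiableAt)
    (fun s => (hz s).deriv) t 0
  rw [hU.map_zero, hV.map_zero] at hc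
  simpa [sub_eq_zero] using hc

/-- This turns the definition by choice into a computation: any explicit group with generator `A` is
the chosen one. -/
theorem expNegI_eq (hU : IsUnitaryGroup A U) (hd : Dense (A.domain : Set K)) :
    expNegI A = U := by
  have h : ∃ U, IsUnitaryGroup A U := ⟨U, hU⟩
  rw [expNegI, dif_pos h]
  exact h.choose_spec.eq_of_dense hU hd

end IsUnitaryGroup

theorem mem_graph_vadd (C : K →ₗ[ℂ] K) (A : K →ₗ.[ℂ] K) (ψ χ : K) :
    (ψ, χ) ∈ (C +ᵥ A).graph ↔ (ψ, χ - C ψ) ∈ A.graph := by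
  simp only [LinearPMap.mem_graph_iff]
  constructor
  · rintro ⟨y, rfl, h⟩
    refine ⟨y, rfl, ?_⟩
    change A y = χ - C (y : K)
    have h' : C (y : K) + A y = χ := h
    rw [← h', add_sub_cancel_left]
  · rintro ⟨y, rfl, h⟩
    refine ⟨y, rfl, ?_⟩
    change C (y : K) + A y = χ
    have h' : A y = χ - C (y : K) := h
    rw [h', add_sub_cancel]

/-- Multiplying a family with generator `-i A` by a norm-differentiable family of unitaries with
derivative `-i C` at `0` adds the bounded operator `C` to the generator. -/
theorem hasDerivAt_mul_iff {A : K →ₗ.[ℂ] K} {U₀ W : ℝ → K →L[ℂ] K} {C : K →L[ℂ] K}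
    (hU₀ : ∀ ψ φ, (ψ, φ) ∈ A.graph ↔ HasDerivAt (fun t => U₀ t ψ) (-(Complex.I • φ)) 0)
    (h0 : U₀ 0 = 1) (hW : HasDerivAt W (-(Complex.I • C)) 0) (hW0 : W 0 = 1)
    (hWu : ∀ t, W t ∈ unitary (K →L[ℂ] K)) (ψ χ : K) :
    (ψ, χ) ∈ ((C : K →ₗ[ℂ] K) +ᵥ A).graph ↔
      HasDerivAt (fun t => W t (U₀ t ψ)) (-(Complex.I • χ)) 0 := by
  have forward : ∀ d, HasDerivAt (fun t => U₀ t ψ) d 0 →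
      HasDerivAt (fun t => W t (U₀ t ψ)) (-(Complex.I • C ψ) + d) 0 := fun d hd => by
    have hW' : HasDerivAt (fun t => (W t).restrictScalars ℝ)
        ((-(Complex.I • C) : K →L[ℂ] K).restrictScalars ℝ) 0 :=
      (ContinuousLinearMap.restrictScalarsL ℂ K K ℝ ℝ).hasFDerivAt.comp_hasDerivAt (0 : ℝ) hW
    have := hW'.clm_apply hd
    simpa [h0, hW0] using this
  rw [mem_graph_vadd]
  constructor
  · intro h
    have h1 := forward _ ((hU₀ _ _).1 h)
    convert h1 using 1
    simp only [smul_sub, ContinuousLinearMap.coe_coe]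
    abel
  · intro h
    -- For the converse, `W` is undone by its adjoint, which is again norm-differentiable. This
    -- gives differentiability of the unperturbed orbit; its derivative is then forced by `forward`
    -- and uniqueness.
    have hs : HasDerivAt (fun t => star (W t)) (star (-(Complex.I • C))) 0 := hW.star
    have hs' : HasDerivAt (fun t => (star (W t)).restrictScalars ℝ)
        ((star (-(Complex.I • C)) : K →L[ℂ] K).restrictScalars ℝ) 0 :=
      (ContinuousLinearMap.restrictScalarsL ℂ K K ℝ ℝ).hasFDerivAt.comp_hasDerivAt (0 : ℝ) hs
    have h1 := hs'.clm_apply h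
    have h2 : (fun t => (star (W t)).restrictScalars ℝ (W t (U₀ t ψ))) = fun t => U₀ t ψ := by
      funext t
      change (star (W t) * W t) (U₀ t ψ) = _
      rw [Unitary.star_mul_self_of_mem (hWu t)]
      rfl
    rw [h2] at h1
    have h3 := (forward _ h1).unique h
    have h4 := h1
    rw [eq_sub_of_add_eq' h3] at h4
    rw [hU₀]
    convert h4 using 1
    simp only [smul_sub, ContinuousLinearMap.coe_coe]
    abel

end UnitaryGroup

/-! ## Translations and boosts on `ℓ²(ℤ)` -/

@[simp] theorem shift_apply (a : ℤ) (ψ : HS) (x : ℤ) : shift a ψ x = ψ (x + a) := rfl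

@[simp] theorem transl_apply (ψ : HS) (x : ℤ) : transl ψ x = ψ (x - 1) := rfl

theorem adjoint_shift (a : ℤ) : (shift a).adjoint = shift (-a) := by
  symm
  rw [ContinuousLinearMap.eq_adjoint_iff]
  intro ψ φ
  rw [lp.inner_eq_tsum, lp.inner_eq_tsum]
  rw [← (Equiv.addRight a).tsum_eq]
  simp

theorem adjoint_transl : transl.adjoint = shift 1 := adjoint_shift (-1)

theorem star_transl : star transl = shift 1 := adjoint_transl

theorem star_transl_mul_transl : star transl * transl = 1 := by
  rw [star_transl]; ext ψ x; simp

theorem transl_mul_star_transl : transl * star transl = 1 := by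
  rw [star_transl]; ext ψ x; simp

theorem norm_sq_eq_tsum (ψ : HS) : ‖ψ‖ ^ 2 = ∑' x, ‖ψ x‖ ^ 2 := by
  have := lp.norm_rpow_eq_tsum (p := 2) (by norm_num) ψ
  simpa using this

theorem summable_norm_sq (ψ : HS) : Summable fun x => ‖ψ x‖ ^ 2 := by
  have := (memℓp_gen_iff (p := 2) (by norm_num)).1 (lp.memℓp ψ)
  simpa using this

theorem memℓp_two_of_summable {f : ℤ → ℂ} (hf : Summable fun x => ‖f x‖ ^ 2) :
    Memℓp f 2 := memℓp_gen (by simpa using hf)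

/-- Dominated convergence in `ℓ²`, applied to the squared norm of the difference. -/
theorem tendsto_of_dominated {ι : Type*} {l : Filter ι} [l.IsCountablyGenerated] {f : ι → HS}
    {g : HS} {b : ℤ → ℝ} (hb : Summable fun x => b x ^ 2) (hfb : ∀ᶠ i in l, ∀ x, ‖f i x - g x‖ ≤ b x)
    (hf : ∀ x, Tendsto (fun i => f i x) l (𝓝 (g x))) : Tendsto f l (𝓝 g) := by
  rw [tendsto_iff_norm_sub_tendsto_zero]
  have h : Tendsto (fun i => ‖f i - g‖ ^ 2) l (𝓝 0) := by
    simp_rw [norm_sq_eq_tsum]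
    rw [← tsum_zero (α := ℝ) (β := ℤ)]
    refine tendsto_tsum_of_dominated_convergence hb (fun x => ?_) ?_
    · have h1 := tendsto_iff_norm_sub_tendsto_zero.1 (hf x)
      simpa using h1.pow 2
    · filter_upwards [hfb] with i hi x
      rw [Real.norm_of_nonneg (by positivity)]
      exact pow_le_pow_left₀ (norm_nonneg _) (hi x) 2
  have h2 := h.sqrt
  simpa [Real.sqrt_sq (norm_nonneg _)] using h2

/-- The multiplication operator `exp (i θ X)`. -/
def boost (θ : ℝ) : HS →L[ℂ] HS :=
  LinearMap.mkContinuous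
    { toFun := fun ψ => ⟨fun x => Complex.exp (Complex.I * ((θ * x : ℝ) : ℂ)) * ψ x,
        memℓp_two_of_summable (by
          simpa only [norm_mul, Complex.norm_exp_I_mul_ofReal, one_mul] using summable_norm_sq ψ)⟩
      map_add' := fun ψ φ => by ext x; exact mul_add _ _ _
      map_smul' := fun c ψ => by ext x; exact mul_left_comm _ _ _ } 1 (fun ψ => by
        rw [one_mul, lp.norm_eq_tsum_rpow (by norm_num), lp.norm_eq_tsum_rpow (by norm_num)]
        refine le_of_eq (congrArg (fun r : ℝ => r ^ (1 / (2 : ℝ≥0∞).toReal)) (tsum_congr fun x => ?_))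
        change ‖Complex.exp (Complex.I * ((θ * x : ℝ) : ℂ)) * ψ x‖ ^ _ = _
        rw [norm_mul, Complex.norm_exp_I_mul_ofReal, one_mul])

@[simp] theorem boost_apply (θ : ℝ) (ψ : HS) (x : ℤ) :
    boost θ ψ x = Complex.exp (Complex.I * ((θ * x : ℝ) : ℂ)) * ψ x := rfl

theorem boost_zero : boost 0 = 1 := by ext ψ x; simp

theorem boost_add (s t : ℝ) : boost (s + t) = boost s * boost t := by
  ext ψ x
  change boost (s + t) ψ x = boost s (boost t ψ) x
  simp only [boost_apply, ← mul_assoc, ← Complex.exp_add]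
  congr 2
  push_cast
  ring

theorem star_boost (θ : ℝ) : star (boost θ) = boost (-θ) := by
  symm
  rw [ContinuousLinearMap.star_eq_adjoint, ContinuousLinearMap.eq_adjoint_iff]
  intro ψ φ
  rw [lp.inner_eq_tsum, lp.inner_eq_tsum]
  refine tsum_congr fun x => ?_
  simp only [boost_apply, RCLike.inner_apply, map_mul, ← Complex.exp_conj, Complex.conj_I,
    Complex.conj_ofReal]
  rw [show -Complex.I * ((-θ * x : ℝ) : ℂ) = Complex.I * ((θ * x : ℝ) : ℂ) by push_cast; ring]
  ring

theorem boost_mem_unitary (θ : ℝ) : boost θ ∈ unitary (HS →L[ℂ] HS) := by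
  rw [Unitary.mem_iff, star_boost, ← boost_add, ← boost_add]
  simp [boost_zero]

theorem boost_mul_transl (θ : ℝ) :
    boost θ * transl = Complex.exp (Complex.I * θ) • (transl * boost θ) := by
  ext ψ x
  change boost θ (transl ψ) x = Complex.exp (Complex.I * θ) * transl (boost θ ψ) x
  simp only [boost_apply, transl_apply, ← mul_assoc, ← Complex.exp_add]
  congr 2
  push_cast
  ring

theorem continuous_boost_apply (ψ : HS) : Continuous fun θ => boost θ ψ := by
  rw [continuous_iff_continuousAt]
  intro θ₀
  refine tendsto_of_dominated (b := fun x => 2 * ‖ψ x‖) ?_ (Eventually.of_forall fun θ x => ?_)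
    fun x => ?_
  · simpa [mul_pow] using (summable_norm_sq ψ).mul_left (2 ^ 2)
  · refine (norm_sub_le _ _).trans ?_
    rw [boost_apply, boost_apply, norm_mul, norm_mul, Complex.norm_exp_I_mul_ofReal,
      Complex.norm_exp_I_mul_ofReal]
    linarith
  · simp only [boost_apply]
    exact Continuous.tendsto (by fun_prop) θ₀

theorem mem_graph_position (ψ φ : HS) :
    (ψ, φ) ∈ position.graph ↔ ∀ x : ℤ, φ x = x * ψ x := by
  rw [LinearPMap.mem_graph_iff]
  constructor
  · rintro ⟨y, rfl, rfl⟩ x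
    rfl
  · intro h
    have h' : (φ : ℤ → ℂ) = fun x : ℤ => (x : ℂ) * ψ x := funext h
    refine ⟨⟨ψ, ?_⟩, rfl, ?_⟩
    · change Memℓp (fun x : ℤ => (x : ℂ) * ψ x) 2
      rw [← h']
      exact lp.memℓp φ
    · ext x
      exact (h x).symm

/-- On the domain, `|exp (i t x) - 1| ≤ |t x|` bounds the difference quotients by the `ℓ²` sequence
`|φ|`. Conversely, the derivative can be read off at each site, and its membership in `ℓ²` is
precisely what puts `ψ` in the maximal domain. -/
theorem mem_graph_position_iff_hasDerivAt (ψ φ : HS) :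
    (ψ, φ) ∈ position.graph ↔ HasDerivAt (fun θ => boost θ ψ) (Complex.I • φ) 0 := by
  have hpt : ∀ x : ℤ, HasDerivAt (fun θ : ℝ => boost θ ψ x) (Complex.I * (x * ψ x)) 0 := by
    intro x
    have h1 : HasDerivAt (fun θ : ℝ => Complex.I * ((θ * x : ℝ) : ℂ)) (Complex.I * x) 0 := by
      have := ((hasDerivAt_id (0 : ℝ)).mul_const (x : ℝ)).ofReal_comp.const_mul Complex.I
      simpa using this
    have h2 := h1.cexp.mul_const (ψ x)
    simpa [mul_assoc] using h2
  rw [mem_graph_position]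
  constructor
  · intro h
    rw [hasDerivAt_iff_tendsto_slope_zero]
    refine tendsto_of_dominated (b := fun x => 2 * ‖φ x‖) ?_ ?_ fun x => ?_
    · simpa [mul_pow] using (summable_norm_sq φ).mul_left (2 ^ 2)
    · filter_upwards [self_mem_nhdsWithin] with t ht x
      have ht' : t ≠ 0 := ht
      refine (norm_sub_le _ _).trans ?_
      have e1 : (t⁻¹ • (boost (0 + t) ψ - boost 0 ψ)) x
          = t⁻¹ • ((Complex.exp (Complex.I * ((t * x : ℝ) : ℂ)) - 1) * ψ x) := by
        rw [boost_zero, zero_add, sub_mul, one_mul]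
        rfl
      have e2 := Real.norm_exp_I_mul_ofReal_sub_one_le (x := t * x)
      rw [e1, norm_smul, norm_inv]
      have e3 : ‖(Complex.I • φ) x‖ = ‖φ x‖ := by simp
      rw [e3]
      have e4 : ‖φ x‖ = ‖(x : ℝ)‖ * ‖ψ x‖ := by rw [h x]; simp
      have e5 : ‖t‖⁻¹ * ‖(Complex.exp (Complex.I * ((t * x : ℝ) : ℂ)) - 1) * ψ x‖
          ≤ ‖t‖⁻¹ * ((‖t‖ * ‖(x : ℝ)‖) * ‖ψ x‖) := by
        rw [norm_mul]
        rw [norm_mul] at e2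
        gcongr
      rw [mul_assoc, inv_mul_cancel_left₀ (norm_ne_zero_iff.2 ht'), ← e4] at e5
      linarith
    · have := (hasDerivAt_iff_tendsto_slope_zero.1 (hpt x))
      rw [← h x] at this
      exact this
  · intro h x
    have h1 : HasDerivAt (fun θ : ℝ => boost θ ψ x) ((Complex.I • φ) x) 0 := by
      have := ((lp.evalCLM ℂ (fun _ : ℤ => ℂ) 2 x).restrictScalars ℝ).hasFDerivAt.comp_hasDerivAt
        (0 : ℝ) h
      exact this
    have h2 := h1.unique (hpt x)
    exact mul_left_cancel₀ Complex.I_ne_zero h2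

/-- A nonzero `F` is essential: at `F = 0` the left side would keep the domain of `X`, whereas the
constant orbit on the right is differentiable for every vector. -/
theorem mem_graph_neg_smul_position {F : ℝ} (hF : F ≠ 0) (ψ φ : HS) :
    (ψ, φ) ∈ (-((F : ℂ) • position)).graph ↔
      HasDerivAt (fun t => boost (F * t) ψ) (-(Complex.I • φ)) 0 := by
  have hFc : (F : ℂ) ≠ 0 := by exact_mod_cast hF
  have h1 : (ψ, φ) ∈ (-((F : ℂ) • position)).graph ↔ (ψ, -((F : ℂ)⁻¹ • φ)) ∈ position.graph := by
    rw [LinearPMap.mem_graph_iff, LinearPMap.mem_graph_iff]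
    constructor
    · rintro ⟨y, rfl, h⟩
      refine ⟨y, rfl, ?_⟩
      have h' : -((F : ℂ) • position y) = φ := h
      simp only [← h', smul_neg, neg_neg, smul_smul, inv_mul_cancel₀ hFc, one_smul]
    · rintro ⟨y, rfl, h⟩
      refine ⟨y, rfl, ?_⟩
      change -((F : ℂ) • position y) = φ
      have h' : position y = -((F : ℂ)⁻¹ • φ) := h
      simp only [h', smul_neg, neg_neg, smul_smul, mul_inv_cancel₀ hFc, one_smul]
  rw [h1, mem_graph_position_iff_hasDerivAt]
  have hs : ∀ (c : ℝ) (f : ℝ → HS) (f' : HS), HasDerivAt f f' 0 →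
      HasDerivAt (fun t => f (c * t)) ((c : ℂ) • f') 0 := fun c f f' h => by
    have h2 : HasDerivAt (fun t : ℝ => c * t) c 0 := by
      simpa using (hasDerivAt_id (0 : ℝ)).const_mul c
    have h3 := HasDerivAt.scomp (h := fun t : ℝ => c * t) (0 : ℝ) (by simpa using h) h2
    exact h3
  constructor
  · intro h
    convert hs F _ _ h using 1
    simp only [smul_neg, smul_smul]
    congr 2
    field_simp
  · intro h
    have := hs F⁻¹ _ _ h
    simp only [mul_inv_cancel_left₀ hF] at this
    convert this using 1
    simp only [smul_neg, smul_smul]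
    push_cast
    rw [mul_comm]

/-! ## The Wannier–Stark propagator -/

theorem boost_mul_star_transl (θ : ℝ) :
    boost θ * star transl = Complex.exp (-(Complex.I * θ)) • (star transl * boost θ) := by
  rw [star_transl]
  ext ψ x
  change boost θ (shift 1 ψ) x = Complex.exp (-(Complex.I * θ)) * shift 1 (boost θ ψ) x
  simp only [boost_apply, shift_apply, ← mul_assoc, ← Complex.exp_add]
  congr 2
  push_cast
  ring

theorem boost_mul_boost_neg (θ : ℝ) : boost θ * boost (-θ) = 1 := by
  rw [← boost_add, add_neg_cancel, boost_zero]

theorem boost_neg_mul_boost (θ : ℝ) : boost (-θ) * boost θ = 1 := by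
  rw [← boost_add, neg_add_cancel, boost_zero]

theorem boost_conj_exp (θ : ℝ) (Y : HS →L[ℂ] HS) :
    boost θ * NormedSpace.exp Y * boost (-θ) = NormedSpace.exp (boost θ * Y * boost (-θ)) := by
  let _ : NormedAlgebra ℚ (HS →L[ℂ] HS) := NormedAlgebra.restrictScalars ℚ ℂ _
  exact (NormedSpace.exp_units_conj
    (⟨boost θ, boost (-θ), boost_mul_boost_neg θ, boost_neg_mul_boost θ⟩ : (HS →L[ℂ] HS)ˣ) Y).symm

/-- The hopping operator `a T* + b T`. -/
def hop (a b : ℂ) : HS →L[ℂ] HS := a • star transl + b • transl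

theorem commute_transl_star_transl : Commute transl (star transl) := by
  rw [Commute, SemiconjBy, transl_mul_star_transl, star_transl_mul_transl]

theorem commute_transl_hop (a b : ℂ) : Commute transl (hop a b) :=
  (commute_transl_star_transl.smul_right a).add_right ((Commute.refl transl).smul_right b)

theorem commute_star_transl_hop (a b : ℂ) : Commute (star transl) (hop a b) :=
  ((Commute.refl _).smul_right a).add_right (commute_transl_star_transl.symm.smul_right b)

theorem commute_hop (a b c d : ℂ) : Commute (hop a b) (hop c d) :=
  ((commute_star_transl_hop c d).smul_left a).add_left ((commute_transl_hop c d).smul_left b)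

theorem hop_add (a b c d : ℂ) : hop a b + hop c d = hop (a + c) (b + d) := by
  simp only [hop, add_smul]; abel

theorem star_hop (a b : ℂ) : star (hop a b) = hop (star b) (star a) := by
  simp only [hop, star_add, star_smul, star_star]; abel

theorem boost_conj_hop (θ : ℝ) (a b : ℂ) : boost θ * hop a b * boost (-θ) =
    hop (a * Complex.exp (-(Complex.I * θ))) (b * Complex.exp (Complex.I * θ)) := by
  simp only [hop, mul_add, add_mul, mul_smul_comm, smul_mul_assoc, boost_mul_transl,
    boost_mul_star_transl, mul_assoc, boost_mul_boost_neg, mul_one, smul_smul]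

/-- The unitary `exp ((T* - T) / F)`, which diagonalises the Hamiltonian of the particle. -/
def gauge (F : ℝ) : HS →L[ℂ] HS := NormedSpace.exp (hop (F : ℂ)⁻¹ (-(F : ℂ)⁻¹))

theorem star_gauge (F : ℝ) : star (gauge F) = NormedSpace.exp (hop (-(F : ℂ)⁻¹) (F : ℂ)⁻¹) := by
  rw [gauge, NormedSpace.star_exp, star_hop]
  simp

theorem gauge_mem_unitary (F : ℝ) : gauge F ∈ unitary (HS →L[ℂ] HS) := by
  let _ : NormedAlgebra ℚ (HS →L[ℂ] HS) := NormedAlgebra.restrictScalars ℚ ℂ _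
  refine NormedSpace.exp_mem_unitary_of_mem_skewAdjoint ?_
  rw [skewAdjoint.mem_iff, star_hop]
  simp only [Complex.star_def]
  simp only [hop, map_neg, map_inv₀, Complex.conj_ofReal, neg_add_rev, neg_smul, neg_neg]
  abel

/-- The propagator `exp (-i t h_S)`. -/
def stark (F t : ℝ) : HS →L[ℂ] HS :=
  Complex.exp (-(2 * Complex.I * t)) • (gauge F * boost (F * t) * star (gauge F))

/-- The propagator `exp (-i t h_S)` with the boost `exp (i t F X)` split off. -/
def starkFactor (F t : ℝ) : HS →L[ℂ] HS :=
  Complex.exp (-(2 * Complex.I * t)) • NormedSpace.exp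
    (hop ((F : ℂ)⁻¹ * (1 - Complex.exp (-(Complex.I * (F * t : ℝ)))))
      ((F : ℂ)⁻¹ * (Complex.exp (Complex.I * (F * t : ℝ)) - 1)))

/-- Moving the boost through the adjoint of `gauge` only multiplies the hopping coefficients by
phases. Hopping operators commute, so the two exponents add. `stark` displays the group law; the
factored form displays the generator, and its exponent is periodic in `t` (Bloch oscillations). -/
theorem stark_eq (F t : ℝ) : stark F t = starkFactor F t * boost (F * t) := by
  have h : gauge F * (boost (F * t) * star (gauge F) * boost (-(F * t))) = NormedSpace.exp
    (hop ((F : ℂ)⁻¹ * (1 - Complex.exp (-(Complex.I * (F * t : ℝ)))))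
      ((F : ℂ)⁻¹ * (Complex.exp (Complex.I * (F * t : ℝ)) - 1))) := by
    let _ : NormedAlgebra ℚ (HS →L[ℂ] HS) := NormedAlgebra.restrictScalars ℚ ℂ _
    rw [star_gauge, boost_conj_exp, boost_conj_hop, gauge,
      ← NormedSpace.exp_add_of_commute (commute_hop _ _ _ _), hop_add]
    congr 2 <;> ring
  rw [stark, starkFactor, ← h, smul_mul_assoc]
  simp only [mul_assoc, boost_neg_mul_boost, mul_one]

theorem smul_mem_unitary {K : Type*} [NormedAddCommGroup K] [InnerProductSpace ℂ K]
    [CompleteSpace K] {V : K →L[ℂ] K} (hV : V ∈ unitary (K →L[ℂ] K)) {c : ℂ} (hc : ‖c‖ = 1) :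
    c • V ∈ unitary (K →L[ℂ] K) := by
  have h : star c * c = 1 := by
    rw [Complex.star_def, Complex.conj_mul', hc]; simp
  rw [Unitary.mem_iff] at *
  rw [star_smul, smul_mul_smul_comm, smul_mul_smul_comm, mul_comm c, h, hV.1, hV.2]
  simp

theorem norm_exp_neg_two_I_mul (t : ℝ) : ‖Complex.exp (-(2 * Complex.I * t))‖ = 1 := by
  have := Complex.norm_exp_ofReal_mul_I (-(2 * t))
  rw [← this]; congr 2; push_cast; ring

theorem stark_mem_unitary (F t : ℝ) : stark F t ∈ unitary (HS →L[ℂ] HS) :=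
  smul_mem_unitary (mul_mem (mul_mem (gauge_mem_unitary F) (boost_mem_unitary _))
    (Unitary.star_mem (gauge_mem_unitary F))) (norm_exp_neg_two_I_mul t)

theorem starkFactor_mem_unitary (F t : ℝ) : starkFactor F t ∈ unitary (HS →L[ℂ] HS) := by
  have h : starkFactor F t = stark F t * boost (-(F * t)) := by
    rw [stark_eq, mul_assoc, boost_mul_boost_neg, mul_one]
  rw [h]
  exact mul_mem (stark_mem_unitary F t) (boost_mem_unitary _)

theorem stark_zero (F : ℝ) : stark F 0 = 1 := by
  simp [stark, boost_zero, Unitary.mul_star_self_of_mem (gauge_mem_unitary F)]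

theorem stark_add (F s t : ℝ) : stark F (s + t) = stark F s * stark F t := by
  simp only [stark, smul_mul_smul_comm, ← Complex.exp_add]
  congr 1
  · congr 1; push_cast; ring
  · rw [mul_add, boost_add]
    have := Unitary.star_mul_self_of_mem (gauge_mem_unitary F)
    calc _ = gauge F * boost (F * s) * 1 * boost (F * t) * star (gauge F) := by
          simp only [mul_one, mul_assoc]
      _ = _ := by rw [← this]; simp only [mul_assoc]

theorem continuous_stark_apply (F : ℝ) (ψ : HS) : Continuous fun t => stark F t ψ := by
  have h : ∀ t, stark F t ψ = Complex.exp (-(2 * Complex.I * t)) •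
      gauge F (boost (F * t) (star (gauge F) ψ)) := fun t => rfl
  simp only [h]
  have h1 : Continuous fun t : ℝ => boost (F * t) (star (gauge F) ψ) :=
    (continuous_boost_apply (star (gauge F) ψ)).comp (by fun_prop : Continuous fun t : ℝ => F * t)
  exact (by fun_prop : Continuous fun t : ℝ => Complex.exp (-(2 * Complex.I * t))).smul
    ((gauge F).continuous.comp h1)

/-- Both hopping coefficients have derivative `i` at `0`, contributing `i (T + T*)`; the scalar
phase contributes `-2i`. Together these form `-i (2 - T - T*)`. -/
theorem hasDerivAt_starkFactor {F : ℝ} (hF : F ≠ 0) :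
    HasDerivAt (starkFactor F) (-(Complex.I • negLaplacian)) 0 := by
  have hFc : (F : ℂ) ≠ 0 := by exact_mod_cast hF
  have hlin : HasDerivAt (fun t : ℝ => Complex.I * ((F * t : ℝ) : ℂ)) (Complex.I * F) 0 := by
    have := ((hasDerivAt_id (0 : ℝ)).const_mul F).ofReal_comp.const_mul Complex.I
    simpa using this
  have ha : HasDerivAt (fun t : ℝ => (F : ℂ)⁻¹ * (1 - Complex.exp (-(Complex.I * (F * t : ℝ)))))
      Complex.I 0 := by
    have := (hlin.neg.cexp.const_sub 1).const_mul (F : ℂ)⁻¹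
    refine this.congr_deriv ?_
    simp
    field_simp
  have hb : HasDerivAt (fun t : ℝ => (F : ℂ)⁻¹ * (Complex.exp (Complex.I * (F * t : ℝ)) - 1))
      Complex.I 0 := by
    have := (hlin.cexp.sub_const 1).const_mul (F : ℂ)⁻¹
    refine this.congr_deriv ?_
    simp
    field_simp
  have hB := (ha.smul_const (star transl)).add (hb.smul_const transl)
  have hexp0 := hasFDerivAt_exp_zero (𝕂 := ℝ) (𝔸 := HS →L[ℂ] HS)
  rw [show (0 : HS →L[ℂ] HS) = hop ((F : ℂ)⁻¹ * (1 - Complex.exp (-(Complex.I * (F * 0 : ℝ)))))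
      ((F : ℂ)⁻¹ * (Complex.exp (Complex.I * (F * 0 : ℝ)) - 1)) by simp [hop]] at hexp0
  have hexp := hexp0.comp_hasDerivAt (0 : ℝ) hB
  have hph : HasDerivAt (fun t : ℝ => Complex.exp (-(2 * Complex.I * t))) (-(2 * Complex.I)) 0 := by
    have h1 : HasDerivAt (fun t : ℝ => -(2 * Complex.I * (t : ℂ))) (-(2 * Complex.I)) 0 := by
      have := ((hasDerivAt_id (0 : ℝ)).ofReal_comp.const_mul (2 * Complex.I)).neg
      simp only [Complex.ofReal_one, mul_one] at this
      exact this
    simpa using h1.cexp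
  have := hph.smul hexp
  refine this.congr_deriv ?_
  simp [negLaplacian, smul_sub, smul_smul, ContinuousLinearMap.star_eq_adjoint]
  change Complex.I • transl.adjoint + Complex.I • transl + -((2 * Complex.I) • 1) = _
  module

theorem starkFactor_zero (F : ℝ) : starkFactor F 0 = 1 := by
  simp [starkFactor, hop]

theorem mem_graph_hamS {F : ℝ} (hF : F ≠ 0) (ψ φ : HS) :
    (ψ, φ) ∈ (hamS F).graph ↔ HasDerivAt (fun t => stark F t ψ) (-(Complex.I • φ)) 0 := by
  have := hasDerivAt_mul_iff (U₀ := fun t => boost (F * t)) (mem_graph_neg_smul_position hF)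
    (by simp [boost_zero]) (hasDerivAt_starkFactor hF) (starkFactor_zero F)
    (starkFactor_mem_unitary F) ψ φ
  simp only [stark_eq]
  exact this

theorem commute_transl_gauge (F : ℝ) : Commute transl (gauge F) :=
  (commute_transl_hop _ _).exp_right

theorem commute_transl_star_gauge (F : ℝ) : Commute transl (star (gauge F)) := by
  rw [star_gauge]
  exact (commute_transl_hop _ _).exp_right

/-- `gauge` is a function of `T` and `T*`, hence commutes with `T`; only the boost produces a phase.
This covariance is behind both the decoupling by `twist` and the commutation of jumps with the free
evolution. -/
theorem stark_mul_transl (F t : ℝ) :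
    stark F t * transl = Complex.exp (Complex.I * (F * t : ℝ)) • (transl * stark F t) := by
  rw [stark, smul_mul_assoc, mul_smul_comm, smul_comm (Complex.exp (Complex.I * _))]
  congr 1
  rw [mul_assoc, ← (commute_transl_star_gauge F).eq]
  calc _ = gauge F * (boost (F * t) * transl) * star (gauge F) := by simp only [mul_assoc]
    _ = Complex.exp (Complex.I * (F * t : ℝ)) • ((gauge F * transl) * boost (F * t) *
        star (gauge F)) := by
      rw [boost_mul_transl, mul_smul_comm, smul_mul_assoc]; simp only [mul_assoc]
    _ = _ := by rw [← (commute_transl_gauge F).eq]; simp only [mul_assoc]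

/-! ## Operators on the coupled space -/

@[simp] theorem bra_apply (σ : Fin 2) (Ψ : HTot) : bra σ Ψ = Ψ σ := rfl

theorem bra_incl (σ σ' : Fin 2) (ψ : HS) : bra σ (incl σ' ψ) = if σ = σ' then ψ else 0 := by
  have h : incl σ' ψ = WithLp.toLp 2 (Pi.single σ' ψ) := by
    refine ext_inner_left ℂ fun Φ => ?_
    rw [incl, ContinuousLinearMap.adjoint_inner_right, PiLp.inner_apply,
      Finset.sum_eq_single σ']
    · simp
    · intro b _ hb
      simp [hb]
    · simp
  rw [h, bra_apply]
  simp [Pi.single_apply]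

theorem sum_incl_bra (Ψ : HTot) : ∑ σ, incl σ (bra σ Ψ) = Ψ := by
  refine ext_inner_left ℂ fun Φ => ?_
  rw [inner_sum, PiLp.inner_apply]
  refine Finset.sum_congr rfl fun σ _ => ?_
  rw [incl, ContinuousLinearMap.adjoint_inner_right]
  rfl

theorem clm_ext_bra {V W : HTot →L[ℂ] HTot} (h : ∀ σ Ψ, bra σ (V Ψ) = bra σ (W Ψ)) : V = W := by
  ext1 Ψ
  rw [← sum_incl_bra (V Ψ), ← sum_incl_bra (W Ψ)]
  simp only [h]

theorem bra_tens (A : HS →L[ℂ] HS) (B : Matrix (Fin 2) (Fin 2) ℂ) (σ : Fin 2) (Ψ : HTot) :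
    bra σ (tens A B Ψ) = ∑ σ', B σ σ' • A (bra σ' Ψ) := by
  have h : tens A B Ψ = ∑ σ, ∑ σ', B σ σ' • incl σ (A (bra σ' Ψ)) := by
    simp [tens]
  rw [h, map_sum]
  simp only [map_sum, map_smul, bra_incl]
  rw [Finset.sum_eq_single σ]
  · simp
  · intro b _ hb
    simp [Ne.symm hb]
  · simp

theorem tens_mul_tens (A A' : HS →L[ℂ] HS) (B B' : Matrix (Fin 2) (Fin 2) ℂ) :
    tens A B * tens A' B' = tens (A * A') (B * B') := by
  refine clm_ext_bra fun σ Ψ => ?_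
  change bra σ (tens A B (tens A' B' Ψ)) = _
  simp only [bra_tens, map_sum, map_smul, Matrix.mul_apply, Finset.sum_smul, Finset.smul_sum,
    smul_smul]
  rw [Finset.sum_comm]
  rfl

theorem star_tens (A : HS →L[ℂ] HS) (B : Matrix (Fin 2) (Fin 2) ℂ) :
    star (tens A B) = tens (star A) Bᴴ := by
  symm
  rw [ContinuousLinearMap.star_eq_adjoint, ContinuousLinearMap.star_eq_adjoint,
    ContinuousLinearMap.eq_adjoint_iff]
  intro Ψ Φ
  have h1 : ∀ σ, (tens A.adjoint Bᴴ Ψ) σ = _ := fun σ => bra_tens A.adjoint Bᴴ σ Ψ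
  have h2 : ∀ σ, (tens A B Φ) σ = _ := fun σ => bra_tens A B σ Φ
  simp only [PiLp.inner_apply, h1, h2, sum_inner, inner_sum, inner_smul_left, inner_smul_right,
    ContinuousLinearMap.adjoint_inner_left, Matrix.conjTranspose_apply]
  rw [Finset.sum_comm]
  simp

theorem tens_one_one : tens 1 1 = 1 := by
  refine clm_ext_bra fun σ Ψ => ?_
  rw [bra_tens]
  simp [Matrix.one_apply]

theorem tens_smul (A : HS →L[ℂ] HS) (c : ℂ) (B : Matrix (Fin 2) (Fin 2) ℂ) :
    tens A (c • B) = c • tens A B := by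
  simp [tens, smul_smul]

theorem tens_mem_unitary {A : HS →L[ℂ] HS} {B : Matrix (Fin 2) (Fin 2) ℂ}
    (hA : A ∈ unitary (HS →L[ℂ] HS)) (hB : Bᴴ * B = 1) (hB' : B * Bᴴ = 1) :
    tens A B ∈ unitary (HTot →L[ℂ] HTot) := by
  rw [Unitary.mem_iff, star_tens, tens_mul_tens, tens_mul_tens, hB, hB',
    Unitary.star_mul_self_of_mem hA, Unitary.mul_star_self_of_mem hA, tens_one_one]
  simp

theorem hasDerivAt_iff_bra {f : ℝ → HTot} {f' : HTot} {t : ℝ} :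
    HasDerivAt f f' t ↔ ∀ σ, HasDerivAt (fun s => bra σ (f s)) (bra σ f') t := by
  constructor
  · intro h σ
    exact ((bra σ).restrictScalars ℝ).hasFDerivAt.comp_hasDerivAt t h
  · intro h
    have h1 := HasDerivAt.fun_sum (u := Finset.univ) fun σ _ =>
      ((incl σ).restrictScalars ℝ).hasFDerivAt.comp_hasDerivAt t (h σ)
    have h2 : (fun s => ∑ σ, (((incl σ).restrictScalars ℝ) ∘ fun s => bra σ (f s)) s) = f :=
      funext fun s => sum_incl_bra (f s)
    rw [h2] at h1
    exact h1.congr_deriv (sum_incl_bra f')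

theorem mem_graph_ampl (A : HS →ₗ.[ℂ] HS) (Ψ Φ : HTot) :
    (Ψ, Φ) ∈ (ampl A).graph ↔ ∀ σ, (bra σ Ψ, bra σ Φ) ∈ A.graph := by
  simp only [LinearPMap.mem_graph_iff]
  constructor
  · rintro ⟨y, rfl, rfl⟩ σ
    exact ⟨⟨bra σ (y : HTot), y.2 σ⟩, rfl, rfl⟩
  · intro h
    have hd : ∀ σ, bra σ Ψ ∈ A.domain := fun σ => by
      obtain ⟨y, hy, -⟩ := h σ
      exact hy ▸ y.2
    refine ⟨⟨Ψ, hd⟩, rfl, ?_⟩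
    ext1 σ
    obtain ⟨y, hy, hy'⟩ := h σ
    rw [← bra_apply σ Φ]
    refine Eq.trans ?_ hy'
    exact congrArg A (Subtype.ext hy.symm)

theorem bra_tens_one (A : HS →L[ℂ] HS) (σ : Fin 2) (Ψ : HTot) :
    bra σ (tens A 1 Ψ) = A (bra σ Ψ) := by
  rw [bra_tens]; simp [Matrix.one_apply]

theorem mem_graph_ampl_hamS {F : ℝ} (hF : F ≠ 0) (Ψ Φ : HTot) :
    (Ψ, Φ) ∈ (ampl (hamS F)).graph ↔
      HasDerivAt (fun t => tens (stark F t) 1 Ψ) (-(Complex.I • Φ)) 0 := by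
  rw [mem_graph_ampl, hasDerivAt_iff_bra]
  simp only [mem_graph_hamS hF, bra_tens_one, map_neg, map_smul]

/-- Finitely supported truncations lie in the domain and converge to the given vector. -/
theorem dense_domain_hamTot (E F lam : ℝ) : Dense ((hamTot E F lam).domain : Set HTot) := by
  intro Ψ
  have h1 : Tendsto (fun s : Finset ℤ => ∑ σ, incl σ (∑ x ∈ s, lp.single 2 x (bra σ Ψ x))) atTop
      (𝓝 (∑ σ, incl σ (bra σ Ψ))) :=
    tendsto_finsetSum _ fun σ _ => ((incl σ).continuous.tendsto _).comp
      (lp.hasSum_single (by norm_num) (bra σ Ψ))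
  rw [sum_incl_bra] at h1
  refine mem_closure_of_tendsto h1 (Eventually.of_forall fun s => ?_)
  change ∀ σ, bra σ _ ∈ position.domain
  intro σ
  rw [map_sum]
  refine Submodule.sum_mem _ fun σ' _ => ?_
  rw [bra_incl]
  split_ifs
  · refine Submodule.sum_mem _ fun x _ => ?_
    have hx : (lp.single 2 x (bra σ' Ψ x), lp.single 2 x ((x : ℂ) * bra σ' Ψ x)) ∈
        position.graph := by
      rw [mem_graph_position]
      intro y
      by_cases hxy : y = x
      · subst hxy; simp
      · simp [lp.single_apply, hxy]
    obtain ⟨y, hy, -⟩ := (LinearPMap.mem_graph_iff _).1 hx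
    have hy' : (y : HS) = lp.single 2 x (bra σ' Ψ x) := hy
    exact hy' ▸ y.2
  · exact Submodule.zero_mem _

/-! ## The propagator of the coupled system -/

theorem rabi_pos (E F : ℝ) {lam : ℝ} (hlam : lam ≠ 0) : 0 < rabi E F lam := by
  unfold rabi; positivity

theorem rabi_sq (E F lam : ℝ) : rabi E F lam ^ 2 = (E - F) ^ 2 + 4 * lam ^ 2 :=
  Real.sq_sqrt (by positivity)

/-- The matrix `exp (-i t M)` for `M = !![0, lam; lam, E - F]`. -/
def rabiMat (E F lam t : ℝ) : Matrix (Fin 2) (Fin 2) ℂ :=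
  let c : ℂ := (Real.cos (rabi E F lam * t / 2) : ℝ)
  let s : ℂ := (Real.sin (rabi E F lam * t / 2) : ℝ)
  let d : ℂ := (((E - F) / rabi E F lam : ℝ) : ℂ)
  let l : ℂ := ((2 * lam / rabi E F lam : ℝ) : ℂ)
  Complex.exp (-(Complex.I * (((E - F) * t / 2 : ℝ) : ℂ))) •
    !![c + Complex.I * d * s, -(Complex.I * l * s); -(Complex.I * l * s), c - Complex.I * d * s]

theorem rabi_normalization (E F : ℝ) {lam : ℝ} (hlam : lam ≠ 0) :
    ((E - F) / rabi E F lam) ^ 2 + (2 * lam / rabi E F lam) ^ 2 = 1 := by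
  have h := rabi_pos E F hlam
  have h2 := rabi_sq E F lam
  rw [div_pow, div_pow, ← add_div, div_eq_one_iff_eq (by positivity), h2]
  ring

theorem rabiMat_zero (E F lam : ℝ) : rabiMat E F lam 0 = 1 := by
  ext i j
  fin_cases i <;> fin_cases j <;> simp [rabiMat]

/-- Up to a phase the matrix is `cos - i sin N`, where `N` has diagonal `-d, d` and off-diagonal
`l`. Since `d ^ 2 + l ^ 2 = 1`, `N` squares to the identity and the addition formulas give the group
law. -/
theorem rabiMat_add (E F : ℝ) {lam : ℝ} (hlam : lam ≠ 0) (s t : ℝ) :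
    rabiMat E F lam (s + t) = rabiMat E F lam s * rabiMat E F lam t := by
  have hn : (((E - F) / rabi E F lam : ℝ) : ℂ) ^ 2 + ((2 * lam / rabi E F lam : ℝ) : ℂ) ^ 2 = 1 := by
    exact_mod_cast rabi_normalization E F hlam
  have hI := Complex.I_sq
  simp only [rabiMat]
  rw [smul_mul_smul_comm, ← Complex.exp_add,
    show rabi E F lam * (s + t) / 2 = rabi E F lam * s / 2 + rabi E F lam * t / 2 by ring,
    Real.cos_add, Real.sin_add]
  generalize (((E - F) / rabi E F lam : ℝ) : ℂ) = d at *
  generalize ((2 * lam / rabi E F lam : ℝ) : ℂ) = l at *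
  congr 1
  · congr 1; push_cast; ring
  · rw [Matrix.mul_fin_two]
    push_cast
    generalize Complex.cos (rabi E F lam * s / 2) = c₁
    generalize Complex.cos (rabi E F lam * t / 2) = c₂
    generalize Complex.sin (rabi E F lam * s / 2) = s₁
    generalize Complex.sin (rabi E F lam * t / 2) = s₂
    ext i j
    fin_cases i <;> fin_cases j <;> simp
    · linear_combination (s₁ * s₂) * hn + (-(d ^ 2 + l ^ 2) * s₁ * s₂) * hI
    · linear_combination (0 : ℂ) * hI
    · linear_combination (0 : ℂ) * hI
    · linear_combination (s₁ * s₂) * hn + (-(d ^ 2 + l ^ 2) * s₁ * s₂) * hI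

theorem conjTranspose_rabiMat (E F lam t : ℝ) :
    (rabiMat E F lam t)ᴴ = rabiMat E F lam (-t) := by
  have h : ∀ x : ℝ, star (Complex.exp (-(Complex.I * (x : ℂ)))) =
      Complex.exp (-(Complex.I * ((-x : ℝ) : ℂ))) := fun x => by
    rw [Complex.star_def, ← Complex.exp_conj]; simp
  simp only [rabiMat, Matrix.conjTranspose_smul, h]
  rw [show (E - F) * -t / 2 = -((E - F) * t / 2) by ring,
    show rabi E F lam * -t / 2 = -(rabi E F lam * t / 2) by ring, Real.cos_neg, Real.sin_neg]
  congr 1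
  ext i j
  fin_cases i <;> fin_cases j <;>
    simp [Matrix.conjTranspose_apply, -Complex.ofReal_div, -Complex.ofReal_sub,
      -Complex.ofReal_cos, -Complex.ofReal_sin, -Complex.ofReal_mul]

theorem rabiMat_mul_neg (E F : ℝ) {lam : ℝ} (hlam : lam ≠ 0) (t : ℝ) :
    rabiMat E F lam t * rabiMat E F lam (-t) = 1 := by
  rw [← rabiMat_add E F hlam, add_neg_cancel, rabiMat_zero]

theorem rabiMat_neg_mul (E F : ℝ) {lam : ℝ} (hlam : lam ≠ 0) (t : ℝ) :
    rabiMat E F lam (-t) * rabiMat E F lam t = 1 := by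
  rw [← rabiMat_add E F hlam, neg_add_cancel, rabiMat_zero]

/-- The unitary `1 ⊗ |0⟩⟨0| + T ⊗ |1⟩⟨1|`. -/
def twist : HTot →L[ℂ] HTot := tens 1 (annih * annihᴴ) + tens transl (annihᴴ * annih)

theorem annih_mul : annih * annihᴴ = !![1, 0; 0, 0] := by
  ext i j; fin_cases i <;> fin_cases j <;> simp [annih, Matrix.mul_apply]

theorem annih_mul' : annihᴴ * annih = !![0, 0; 0, 1] := by
  ext i j; fin_cases i <;> fin_cases j <;> simp [annih, Matrix.mul_apply]

theorem annih_conjTranspose : annihᴴ = !![0, 0; 1, 0] := by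
  ext i j; fin_cases i <;> fin_cases j <;> simp [annih]

theorem star_twist : star twist = tens 1 (annih * annihᴴ) + tens (star transl) (annihᴴ * annih) := by
  refine (star_add (tens 1 (annih * annihᴴ)) (tens transl (annihᴴ * annih))).trans ?_
  rw [star_tens, star_tens, star_one, Matrix.conjTranspose_mul,
    Matrix.conjTranspose_mul, Matrix.conjTranspose_conjTranspose]

theorem twist_mem_unitary : twist ∈ unitary (HTot →L[ℂ] HTot) := by
  have h0 : tens 1 !![1, 0; 0, 0] + tens 1 !![0, 0; 0, 1] = 1 := by
    rw [← tens_one_one]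
    refine clm_ext_bra fun σ Ψ => ?_
    simp only [_root_.add_apply, map_add, bra_tens]
    fin_cases σ <;> simp [Matrix.one_apply]
  have hz : ∀ A, tens A (0 : Matrix (Fin 2) (Fin 2) ℂ) = 0 := fun A =>
    clm_ext_bra fun σ Ψ => by rw [bra_tens]; simp
  have h1 : (!![1, 0; 0, 0] * !![0, 0; 0, 1] : Matrix (Fin 2) (Fin 2) ℂ) = 0 := by
    ext i j; fin_cases i <;> fin_cases j <;> simp [Matrix.mul_apply]
  have h2 : (!![0, 0; 0, 1] * !![1, 0; 0, 0] : Matrix (Fin 2) (Fin 2) ℂ) = 0 := by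
    ext i j; fin_cases i <;> fin_cases j <;> simp [Matrix.mul_apply]
  have h3 : (!![0, 0; 0, 1] * !![0, 0; 0, 1] : Matrix (Fin 2) (Fin 2) ℂ) = !![0, 0; 0, 1] := by
    ext i j; fin_cases i <;> fin_cases j <;> simp [Matrix.mul_apply]
  have h4 : (!![1, 0; 0, 0] * !![1, 0; 0, 0] : Matrix (Fin 2) (Fin 2) ℂ) = !![1, 0; 0, 0] := by
    ext i j; fin_cases i <;> fin_cases j <;> simp [Matrix.mul_apply]
  rw [Unitary.mem_iff, star_twist, twist, annih_mul, annih_mul']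
  simp only [add_mul, mul_add, tens_mul_tens, h1, h2, h3, h4, hz, star_transl_mul_transl,
    transl_mul_star_transl, add_zero, zero_add, mul_one, h0, and_self]

/-- The propagator `exp (-i t h)` of the coupled system. -/
def totProp (E F lam t : ℝ) : HTot →L[ℂ] HTot :=
  twist * tens (stark F t) (rabiMat E F lam t) * star twist

/-- The propagator `exp (-i t h)` with the free propagator of the particle split off. -/
def totFactor (E F lam t : ℝ) : HTot →L[ℂ] HTot :=
  rabiMat E F lam t 0 0 • tens 1 (annih * annihᴴ) +
  (Complex.exp (-(Complex.I * (F * t : ℝ))) * rabiMat E F lam t 1 1) • tens 1 (annihᴴ * annih) +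
  (Complex.exp (-(Complex.I * (F * t : ℝ))) * rabiMat E F lam t 0 1) • tens (star transl) annih +
  rabiMat E F lam t 1 0 • tens transl annihᴴ

theorem transl_mul_stark (F t : ℝ) :
    transl * stark F t = Complex.exp (-(Complex.I * (F * t : ℝ))) • (stark F t * transl) := by
  rw [stark_mul_transl, smul_smul, ← Complex.exp_add, neg_add_cancel, Complex.exp_zero, one_smul]

theorem stark_mul_star_transl (F t : ℝ) :
    stark F t * star transl =
      Complex.exp (-(Complex.I * (F * t : ℝ))) • (star transl * stark F t) := by
  calc stark F t * star transl = star transl * (transl * stark F t) * star transl := by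
        rw [← mul_assoc, star_transl_mul_transl, one_mul]
    _ = _ := by
        rw [transl_mul_stark, mul_smul_comm, smul_mul_assoc, mul_assoc, mul_assoc,
          transl_mul_star_transl, mul_one]

/-- Carrying the translations in `twist` past the free propagator costs only phases `exp (-i F t)`.
The result has the form required by `hasDerivAt_mul_iff`: a norm-differentiable unitary times a
group of known generator. -/
theorem totProp_eq (E F lam t : ℝ) :
    totProp E F lam t = totFactor E F lam t * tens (stark F t) 1 := by
  have hTS : transl * stark F t * star transl =
      Complex.exp (-(Complex.I * (F * t : ℝ))) • stark F t := by
    rw [transl_mul_stark, smul_mul_assoc, mul_assoc, transl_mul_star_transl, mul_one]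
  have hsm : ∀ (c : ℂ) A B, tens (c • A) B = c • tens A B := fun c A B => by
    simp [tens, smul_smul, mul_comm]
  rw [totProp, totFactor, star_twist, twist]
  simp only [add_mul, mul_add, tens_mul_tens, one_mul, mul_one, hTS, hsm,
    stark_mul_star_transl, ← tens_smul, annih_mul, annih_mul']
  have e1 : (!![1, 0; 0, 0] * rabiMat E F lam t * !![1, 0; 0, 0] : Matrix (Fin 2) (Fin 2) ℂ) =
      rabiMat E F lam t 0 0 • !![1, 0; 0, 0] := by
    ext i j; fin_cases i <;> fin_cases j <;> simp [Matrix.mul_apply, Fin.sum_univ_two, Matrix.vecMul, dotProduct]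
  have e2 : (!![0, 0; 0, 1] * rabiMat E F lam t * !![1, 0; 0, 0] : Matrix (Fin 2) (Fin 2) ℂ) =
      rabiMat E F lam t 1 0 • annihᴴ := by
    ext i j; fin_cases i <;> fin_cases j <;>
      simp [annih, Matrix.mul_apply, Fin.sum_univ_two, Matrix.vecMul, dotProduct]
  have e3 : (!![1, 0; 0, 0] * rabiMat E F lam t * !![0, 0; 0, 1] : Matrix (Fin 2) (Fin 2) ℂ) =
      rabiMat E F lam t 0 1 • annih := by
    ext i j; fin_cases i <;> fin_cases j <;>
      simp [annih, Matrix.mul_apply, Fin.sum_univ_two, Matrix.vecMul, dotProduct]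
  have e4 : (!![0, 0; 0, 1] * rabiMat E F lam t * !![0, 0; 0, 1] : Matrix (Fin 2) (Fin 2) ℂ) =
      rabiMat E F lam t 1 1 • !![0, 0; 0, 1] := by
    ext i j; fin_cases i <;> fin_cases j <;> simp [Matrix.mul_apply, Fin.sum_univ_two, Matrix.vecMul, dotProduct]
  simp only [e1, e2, e3, e4, tens_smul, smul_smul]
  abel

theorem totProp_add (E F : ℝ) {lam : ℝ} (hlam : lam ≠ 0) (s t : ℝ) :
    totProp E F lam (s + t) = totProp E F lam s * totProp E F lam t := by
  have h := Unitary.star_mul_self_of_mem twist_mem_unitary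
  calc _ = twist * tens (stark F s) (rabiMat E F lam s) * 1 *
        tens (stark F t) (rabiMat E F lam t) * star twist := by
        rw [totProp, stark_add, rabiMat_add E F hlam, ← tens_mul_tens]
        simp only [mul_one, mul_assoc]
    _ = _ := by rw [← h]; simp only [totProp, mul_assoc]

theorem totProp_zero (E F lam : ℝ) : totProp E F lam 0 = 1 := by
  rw [totProp, stark_zero, rabiMat_zero, tens_one_one, mul_one,
    Unitary.mul_star_self_of_mem twist_mem_unitary]

theorem totProp_mem_unitary (E F : ℝ) {lam : ℝ} (hlam : lam ≠ 0) (t : ℝ) :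
    totProp E F lam t ∈ unitary (HTot →L[ℂ] HTot) := by
  refine mul_mem (mul_mem twist_mem_unitary (tens_mem_unitary (stark_mem_unitary F t) ?_ ?_))
    (Unitary.star_mem twist_mem_unitary)
  · rw [conjTranspose_rabiMat, rabiMat_neg_mul E F hlam]
  · rw [conjTranspose_rabiMat, rabiMat_mul_neg E F hlam]

theorem totFactor_mem_unitary (E F : ℝ) {lam : ℝ} (hlam : lam ≠ 0) (t : ℝ) :
    totFactor E F lam t ∈ unitary (HTot →L[ℂ] HTot) := by
  have h : totFactor E F lam t = totProp E F lam t * tens (stark F (-t)) 1 := by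
    rw [totProp_eq, mul_assoc, tens_mul_tens, ← stark_add, add_neg_cancel, stark_zero, mul_one,
      tens_one_one, mul_one]
  rw [h]
  exact mul_mem (totProp_mem_unitary E F hlam t)
    (tens_mem_unitary (stark_mem_unitary F _) (by simp) (by simp))

theorem totFactor_zero (E F lam : ℝ) : totFactor E F lam 0 = 1 := by
  have := totProp_eq E F lam 0
  rw [totProp_zero, stark_zero, tens_one_one, mul_one] at this
  exact this.symm

theorem continuous_rabiMat (E F lam : ℝ) (i j : Fin 2) :
    Continuous fun t => rabiMat E F lam t i j := by
  fin_cases i <;> fin_cases j <;> simp [rabiMat] <;> fun_prop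

theorem continuous_totProp_apply (E F lam : ℝ) (Ψ : HTot) :
    Continuous fun t => totProp E F lam t Ψ := by
  have h : ∀ t, totProp E F lam t Ψ = totFactor E F lam t (tens (stark F t) 1 Ψ) := fun t => by
    rw [totProp_eq]; rfl
  have h1 : Continuous fun t => tens (stark F t) 1 Ψ := by
    have : ∀ t, tens (stark F t) 1 Ψ = ∑ σ, incl σ (stark F t (bra σ Ψ)) := fun t => by
      rw [← sum_incl_bra (tens (stark F t) 1 Ψ)]
      simp only [bra_tens_one]
    simp only [this]
    exact continuous_finsetSum _ fun σ _ =>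
      (incl σ).continuous.comp (continuous_stark_apply F _)
  have h2 : Continuous fun t => totFactor E F lam t := by
    have := continuous_rabiMat E F lam
    unfold totFactor
    fun_prop
  simp only [h]
  exact h2.clm_apply h1

theorem hasDerivAt_rabiMat (E F : ℝ) {lam : ℝ} (hlam : lam ≠ 0) (i j : Fin 2) :
    HasDerivAt (fun t => rabiMat E F lam t i j)
      (-(Complex.I * (!![0, (lam : ℂ); (lam : ℂ), (E - F : ℝ)] i j))) 0 := by
  have hω : (rabi E F lam : ℂ) ≠ 0 := by exact_mod_cast (rabi_pos E F hlam).ne'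
  have hlin : HasDerivAt (fun t : ℝ => rabi E F lam * t / 2) (rabi E F lam / 2) 0 := by
    simpa using ((hasDerivAt_id (0 : ℝ)).const_mul (rabi E F lam)).div_const 2
  have hc : HasDerivAt (fun t : ℝ => ((Real.cos (rabi E F lam * t / 2) : ℝ) : ℂ)) 0 0 := by
    simpa using hlin.cos.ofReal_comp
  have hs : HasDerivAt (fun t : ℝ => ((Real.sin (rabi E F lam * t / 2) : ℝ) : ℂ))
      ((rabi E F lam / 2 : ℝ) : ℂ) 0 := by
    have := hlin.sin.ofReal_comp
    simpa using this
  have hp : HasDerivAt (fun t : ℝ => Complex.exp (-(Complex.I * (((E - F) * t / 2 : ℝ) : ℂ))))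
      (-(Complex.I * (((E - F) / 2 : ℝ) : ℂ))) 0 := by
    have h1 : HasDerivAt (fun t : ℝ => (E - F) * t / 2) ((E - F) / 2) 0 := by
      simpa using ((hasDerivAt_id (0 : ℝ)).const_mul (E - F)).div_const 2
    have h2 := (h1.ofReal_comp.const_mul Complex.I).neg.cexp
    refine h2.congr_deriv ?_
    simp
  generalize hd : (((E - F) / rabi E F lam : ℝ) : ℂ) = d
  generalize hl : ((2 * lam / rabi E F lam : ℝ) : ℂ) = l
  have hd' : d * ((rabi E F lam / 2 : ℝ) : ℂ) = (((E - F) / 2 : ℝ) : ℂ) := by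
    rw [← hd]; push_cast; field_simp
  have hl' : l * ((rabi E F lam / 2 : ℝ) : ℂ) = (lam : ℂ) := by
    rw [← hl]; push_cast; field_simp
  have e00 := hp.mul (hc.add (hs.const_mul (Complex.I * d)))
  have e01 := hp.mul (hs.const_mul (Complex.I * l)).neg
  have e11 := hp.mul (hc.sub (hs.const_mul (Complex.I * d)))
  fin_cases i <;> fin_cases j <;> simp only [rabiMat, hd, hl]
  · refine e00.congr_deriv ?_
    simp only [mul_assoc, hd']
    simp
  · refine e01.congr_deriv ?_
    simp only [mul_assoc, hl']
    simp
  · refine e01.congr_deriv ?_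
    simp only [mul_assoc, hl']
    simp
  · refine e11.congr_deriv ?_
    simp only [mul_assoc, hd']
    simp
    ring

/-- The phase `exp (-i F t)` restores the energy shifted away by `twist`: `-iF - i(E - F) = -iE` on
the excited level. The off-diagonal entries vanish at `0`, so their derivatives give exactly the
coupling. -/
theorem hasDerivAt_totFactor (E F : ℝ) {lam : ℝ} (hlam : lam ≠ 0) :
    HasDerivAt (totFactor E F lam)
      (-(Complex.I • (tens 1 (hamE E) + (lam : ℂ) • coupling : HTot →L[ℂ] HTot))) 0 := by
  have hp : HasDerivAt (fun t : ℝ => Complex.exp (-(Complex.I * ((F * t : ℝ) : ℂ))))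
      (-(Complex.I * (F : ℂ))) 0 := by
    have h1 : HasDerivAt (fun t : ℝ => F * t) F 0 := by
      simpa using (hasDerivAt_id (0 : ℝ)).const_mul F
    have h2 := (h1.ofReal_comp.const_mul Complex.I).neg.cexp
    refine h2.congr_deriv ?_
    simp
  have hm := hasDerivAt_rabiMat E F hlam
  have := ((((hm 0 0).smul_const (tens 1 (annih * annihᴴ))).add
    ((hp.mul (hm 1 1)).smul_const (tens 1 (annihᴴ * annih)))).add
    ((hp.mul (hm 0 1)).smul_const (tens (star transl) annih))).add
    ((hm 1 0).smul_const (tens transl annihᴴ))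
  refine this.congr_deriv ?_
  simp only [rabiMat_zero, hamE, tens_smul, coupling, ← ContinuousLinearMap.star_eq_adjoint]
  simp
  module

theorem isUnitaryGroup_totProp (E : ℝ) {F lam : ℝ} (hF : F ≠ 0) (hlam : lam ≠ 0) :
    IsUnitaryGroup (hamTot E F lam) (totProp E F lam) where
  map_zero := totProp_zero E F lam
  map_add := totProp_add E F hlam
  unitary := totProp_mem_unitary E F hlam
  continuous := continuous_totProp_apply E F lam
  generator Ψ Φ := by
    have := hasDerivAt_mul_iff (mem_graph_ampl_hamS hF) (by rw [stark_zero, tens_one_one])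
      (hasDerivAt_totFactor E F hlam) (totFactor_zero E F lam)
      (totFactor_mem_unitary E F hlam) Ψ Φ
    simp only [totProp_eq]
    exact this

theorem expNegI_hamTot (E : ℝ) {F lam : ℝ} (hF : F ≠ 0) (hlam : lam ≠ 0) :
    expNegI (hamTot E F lam) = totProp E F lam :=
  (isUnitaryGroup_totProp E hF hlam).expNegI_eq (dense_domain_hamTot E F lam)

/-! ## The reduced dynamics as a random walk -/

theorem partialTrace_add (V W : HTot →L[ℂ] HTot) :
    partialTrace (V + W) = partialTrace V + partialTrace W := by
  simp [partialTrace, ContinuousLinearMap.add_comp, ContinuousLinearMap.comp_add,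
    Finset.sum_add_distrib]

theorem partialTrace_smul (c : ℂ) (V : HTot →L[ℂ] HTot) :
    partialTrace (c • V) = c • partialTrace V := by
  simp [partialTrace, ContinuousLinearMap.smul_comp, smul_add]

theorem partialTrace_tens (A : HS →L[ℂ] HS) (B : Matrix (Fin 2) (Fin 2) ℂ) :
    partialTrace (tens A B) = B.trace • A := by
  ext1 ψ
  have h : partialTrace (tens A B) ψ = ∑ σ, bra σ (tens A B (incl σ ψ)) := by
    simp [partialTrace]
  rw [h]
  simp only [bra_tens, bra_incl, Matrix.trace, Finset.sum_smul]
  simp [Fin.sum_univ_two]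

/-- The thermal occupation of the ground state. -/
def occ (E β : ℝ) : ℝ := Real.exp (β * E / 2) / (2 * Real.cosh (β * E / 2))

/-- The thermal occupation of the excited state. -/
def occ' (E β : ℝ) : ℝ := Real.exp (-(β * E / 2)) / (2 * Real.cosh (β * E / 2))

theorem thermal_eq (E β : ℝ) : thermal E β = !![(occ E β : ℂ), 0; 0, (occ' E β : ℂ)] := by
  have h1 : -(β : ℂ) • hamE E = Matrix.diagonal ![0, ((-(β * E) : ℝ) : ℂ)] := by
    rw [hamE, annih_mul']
    ext i j
    fin_cases i <;> fin_cases j <;> simp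
  have h2 : NormedSpace.exp (-(β : ℂ) • hamE E) = !![1, 0; 0, ((Real.exp (-(β * E)) : ℝ) : ℂ)] := by
    rw [h1, Matrix.exp_diagonal]
    ext i j
    rw [Matrix.diagonal_apply]
    fin_cases i <;> fin_cases j <;> simp [Pi.coe_exp, ← Complex.exp_eq_exp_ℂ]
  have hc : Real.cosh (β * E / 2) ≠ 0 := (Real.cosh_pos _).ne'
  have e0 : occ E β = (1 + Real.exp (-(β * E)))⁻¹ := by
    rw [occ, Real.cosh_eq, div_eq_iff (by positivity), inv_mul_eq_div, eq_div_iff (by positivity),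
      mul_add, ← Real.exp_add]
    ring_nf
  have e1 : occ' E β = (1 + Real.exp (-(β * E)))⁻¹ * Real.exp (-(β * E)) := by
    rw [occ', Real.cosh_eq, div_eq_iff (by positivity), inv_mul_eq_div, div_mul_eq_mul_div,
      eq_div_iff (by positivity)]
    have h3 : Real.exp (-(β * E)) = Real.exp (-(β * E / 2)) ^ 2 := by
      rw [← Real.exp_nat_mul]; ring_nf
    have h4 : Real.exp (β * E / 2) * Real.exp (-(β * E / 2)) = 1 := by
      rw [← Real.exp_add, add_neg_cancel, Real.exp_zero]
    rw [h3]
    linear_combination (-Real.exp (-(β * E / 2))) * h4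
  rw [thermal, h2, e0, e1]
  ext i j
  fin_cases i <;> fin_cases j <;> simp

theorem kickProb_eq (E F lam τ : ℝ) : kickProb E F lam τ =
    (2 * lam / rabi E F lam) ^ 2 * Real.sin (rabi E F lam * τ / 2) ^ 2 := by
  rw [kickProb]; ring

theorem rabiMat_entry_off (E F lam τ : ℝ) :
    rabiMat E F lam τ 0 1 * star (rabiMat E F lam τ 0 1) = (kickProb E F lam τ : ℂ) ∧
    rabiMat E F lam τ 1 0 * star (rabiMat E F lam τ 1 0) = (kickProb E F lam τ : ℂ) := by
  have h : ∀ x : ℝ, ‖Complex.exp (-(Complex.I * (x : ℂ)))‖ = 1 := fun x => by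
    have := Complex.norm_exp_I_mul_ofReal (-x)
    rw [← this]; push_cast; ring_nf
  have key : ‖Complex.exp (-(Complex.I * (((E - F) * τ / 2 : ℝ) : ℂ))) *
      -(Complex.I * ((2 * lam / rabi E F lam : ℝ) : ℂ) *
        ((Real.sin (rabi E F lam * τ / 2) : ℝ) : ℂ))‖ ^ 2 = kickProb E F lam τ := by
    rw [norm_mul, h, one_mul, norm_neg, norm_mul, norm_mul, Complex.norm_I, one_mul,
      Complex.norm_real, Complex.norm_real, mul_pow, Real.norm_eq_abs, Real.norm_eq_abs, sq_abs,
      sq_abs, kickProb_eq]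
  simp only [Complex.star_def, Complex.mul_conj', ← key]
  constructor <;> · simp [rabiMat]

/-- Each row of a unitary matrix has norm one, so these are complementary to the transition
probabilities. -/
theorem rabiMat_entry_diag (E F : ℝ) {lam : ℝ} (hlam : lam ≠ 0) (τ : ℝ) :
    rabiMat E F lam τ 0 0 * star (rabiMat E F lam τ 0 0) = ((1 - kickProb E F lam τ : ℝ) : ℂ) ∧
    rabiMat E F lam τ 1 1 * star (rabiMat E F lam τ 1 1) = ((1 - kickProb E F lam τ : ℝ) : ℂ) := by
  have h := rabiMat_mul_neg E F hlam τ
  rw [← conjTranspose_rabiMat] at h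
  obtain ⟨h1, h2⟩ := rabiMat_entry_off E F lam τ
  have h00 := congrFun (congrFun h 0) 0
  have h11 := congrFun (congrFun h 1) 1
  simp only [Matrix.mul_apply, Fin.sum_univ_two, Matrix.conjTranspose_apply,
    Matrix.one_apply_eq, h1, h2] at h00 h11
  push_cast
  exact ⟨eq_sub_of_add_eq h00, eq_sub_of_add_eq' h11⟩

/-- The probability of a jump to the right. -/
def probUp (E F lam β τ : ℝ) : ℝ := kickProb E F lam τ * occ E β

/-- The probability of a jump to the left. -/
def probDown (E F lam β τ : ℝ) : ℝ := kickProb E F lam τ * occ' E β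

/-- The operator `a A + b T A T* + c T* A T`. -/
def randomShift (a b c : ℝ) (A : HS →L[ℂ] HS) : HS →L[ℂ] HS :=
  (a : ℂ) • A + (b : ℂ) • (transl * A * star transl) + (c : ℂ) • (star transl * A * transl)

theorem occ_add_occ' (E β : ℝ) : occ E β + occ' E β = 1 := by
  have hc : Real.cosh (β * E / 2) ≠ 0 := (Real.cosh_pos _).ne'
  rw [occ, occ', ← add_div, div_eq_one_iff_eq (by positivity), Real.cosh_eq]
  ring

theorem star_totProp (E F : ℝ) {lam : ℝ} (hlam : lam ≠ 0) (t : ℝ) :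
    totProp E F lam (-t) = star (totProp E F lam t) := by
  have h1 : totProp E F lam t * totProp E F lam (-t) = 1 := by
    rw [← totProp_add E F hlam, add_neg_cancel, totProp_zero]
  calc totProp E F lam (-t)
      = star (totProp E F lam t) * (totProp E F lam t * totProp E F lam (-t)) := by
        rw [← mul_assoc, Unitary.star_mul_self_of_mem (totProp_mem_unitary E F hlam t), one_mul]
    _ = _ := by rw [h1, mul_one]

theorem star_add_total (V W : HTot →L[ℂ] HTot) : star (V + W) = star V + star W := star_add V W

theorem star_smul_total (c : ℂ) (V : HTot →L[ℂ] HTot) : star (c • V) = star c • star V :=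
  star_smul c V

/-- The four terms of `totFactor` carry the four matrix units of the atom. Against a diagonal
thermal state the trace pairs each term only with its own adjoint, so no interference survives.
Exciting the atom accompanies a jump to the right, emptying it a jump to the left. -/
theorem reducedMap_eq (E : ℝ) {F lam : ℝ} (hF : F ≠ 0) (hlam : lam ≠ 0) (β τ : ℝ)
    (ρ : HS →L[ℂ] HS) : reducedMap E F lam β τ ρ =
      randomShift (1 - kickProb E F lam τ) (probUp E F lam β τ) (probDown E F lam β τ)
        (stark F τ * ρ * star (stark F τ)) := by
  have h1 : expNegI (hamTot E F lam) τ ∘L tens ρ (thermal E β) ∘L expNegI (hamTot E F lam) (-τ) =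
      totFactor E F lam τ * tens (stark F τ * ρ * star (stark F τ)) (thermal E β) *
        star (totFactor E F lam τ) := by
    rw [expNegI_hamTot E hF hlam, star_totProp E F hlam, totProp_eq, star_mul, star_tens,
      Matrix.conjTranspose_one]
    change totFactor E F lam τ * tens (stark F τ) 1 * (tens ρ (thermal E β) *
      (tens (star (stark F τ)) 1 * star (totFactor E F lam τ))) = _
    calc _ = totFactor E F lam τ * (tens (stark F τ) 1 * tens ρ (thermal E β) *
        tens (star (stark F τ)) 1) * star (totFactor E F lam τ) := by simp only [mul_assoc]
      _ = _ := by rw [tens_mul_tens, tens_mul_tens, one_mul, mul_one]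
  rw [reducedMap, h1]
  generalize stark F τ * ρ * star (stark F τ) = A
  obtain ⟨n01, n10⟩ := rabiMat_entry_off E F lam τ
  obtain ⟨n00, n11⟩ := rabiMat_entry_diag E F hlam τ
  have hu : Complex.exp (-(Complex.I * (F * τ : ℝ))) *
      star (Complex.exp (-(Complex.I * (F * τ : ℝ)))) = 1 := by
    rw [Complex.star_def, ← Complex.exp_conj, ← Complex.exp_add]
    simp
  have n11' : (Complex.exp (-(Complex.I * (F * τ : ℝ))) * rabiMat E F lam τ 1 1) *
      star (Complex.exp (-(Complex.I * (F * τ : ℝ))) * rabiMat E F lam τ 1 1) =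
      ((1 - kickProb E F lam τ : ℝ) : ℂ) := by
    rw [star_mul', mul_mul_mul_comm, hu, one_mul, n11]
  have n01' : (Complex.exp (-(Complex.I * (F * τ : ℝ))) * rabiMat E F lam τ 0 1) *
      star (Complex.exp (-(Complex.I * (F * τ : ℝ))) * rabiMat E F lam τ 0 1) =
      (kickProb E F lam τ : ℂ) := by
    rw [star_mul', mul_mul_mul_comm, hu, one_mul, n01]
  have hs : star (totFactor E F lam τ) =
      star (rabiMat E F lam τ 0 0) • tens 1 (annih * annihᴴ) +
      star (Complex.exp (-(Complex.I * (F * τ : ℝ))) * rabiMat E F lam τ 1 1) •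
        tens 1 (annihᴴ * annih) +
      star (Complex.exp (-(Complex.I * (F * τ : ℝ))) * rabiMat E F lam τ 0 1) •
        tens transl annihᴴ +
      star (rabiMat E F lam τ 1 0) • tens (star transl) annih := by
    simp only [totFactor, star_add_total, star_smul_total, star_tens, star_one, star_star,
      Matrix.conjTranspose_mul, Matrix.conjTranspose_conjTranspose]
  rw [hs, totFactor]
  generalize Complex.exp (-(Complex.I * (F * τ : ℝ))) * rabiMat E F lam τ 1 1 = m11 at *
  generalize Complex.exp (-(Complex.I * (F * τ : ℝ))) * rabiMat E F lam τ 0 1 = m01 at *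
  generalize rabiMat E F lam τ 0 0 = m00 at *
  generalize rabiMat E F lam τ 1 0 = m10 at *
  rw [thermal_eq, annih_mul, annih_mul', annih_conjTranspose, annih]
  simp only [add_mul, mul_add, smul_mul_assoc, mul_smul_comm, tens_mul_tens, partialTrace_add,
    partialTrace_smul, partialTrace_tens, Matrix.mul_fin_two, Matrix.trace_fin_two_of, one_mul,
    mul_one, mul_zero, zero_mul, add_zero, zero_add, zero_smul, smul_zero, smul_smul]
  generalize star m00 = s00 at *
  generalize star m01 = s01 at *
  generalize star m10 = s10 at *
  generalize star m11 = s11 at *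
  have ho : (occ E β : ℂ) + (occ' E β : ℂ) = 1 := by exact_mod_cast occ_add_occ' E β
  have e1 : ((1 - kickProb E F lam τ : ℝ) : ℂ) = m00 * s00 * occ E β + m11 * s11 * occ' E β := by
    rw [n00, n11', ← mul_add, ho, mul_one]
  have e2 : (probUp E F lam β τ : ℂ) = m10 * s10 * occ E β := by
    rw [n10, probUp]; push_cast; rfl
  have e3 : (probDown E F lam β τ : ℂ) = m01 * s01 * occ' E β := by
    rw [n01', probDown]; push_cast; rfl
  rw [randomShift, e1, e2, e3]
  module

/-! ## Iterates of the reduced dynamics -/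

/-- The phases arising when `T` passes the propagator and its adjoint are conjugate and cancel. -/
theorem randomShift_conj_stark (a b c F t : ℝ) (A : HS →L[ℂ] HS) :
    randomShift a b c (stark F t * A * star (stark F t)) =
      stark F t * randomShift a b c A * star (stark F t) := by
  have hph : Complex.exp (-(Complex.I * (F * t : ℝ))) *
      star (Complex.exp (-(Complex.I * (F * t : ℝ)))) = 1 := by
    rw [Complex.star_def, ← Complex.exp_conj, ← Complex.exp_add]
    simp
  have h1 := transl_mul_stark F t
  have h2 := congrArg star (transl_mul_stark F t)
  have h3 := stark_mul_star_transl F t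
  have h4 := congrArg star (stark_mul_star_transl F t)
  simp only [star_mul, star_smul, star_star] at h2 h4
  generalize Complex.exp (-(Complex.I * (F * t : ℝ))) = e at *
  have h3' : star transl * stark F t = star e • (stark F t * star transl) := by
    rw [h3, smul_smul, mul_comm, hph, one_smul]
  have h4' : star (stark F t) * transl = e • (transl * star (stark F t)) := by
    rw [h4, smul_smul, hph, one_smul]
  have e1 : transl * (stark F t * A * star (stark F t)) * star transl =
      stark F t * (transl * A * star transl) * star (stark F t) := by
    calc _ = (transl * stark F t) * A * (star (stark F t) * star transl) := by
          simp only [mul_assoc]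
      _ = _ := by
          rw [h1, h2, mul_smul_comm, smul_mul_assoc, smul_mul_assoc, smul_smul, mul_comm, hph,
            one_smul]
          simp only [mul_assoc]
  have e2 : star transl * (stark F t * A * star (stark F t)) * transl =
      stark F t * (star transl * A * transl) * star (stark F t) := by
    calc _ = (star transl * stark F t) * A * (star (stark F t) * transl) := by
          simp only [mul_assoc]
      _ = _ := by
          rw [h3', h4', mul_smul_comm, smul_mul_assoc, smul_mul_assoc, smul_smul, hph,
            one_smul]
          simp only [mul_assoc]
  simp only [randomShift, e1, e2, mul_add, add_mul, mul_smul_comm, smul_mul_assoc]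

/-- By commutation, the `n` free evolutions collect into a single one of duration `n * τ` acting
before all the jumps. -/
theorem iterate_reducedMap (E : ℝ) {F lam : ℝ} (hF : F ≠ 0) (hlam : lam ≠ 0) (β τ : ℝ)
    (ρ : HS →L[ℂ] HS) (n : ℕ) : (reducedMap E F lam β τ)^[n] ρ =
      (randomShift (1 - kickProb E F lam τ) (probUp E F lam β τ) (probDown E F lam β τ))^[n]
        (stark F (n * τ) * ρ * star (stark F (n * τ))) := by
  induction n with
  | zero => simp [stark_zero]
  | succ n ih =>
    rw [Function.iterate_succ_apply', ih, reducedMap_eq E hF hlam, Function.iterate_succ_apply']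
    congr 1
    have hc : Function.Commute (fun A => stark F τ * A * star (stark F τ))
        (randomShift (1 - kickProb E F lam τ) (probUp E F lam β τ) (probDown E F lam β τ)) :=
      fun A => (randomShift_conj_stark _ _ _ F τ A).symm
    have h := (hc.iterate_right n).eq (stark F (n * τ) * ρ * star (stark F (n * τ)))
    refine h.trans ?_
    congr 1
    rw [show ((n + 1 : ℕ) : ℝ) * τ = τ + n * τ by push_cast; ring, stark_add, star_mul]
    simp only [mul_assoc]

theorem ket_apply (x y : ℤ) : ket x y = if y = x then 1 else 0 := by
  rw [ket, lp.single_apply, Pi.single_apply]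

theorem inner_ket_left (x : ℤ) (ψ : HS) : inner ℂ (ket x) ψ = ψ x := by
  rw [ket, lp.inner_single_left]
  simp

theorem transl_ket (x : ℤ) : transl (ket x) = ket (x + 1) := by
  ext y
  simp only [transl_apply, ket_apply, sub_eq_iff_eq_add]

theorem star_transl_ket (x : ℤ) : star transl (ket x) = ket (x - 1) := by
  rw [star_transl]
  ext y
  simp only [shift_apply, ket_apply, eq_sub_iff_add_eq]

theorem diag_eq (A : HS →L[ℂ] HS) (x : ℤ) : diag A x = (A (ket x) x).re := by
  rw [diag, inner_ket_left]

/-- The random walk step on functions on `ℤ`. -/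
def walkStep (a b c : ℝ) (d : ℤ → ℝ) (x : ℤ) : ℝ := a * d x + b * d (x - 1) + c * d (x + 1)

theorem diag_randomShift (a b c : ℝ) (A : HS →L[ℂ] HS) :
    diag (randomShift a b c A) = walkStep a b c (diag A) := by
  funext x
  have h : randomShift a b c A (ket x) = (a : ℂ) • A (ket x) +
      (b : ℂ) • transl (A (star transl (ket x))) + (c : ℂ) • star transl (A (transl (ket x))) := rfl
  have h2 : randomShift a b c A (ket x) x = (a : ℂ) * A (ket x) x +
      (b : ℂ) * A (ket (x - 1)) (x - 1) + (c : ℂ) * A (ket (x + 1)) (x + 1) := by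
    rw [h, transl_ket, star_transl_ket, star_transl]
    rfl
  rw [diag_eq, h2, walkStep, diag_eq, diag_eq, diag_eq]
  simp

theorem diag_iterate_randomShift (a b c : ℝ) (A : HS →L[ℂ] HS) (n : ℕ) :
    diag ((randomShift a b c)^[n] A) = (walkStep a b c)^[n] (diag A) := by
  induction n with
  | zero => rfl
  | succ n ih => rw [Function.iterate_succ_apply', diag_randomShift, ih,
      Function.iterate_succ_apply']

/-! ## Diagonals of positive operators -/

theorem diag_nonneg {A : HS →L[ℂ] HS} (hA : A.IsPositive) (x : ℤ) : 0 ≤ diag A x := by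
  have := hA.inner_nonneg_right (ket x)
  exact (Complex.nonneg_iff.1 this).1

theorem exists_sqrt {K : Type*} [NormedAddCommGroup K] [InnerProductSpace ℂ K] [CompleteSpace K]
    {ρ : K →L[ℂ] K} (hρ : ρ.IsPositive) : ∃ R : K →L[ℂ] K, star R = R ∧ ρ = R * R := by
  have h : 0 ≤ ρ := (ContinuousLinearMap.nonneg_iff_isPositive ρ).2 hρ
  exact ⟨CFC.sqrt ρ, IsSelfAdjoint.of_nonneg (CFC.sqrt_nonneg ρ), (CFC.sqrt_mul_sqrt_self ρ h).symm⟩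

/-- Writing a positive operator as `R * R` makes its diagonal a squared norm, which is visibly
nonnegative and can be estimated by the triangle inequality. -/
theorem diag_conj_sq {R : HS →L[ℂ] HS} (hR : star R = R) (S : HS →L[ℂ] HS) (x : ℤ) :
    diag (S * (R * R) * star S) x = ‖R (star S (ket x))‖ ^ 2 := by
  have h : (S * (R * R) * star S) (ket x) = S (R (R (star S (ket x)))) := rfl
  rw [diag, h, ← ContinuousLinearMap.adjoint_inner_left S, ← ContinuousLinearMap.star_eq_adjoint]
  have h1 : R.adjoint = R := hR
  rw [← ContinuousLinearMap.adjoint_inner_left R, h1, inner_self_eq_norm_sq_to_K]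
  norm_cast

theorem ofReal_norm_sq_eq_tsum (ψ : HS) :
    ENNReal.ofReal (‖ψ‖ ^ 2) = ∑' x, ENNReal.ofReal (‖ψ x‖ ^ 2) := by
  rw [norm_sq_eq_tsum, ENNReal.ofReal_tsum_of_nonneg (fun _ => by positivity) (summable_norm_sq ψ)]

/-- An operator and its adjoint have the same Hilbert–Schmidt norm, by Tonelli on the matrix
entries. In `hasSum_diag_conj` this replaces cyclicity of the trace. -/
theorem tsum_norm_sq_ket_star (A : HS →L[ℂ] HS) :
    ∑' x, ENNReal.ofReal (‖A (ket x)‖ ^ 2) = ∑' x, ENNReal.ofReal (‖star A (ket x)‖ ^ 2) := by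
  simp only [ofReal_norm_sq_eq_tsum]
  rw [ENNReal.tsum_comm]
  refine tsum_congr fun y => tsum_congr fun x => ?_
  rw [← inner_ket_left y, ← inner_ket_left x, ContinuousLinearMap.star_eq_adjoint,
    ContinuousLinearMap.adjoint_inner_right, ← inner_conj_symm, RCLike.norm_conj]

theorem hasSum_of_tsum_ofReal {f : ℤ → ℝ} (hf : ∀ x, 0 ≤ f x) {r : ℝ} (hr : 0 ≤ r)
    (h : ∑' x, ENNReal.ofReal (f x) = ENNReal.ofReal r) : HasSum f r := by
  have hs : Summable f := by
    have := ENNReal.summable_toReal (f := fun x => ENNReal.ofReal (f x)) (by rw [h]; simp)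
    simpa [ENNReal.toReal_ofReal (hf _)] using this
  rw [← ENNReal.ofReal_tsum_of_nonneg hf hs,
    ENNReal.ofReal_eq_ofReal_iff (tsum_nonneg hf) hr] at h
  exact h ▸ hs.hasSum

theorem hasSum_diag_conj {ρ S : HS →L[ℂ] HS} (hρ : IsDensityMatrix ρ)
    (hS : S ∈ unitary (HS →L[ℂ] HS)) : HasSum (diag (S * ρ * star S)) 1 := by
  obtain ⟨R, hR, rfl⟩ := exists_sqrt hρ.1
  refine hasSum_of_tsum_ofReal (fun x => ?_) zero_le_one ?_
  · rw [diag_conj_sq hR]; positivity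
  have h0 : ∀ x, diag (R * R) x = ‖R (ket x)‖ ^ 2 := fun x => by
    have := diag_conj_sq hR 1 x
    simpa using this
  calc ∑' x, ENNReal.ofReal (diag (S * (R * R) * star S) x)
      = ∑' x, ENNReal.ofReal (‖(R * star S) (ket x)‖ ^ 2) :=
        tsum_congr fun x => by rw [diag_conj_sq hR]; rfl
    _ = ∑' x, ENNReal.ofReal (diag (R * R) x) := by
        rw [tsum_norm_sq_ket_star, star_mul, star_star, hR]
        refine tsum_congr fun x => ?_
        change ENNReal.ofReal (‖S (R (ket x))‖ ^ 2) = _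
        rw [norm_apply_of_mem_unitary hS, h0]
    _ = ENNReal.ofReal 1 := by
        rw [← ENNReal.ofReal_tsum_of_nonneg (diag_nonneg hρ.1) hρ.2.summable, hρ.2.tsum_eq]

/-! ## Uniform domination of the free evolution -/

theorem hop_ket (a b : ℂ) (x : ℤ) : hop a b (ket x) = a • ket (x - 1) + b • ket (x + 1) := by
  rw [← transl_ket, ← star_transl_ket]; rfl

theorem hop_one_one_apply (ψ : HS) (x : ℤ) : hop 1 1 ψ x = ψ (x + 1) + ψ (x - 1) := by
  have : hop 1 1 ψ = (1 : ℂ) • shift 1 ψ + (1 : ℂ) • transl ψ := by rw [hop, star_transl]; rfl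
  rw [this]
  simp

/-- Each hop moves one site, costing at most `C` in the weight and `c` in the coefficient. The
triangle inequality thus compares powers of `hop a b` with powers of the positivity-preserving `hop
1 1` acting on the fixed vector `H`. -/
theorem weight_norm_hop_pow_le {R : HS →L[ℂ] HS} {w : ℤ → ℝ} {C : ℝ} (hC : 0 ≤ C)
    (hw : ∀ x, 0 ≤ w x) (hl : ∀ x, w x ≤ C * w (x - 1)) (hr : ∀ x, w x ≤ C * w (x + 1))
    {H : HS} (hH : ∀ x, w x * ‖R (ket x)‖ ≤ (H x).re) {a b : ℂ} {c : ℝ} (hc : 0 ≤ c)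
    (ha : ‖a‖ ≤ c) (hb : ‖b‖ ≤ c) (n : ℕ) (x : ℤ) :
    w x * ‖R ((hop a b ^ n) (ket x))‖ ≤ (c * C) ^ n * ((hop 1 1 ^ n) H x).re := by
  induction n generalizing x with
  | zero => simpa using hH x
  | succ n ih =>
    have e1 : (hop a b ^ (n + 1)) (ket x) =
        a • (hop a b ^ n) (ket (x - 1)) + b • (hop a b ^ n) (ket (x + 1)) := by
      rw [pow_succ]
      change (hop a b ^ n) (hop a b (ket x)) = _
      rw [hop_ket, map_add, map_smul, map_smul]
    have e2 : (hop 1 1 ^ (n + 1)) H x = (hop 1 1 ^ n) H (x + 1) + (hop 1 1 ^ n) H (x - 1) := by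
      rw [pow_succ']
      exact hop_one_one_apply _ _
    rw [e1, e2, map_add, map_smul, map_smul, Complex.add_re]
    have hn : ‖a • R ((hop a b ^ n) (ket (x - 1))) + b • R ((hop a b ^ n) (ket (x + 1)))‖ ≤
        c * ‖R ((hop a b ^ n) (ket (x - 1)))‖ + c * ‖R ((hop a b ^ n) (ket (x + 1)))‖ := by
      refine (norm_add_le _ _).trans ?_
      rw [norm_smul, norm_smul]
      gcongr
    have i1 := ih (x - 1)
    have i2 := ih (x + 1)
    set u := ‖R ((hop a b ^ n) (ket (x - 1)))‖
    set v := ‖R ((hop a b ^ n) (ket (x + 1)))‖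
    have hu : 0 ≤ u := norm_nonneg _
    have hv : 0 ≤ v := norm_nonneg _
    calc _ ≤ w x * (c * u + c * v) := by gcongr; exact hw x
      _ = c * (w x * u) + c * (w x * v) := by ring
      _ ≤ c * ((C * w (x - 1)) * u) + c * ((C * w (x + 1)) * v) := by
        gcongr
        · exact hl x
        · exact hr x
      _ = c * C * (w (x - 1) * u) + c * C * (w (x + 1) * v) := by ring
      _ ≤ c * C * ((c * C) ^ n * ((hop 1 1 ^ n) H (x - 1)).re) +
          c * C * ((c * C) ^ n * ((hop 1 1 ^ n) H (x + 1)).re) := by gcongr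
      _ = _ := by ring

theorem weight_norm_exp_hop_le {R : HS →L[ℂ] HS} {w : ℤ → ℝ} {C : ℝ} (hC : 0 ≤ C)
    (hw : ∀ x, 0 ≤ w x) (hl : ∀ x, w x ≤ C * w (x - 1)) (hr : ∀ x, w x ≤ C * w (x + 1))
    {H : HS} (hH : ∀ x, w x * ‖R (ket x)‖ ≤ (H x).re) {a b : ℂ} {c : ℝ} (hc : 0 ≤ c)
    (ha : ‖a‖ ≤ c) (hb : ‖b‖ ≤ c) (x : ℤ) :
    w x * ‖R (NormedSpace.exp (hop a b) (ket x))‖ ≤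
      (NormedSpace.exp (((c * C : ℝ) : ℂ) • hop 1 1) H x).re := by
  have s1 : HasSum (fun n : ℕ => (w x : ℂ) • R (((n.factorial : ℂ)⁻¹ • hop a b ^ n) (ket x)))
      ((w x : ℂ) • R (NormedSpace.exp (hop a b) (ket x))) := by
    have h := NormedSpace.exp_series_hasSum_exp' (𝕂 := ℂ) (hop a b)
    exact ((h.mapL (ContinuousLinearMap.apply ℂ HS (ket x))).mapL R).const_smul _
  have s2 : HasSum (fun n : ℕ => ((((n.factorial : ℂ)⁻¹ • (((c * C : ℝ) : ℂ) • hop 1 1) ^ n) H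
      : HS) x).re) ((NormedSpace.exp (((c * C : ℝ) : ℂ) • hop 1 1) H x).re) := by
    have h := NormedSpace.exp_series_hasSum_exp' (𝕂 := ℂ) (((c * C : ℝ) : ℂ) • hop 1 1)
    exact Complex.hasSum_re ((h.mapL (ContinuousLinearMap.apply ℂ HS H)).mapL
      (lp.evalCLM ℂ (fun _ : ℤ => ℂ) 2 x))
  have h := s1.norm_le_of_bounded s2 fun n => ?_
  · rw [norm_smul, Complex.norm_real, Real.norm_of_nonneg (hw x)] at h
    exact h
  · have e1 : ((n.factorial : ℂ)⁻¹ • hop a b ^ n) (ket x) =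
        (n.factorial : ℂ)⁻¹ • (hop a b ^ n) (ket x) := rfl
    have e2 : (((n.factorial : ℂ)⁻¹ • (((c * C : ℝ) : ℂ) • hop 1 1) ^ n) H : HS) x =
        (((n.factorial : ℝ)⁻¹ * (c * C) ^ n : ℝ) : ℂ) * (hop 1 1 ^ n) H x := by
      rw [smul_pow, smul_smul]
      push_cast
      rfl
    rw [e1, e2, Complex.re_ofReal_mul, map_smul, norm_smul, norm_smul, norm_inv, Complex.norm_real,
      Complex.norm_natCast, Real.norm_of_nonneg (hw x)]
    have := weight_norm_hop_pow_le hC hw hl hr hH hc ha hb n x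
    calc _ = (n.factorial : ℝ)⁻¹ * (w x * ‖R ((hop a b ^ n) (ket x))‖) := by ring
      _ ≤ (n.factorial : ℝ)⁻¹ * ((c * C) ^ n * ((hop 1 1 ^ n) H x).re) := by gcongr
      _ = _ := by ring

/-- The adjoint of the propagator is, up to phases, a boost after the exponential of a hopping
operator whose coefficients are bounded uniformly in time. Comparison with `exp (c C (T + T*))`
bounds the weighted amplitudes by one `ℓ²` vector, whose square is the dominating function. -/
theorem exists_summable_bound {F : ℝ} (hF : 0 < F) {ρ : HS →L[ℂ] HS} (hρ : ρ.IsPositive)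
    {w : ℤ → ℝ} {C : ℝ} (hC : 0 ≤ C) (hw : ∀ x, 0 ≤ w x) (hl : ∀ x, w x ≤ C * w (x - 1))
    (hr : ∀ x, w x ≤ C * w (x + 1)) (hs : Summable fun x => w x ^ 2 * diag ρ x) :
    ∃ g : ℤ → ℝ, Summable g ∧
      ∀ t x, w x ^ 2 * diag (stark F t * ρ * star (stark F t)) x ≤ g x := by
  obtain ⟨R, hR, rfl⟩ := exists_sqrt hρ
  have h0 : ∀ x, diag (R * R) x = ‖R (ket x)‖ ^ 2 := fun x => by
    have := diag_conj_sq hR 1 x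
    simpa using this
  have hmem : Memℓp (fun x : ℤ => ((w x * ‖R (ket x)‖ : ℝ) : ℂ)) 2 := by
    refine memℓp_two_of_summable ?_
    simpa only [Complex.norm_real, norm_mul, norm_norm, mul_pow, h0, Real.norm_eq_abs, sq_abs]
      using hs
  let H : HS := ⟨_, hmem⟩
  -- Both hopping coefficients are `F⁻¹` times a difference of two numbers of modulus one, whence
  -- this bound for all times.
  let c : ℝ := F⁻¹ * 2
  have hc : 0 ≤ c := by positivity
  refine ⟨fun x => ‖NormedSpace.exp (((c * C : ℝ) : ℂ) • hop 1 1) H x‖ ^ 2,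
    summable_norm_sq _, fun t x => ?_⟩
  rw [diag_conj_sq hR, ← mul_pow]
  refine pow_le_pow_left₀ (mul_nonneg (hw x) (norm_nonneg _)) ?_ 2
  have hb : ∀ θ x, ∃ z : ℂ, ‖z‖ = 1 ∧ boost θ (ket x) = z • ket x := fun θ x => by
    refine ⟨Complex.exp (Complex.I * ((θ * x : ℝ) : ℂ)), Complex.norm_exp_I_mul_ofReal _, ?_⟩
    ext y
    simp only [boost_apply, lp.coeFn_smul, Pi.smul_apply, ket_apply, smul_eq_mul]
    split_ifs with h
    · rw [h]
    · simp
  obtain ⟨a, b, ha, hb', hab⟩ : ∃ a b : ℂ, ‖a‖ ≤ c ∧ ‖b‖ ≤ c ∧ star (starkFactor F t) =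
      star (Complex.exp (-(2 * Complex.I * t))) • NormedSpace.exp (hop a b) := by
    have hexp : ‖Complex.exp (Complex.I * (F * t : ℝ))‖ = 1 := Complex.norm_exp_I_mul_ofReal _
    have hexp' : ‖Complex.exp (-(Complex.I * (F * t : ℝ)))‖ = 1 := by
      rw [Complex.exp_neg, norm_inv, hexp, inv_one]
    have hFn : ‖(F : ℂ)⁻¹‖ = F⁻¹ := by
      rw [norm_inv, Complex.norm_real, Real.norm_of_nonneg hF.le]
    refine ⟨_, _, ?_, ?_, by rw [starkFactor, star_smul, NormedSpace.star_exp, star_hop]⟩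
    · rw [norm_star, norm_mul, hFn]
      refine mul_le_mul_of_nonneg_left ((norm_sub_le _ _).trans ?_) (by positivity)
      rw [hexp, norm_one]; norm_num
    · rw [norm_star, norm_mul, hFn]
      refine mul_le_mul_of_nonneg_left ((norm_sub_le _ _).trans ?_) (by positivity)
      rw [hexp', norm_one]; norm_num
  -- The boost is absorbed into the operator `R`: it multiplies each ket by a phase, so the same `H`
  -- still dominates.
  have hfin := weight_norm_exp_hop_le (R := R * star (boost (F * t))) (H := H) hC hw hl hr
    (fun y => by
      change w y * ‖R (star (boost (F * t)) (ket y))‖ ≤ w y * ‖R (ket y)‖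
      obtain ⟨z, hz, hz'⟩ := hb (-(F * t)) y
      rw [star_boost, hz', map_smul, norm_smul, hz, one_mul]) hc ha hb' x
  have e : ‖R (star (stark F t) (ket x))‖ =
      ‖(R * star (boost (F * t))) (NormedSpace.exp (hop a b) (ket x))‖ := by
    rw [stark_eq, star_mul, hab, mul_smul_comm]
    change ‖R (star (Complex.exp (-(2 * Complex.I * t))) • star (boost (F * t)) _)‖ = _
    rw [map_smul, norm_smul, norm_star, norm_exp_neg_two_I_mul, one_mul]
    rfl
  rw [e]
  exact hfin.trans ((Complex.re_le_norm _))

/-! ## Random walk steps of measures -/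

/-- The law of `Y + ξ` for independent `Y` and `ξ`, where `Y` has law `ν` and `ξ` takes the values
`0, 1, -1` with probabilities `a, b, c`. -/
def walkMeasure (a b c : ℝ) (ν : Measure ℝ) : Measure ℝ :=
  ENNReal.ofReal a • ν + ENNReal.ofReal b • ν.map (· + 1) + ENNReal.ofReal c • ν.map (· + (-1))

theorem lintegral_walkMeasure (a b c : ℝ) (ν : Measure ℝ) {f : ℝ → ℝ≥0∞} (hf : Measurable f) :
    ∫⁻ x, f x ∂(walkMeasure a b c ν) = ENNReal.ofReal a * ∫⁻ x, f x ∂ν +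
      ENNReal.ofReal b * ∫⁻ x, f (x + 1) ∂ν + ENNReal.ofReal c * ∫⁻ x, f (x + (-1)) ∂ν := by
  simp only [walkMeasure, lintegral_add_measure, lintegral_smul_measure, smul_eq_mul]
  rw [lintegral_map hf (measurable_add_const _), lintegral_map hf (measurable_add_const _)]

theorem integrable_walkMeasure (a b c : ℝ) {ν : Measure ℝ} {f : ℝ → ℝ} (h0 : Integrable f ν)
    (h1 : Integrable (fun x => f (x + 1)) ν) (h2 : Integrable (fun x => f (x + (-1))) ν) :
    Integrable f (walkMeasure a b c ν) := by
  refine ((h0.smul_measure ENNReal.ofReal_ne_top).add_measure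
    (Integrable.smul_measure ?_ ENNReal.ofReal_ne_top)).add_measure
    (Integrable.smul_measure ?_ ENNReal.ofReal_ne_top)
  · exact (MeasurableEmbedding.integrable_map_iff (measurableEmbedding_addRight _)).2 h1
  · exact (MeasurableEmbedding.integrable_map_iff (measurableEmbedding_addRight _)).2 h2

theorem integral_walkMeasure {V : Type*} [NormedAddCommGroup V] [NormedSpace ℝ V] {a b c : ℝ}
    (ha : 0 ≤ a) (hb : 0 ≤ b) (hc : 0 ≤ c) {ν : Measure ℝ} {f : ℝ → V} (h0 : Integrable f ν)
    (h1 : Integrable (fun x => f (x + 1)) ν) (h2 : Integrable (fun x => f (x + (-1))) ν) :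
    ∫ x, f x ∂(walkMeasure a b c ν) =
      a • ∫ x, f x ∂ν + b • ∫ x, f (x + 1) ∂ν + c • ∫ x, f (x + (-1)) ∂ν := by
  have h1' : Integrable f (ν.map (· + 1)) :=
    (MeasurableEmbedding.integrable_map_iff (measurableEmbedding_addRight _)).2 h1
  have h2' : Integrable f (ν.map (· + (-1))) :=
    (MeasurableEmbedding.integrable_map_iff (measurableEmbedding_addRight _)).2 h2
  have k0 := h0.smul_measure (c := ENNReal.ofReal a) ENNReal.ofReal_ne_top
  have k1 := h1'.smul_measure (c := ENNReal.ofReal b) ENNReal.ofReal_ne_top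
  have k2 := h2'.smul_measure (c := ENNReal.ofReal c) ENNReal.ofReal_ne_top
  rw [walkMeasure, integral_add_measure (k0.add_measure k1) k2, integral_add_measure k0 k1,
    integral_smul_measure, integral_smul_measure, integral_smul_measure,
    ENNReal.toReal_ofReal ha, ENNReal.toReal_ofReal hb, ENNReal.toReal_ofReal hc,
    (measurableEmbedding_addRight (1 : ℝ)).integral_map,
    (measurableEmbedding_addRight (-1 : ℝ)).integral_map]

theorem walkMeasure_univ {a b c : ℝ} (ha : 0 ≤ a) (hb : 0 ≤ b) (hc : 0 ≤ c) (hs : a + b + c = 1)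
    (ν : Measure ℝ) : walkMeasure a b c ν Set.univ = ν Set.univ := by
  have h := lintegral_walkMeasure a b c ν (f := fun _ => 1) measurable_const
  simp only [lintegral_const, one_mul] at h
  rw [h, ← add_mul, ← add_mul, ← ENNReal.ofReal_add ha hb,
    ← ENNReal.ofReal_add (add_nonneg ha hb) hc, hs, ENNReal.ofReal_one, one_mul]

theorem walkMeasure_mono (a b c : ℝ) {ν ν' : Measure ℝ} (h : ν ≤ ν') :
    walkMeasure a b c ν ≤ walkMeasure a b c ν' := by
  unfold walkMeasure
  gcongr <;> exact measurable_add_const _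

theorem walkMeasure_smul (a b c : ℝ) (r : ℝ≥0∞) (ν : Measure ℝ) :
    walkMeasure a b c (r • ν) = r • walkMeasure a b c ν := by
  simp only [walkMeasure, Measure.map_smul, smul_add, smul_smul, mul_comm]

theorem iterate_walkMeasure_univ {a b c : ℝ} (ha : 0 ≤ a) (hb : 0 ≤ b) (hc : 0 ≤ c)
    (hs : a + b + c = 1) (ν : Measure ℝ) (n : ℕ) :
    (walkMeasure a b c)^[n] ν Set.univ = ν Set.univ := by
  induction n with
  | zero => rfl
  | succ n ih => rw [Function.iterate_succ_apply', walkMeasure_univ ha hb hc hs, ih]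

theorem iterate_walkMeasure_mono (a b c : ℝ) {ν ν' : Measure ℝ} (h : ν ≤ ν') (n : ℕ) :
    (walkMeasure a b c)^[n] ν ≤ (walkMeasure a b c)^[n] ν' :=
  Monotone.iterate (fun _ _ h => walkMeasure_mono a b c h) n h

/-! ## Measures on the lattice -/

/-- The measure on `ℝ` with mass `d x` at the integer `x`. -/
def latticeLaw (d : ℤ → ℝ) : Measure ℝ :=
  Measure.sum fun x : ℤ => ENNReal.ofReal (d x) • Measure.dirac (x : ℝ)

theorem positionLaw_eq (A : HS →L[ℂ] HS) : positionLaw A = latticeLaw (diag A) := rfl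

theorem lintegral_latticeLaw (d : ℤ → ℝ) {f : ℝ → ℝ≥0∞} :
    ∫⁻ x, f x ∂(latticeLaw d) = ∑' x : ℤ, ENNReal.ofReal (d x) * f x := by
  simp [latticeLaw, lintegral_sum_measure, lintegral_smul_measure]

theorem latticeLaw_walkStep {a b c : ℝ} (ha : 0 ≤ a) (hb : 0 ≤ b) (hc : 0 ≤ c) {d : ℤ → ℝ}
    (hd : ∀ x, 0 ≤ d x) :
    latticeLaw (walkStep a b c d) = walkMeasure a b c (latticeLaw d) := by
  refine Measure.ext_of_lintegral _ fun f hf => ?_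
  rw [lintegral_walkMeasure _ _ _ _ hf]
  simp only [lintegral_latticeLaw]
  have e1 : ∑' x : ℤ, ENNReal.ofReal (d x) * f (x + 1) =
      ∑' x : ℤ, ENNReal.ofReal (d (x - 1)) * f x := by
    rw [← (Equiv.subRight (1 : ℤ)).tsum_eq]
    simp
  have e2 : ∑' x : ℤ, ENNReal.ofReal (d x) * f (x + (-1)) =
      ∑' x : ℤ, ENNReal.ofReal (d (x + 1)) * f x := by
    rw [← (Equiv.addRight (1 : ℤ)).tsum_eq]
    simp
  rw [e1, e2, ← ENNReal.tsum_mul_left, ← ENNReal.tsum_mul_left, ← ENNReal.tsum_mul_left,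
    ← ENNReal.tsum_add, ← ENNReal.tsum_add]
  refine tsum_congr fun x => ?_
  rw [walkStep, ENNReal.ofReal_add (by have := hd x; have := hd (x - 1); positivity)
      (mul_nonneg hc (hd _)), ENNReal.ofReal_add (mul_nonneg ha (hd _)) (mul_nonneg hb (hd _)),
    ENNReal.ofReal_mul ha, ENNReal.ofReal_mul hb, ENNReal.ofReal_mul hc]
  ring

theorem walkStep_nonneg {a b c : ℝ} (ha : 0 ≤ a) (hb : 0 ≤ b) (hc : 0 ≤ c) {d : ℤ → ℝ}
    (hd : ∀ x, 0 ≤ d x) (x : ℤ) : 0 ≤ walkStep a b c d x := by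
  have h1 := hd x
  have h2 := hd (x - 1)
  have h3 := hd (x + 1)
  unfold walkStep; positivity

theorem latticeLaw_iterate_walkStep {a b c : ℝ} (ha : 0 ≤ a) (hb : 0 ≤ b) (hc : 0 ≤ c)
    {d : ℤ → ℝ} (hd : ∀ x, 0 ≤ d x) (n : ℕ) : (∀ x, 0 ≤ (walkStep a b c)^[n] d x) ∧
    latticeLaw ((walkStep a b c)^[n] d) = (walkMeasure a b c)^[n] (latticeLaw d) := by
  induction n with
  | zero => exact ⟨hd, rfl⟩
  | succ n ih =>
    simp only [Function.iterate_succ_apply']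
    exact ⟨walkStep_nonneg ha hb hc ih.1, by rw [latticeLaw_walkStep ha hb hc ih.1, ih.2]⟩

theorem latticeLaw_univ {d : ℤ → ℝ} (hd : ∀ x, 0 ≤ d x) (hs : HasSum d 1) :
    latticeLaw d Set.univ = 1 := by
  have h := lintegral_latticeLaw d (f := fun _ => 1)
  simp only [lintegral_const, one_mul, mul_one] at h
  rw [h, ← ENNReal.ofReal_tsum_of_nonneg hd hs.summable, hs.tsum_eq, ENNReal.ofReal_one]

theorem lintegral_latticeLaw_le {d g : ℤ → ℝ} {W : ℝ → ℝ} (hd : ∀ x, 0 ≤ d x)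
    (hW : ∀ x, 0 ≤ W x) (hg : Summable g) (h : ∀ x : ℤ, W x * d x ≤ g x) :
    ∫⁻ x, ENNReal.ofReal (W x) ∂(latticeLaw d) ≤ ENNReal.ofReal (∑' x, g x) := by
  have hg0 : ∀ x, 0 ≤ g x := fun x => (mul_nonneg (hW _) (hd x)).trans (h x)
  rw [lintegral_latticeLaw, ENNReal.ofReal_tsum_of_nonneg hg0 hg]
  refine ENNReal.tsum_le_tsum fun x => ?_
  rw [← ENNReal.ofReal_mul (hd x), mul_comm]
  exact ENNReal.ofReal_le_ofReal (h x)

/-- Uniform tightness: a finite set carrying all but `1 / 2` of the sum of `g` leaves at most mass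
`1 / 2` outside for every law. -/
theorem exists_half_le_latticeLaw_Icc {ι : Type*} {d : ι → ℤ → ℝ} {g : ℤ → ℝ}
    (hd : ∀ i x, 0 ≤ d i x) (hs : ∀ i, HasSum (d i) 1) (hg : Summable g)
    (h : ∀ i x, d i x ≤ g x) :
    ∃ K : ℝ, 0 ≤ K ∧ ∀ i, ENNReal.ofReal (1 / 2) ≤ latticeLaw (d i) (Set.Icc (-K) K) := by
  obtain ⟨s, hs'⟩ := (hg.hasSum.eventually (lt_mem_nhds (show tsum g - 1 / 2 < tsum g by
    linarith))).exists
  obtain ⟨K, hK⟩ : ∃ K : ℝ, 0 ≤ K ∧ ∀ x ∈ s, |(x : ℝ)| ≤ K :=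
    ⟨∑ x ∈ s, |(x : ℝ)|, Finset.sum_nonneg fun _ _ => abs_nonneg _,
      fun x hx => Finset.single_le_sum (f := fun x : ℤ => |(x : ℝ)|) (fun _ _ => abs_nonneg _) hx⟩
  refine ⟨K, hK.1, fun i => ?_⟩
  have h1 : 1 / 2 ≤ ∑ x ∈ s, d i x := by
    have e1 := (hs i).summable.sum_add_tsum_compl (s := s)
    have e2 := hg.sum_add_tsum_compl (s := s)
    have e3 : ∑' x : ↑((s : Set ℤ)ᶜ), d i x ≤ ∑' x : ↑((s : Set ℤ)ᶜ), g x :=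
      ((hs i).summable.subtype _).tsum_le_tsum (fun x => h i x) (hg.subtype _)
    rw [(hs i).tsum_eq] at e1
    linarith
  have h2 : latticeLaw (d i) (Set.Icc (-K) K) =
      ∑' x : ℤ, ENNReal.ofReal (d i x) * (Set.Icc (-K) K).indicator 1 (x : ℝ) := by
    rw [← lintegral_latticeLaw, lintegral_indicator_one measurableSet_Icc]
  rw [h2]
  calc ENNReal.ofReal (1 / 2) ≤ ENNReal.ofReal (∑ x ∈ s, d i x) := ENNReal.ofReal_le_ofReal h1
    _ = ∑ x ∈ s, ENNReal.ofReal (d i x) * (Set.Icc (-K) K).indicator 1 (x : ℝ) := by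
      rw [ENNReal.ofReal_sum_of_nonneg fun x _ => hd i x]
      refine Finset.sum_congr rfl fun x hx => ?_
      rw [Set.indicator_of_mem (Set.mem_Icc.2 (abs_le.1 (hK.2 x hx))), Pi.one_apply, mul_one]
    _ ≤ _ := ENNReal.sum_le_tsum s

/-- The distance to `1` is at most the sum of `g x * |exp (i t x) - 1|`, which tends to `0` by
dominated convergence. This is why an initial law varying with `n` does not affect the limit. -/
theorem tendsto_charFun_latticeLaw {d : ℕ → ℤ → ℝ} {g : ℤ → ℝ}
    (hd : ∀ i x, 0 ≤ d i x) (hs : ∀ i, HasSum (d i) 1) (hg : Summable g)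
    (h : ∀ i x, d i x ≤ g x) {t : ℕ → ℝ} (ht : Tendsto t atTop (𝓝 0)) :
    Tendsto (fun n => charFun (latticeLaw (d n)) (t n)) atTop (𝓝 1) := by
  rw [tendsto_iff_norm_sub_tendsto_zero]
  have hlim : Tendsto (fun n => ∑' x : ℤ, g x * ‖Complex.exp (t n * x * Complex.I) - 1‖) atTop
      (𝓝 (∑' x : ℤ, 0)) := by
    refine tendsto_tsum_of_dominated_convergence (bound := fun x => g x * 2) (hg.mul_right 2)
      (fun x => ?_) (Eventually.of_forall fun n x => ?_)
    · have : Tendsto (fun s : ℝ => g x * ‖Complex.exp (s * x * Complex.I) - 1‖) (𝓝 0)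
          (𝓝 (g x * ‖Complex.exp ((0 : ℝ) * x * Complex.I) - 1‖)) :=
        Continuous.tendsto (by fun_prop) 0
      simp at this
      exact this.comp ht
    · have hg0 : 0 ≤ g x := (hd 0 x).trans (h 0 x)
      rw [Real.norm_of_nonneg (by positivity)]
      gcongr
      refine (norm_sub_le _ _).trans ?_
      have := Complex.norm_exp_ofReal_mul_I (t n * x)
      push_cast at this
      rw [this, norm_one]; norm_num
  rw [tsum_zero] at hlim
  refine squeeze_zero (fun n => norm_nonneg _) (fun n => ?_) hlim
  have : IsProbabilityMeasure (latticeLaw (d n)) := ⟨latticeLaw_univ (hd n) (hs n)⟩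
  have hint : Integrable (fun x : ℝ => Complex.exp (t n * x * Complex.I)) (latticeLaw (d n)) := by
    refine Integrable.of_bound (Continuous.aestronglyMeasurable (by fun_prop)) 1
      (Eventually.of_forall fun x => ?_)
    have := Complex.norm_exp_ofReal_mul_I (t n * x)
    push_cast at this
    rw [this]
  have e1 : charFun (latticeLaw (d n)) (t n) - 1 =
      ∫ x : ℝ, (Complex.exp (t n * x * Complex.I) - 1) ∂(latticeLaw (d n)) := by
    rw [integral_sub hint (integrable_const _), charFun_apply_real]
    simp
  have hint2 := hint.sub (integrable_const (1 : ℂ))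
  rw [e1]
  refine (norm_integral_le_integral_norm _).trans ?_
  have hsum := hasSum_integral_measure hint2.norm
  refine (hsum.tsum_eq.symm.le).trans ?_
  refine (hsum.summable).tsum_le_tsum (fun x => ?_) ?_
  · rw [integral_smul_measure, integral_dirac, ENNReal.toReal_ofReal (hd n x), smul_eq_mul]
    exact mul_le_mul_of_nonneg_right (h n x) (norm_nonneg _)
  · refine Summable.of_nonneg_of_le (fun x => ?_) (fun x => ?_) (hg.mul_right 2)
    · exact mul_nonneg ((hd 0 x).trans (h 0 x)) (norm_nonneg _)
    · have hg0 : 0 ≤ g x := (hd 0 x).trans (h 0 x)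
      gcongr
      refine (norm_sub_le _ _).trans ?_
      have := Complex.norm_exp_ofReal_mul_I (t n * x)
      push_cast at this
      rw [this, norm_one]; norm_num

/-! ## Central limit theorem -/

section CentralLimit

variable {a b c : ℝ}

theorem isProbabilityMeasure_walk (ha : 0 ≤ a) (hb : 0 ≤ b) (hc : 0 ≤ c) (hs : a + b + c = 1)
    (ν : Measure ℝ) [IsProbabilityMeasure ν] (n : ℕ) :
    IsProbabilityMeasure ((walkMeasure a b c)^[n] ν) :=
  ⟨by rw [iterate_walkMeasure_univ ha hb hc hs, measure_univ]⟩

theorem charFun_walkMeasure (ha : 0 ≤ a) (hb : 0 ≤ b) (hc : 0 ≤ c) (ν : Measure ℝ)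
    [IsFiniteMeasure ν] (t : ℝ) : charFun (walkMeasure a b c ν) t =
      (a + b * Complex.exp (t * Complex.I) + c * Complex.exp (-(t * Complex.I))) * charFun ν t := by
  have hint : ∀ r : ℝ, Integrable (fun x : ℝ => Complex.exp (t * (x + r : ℝ) * Complex.I)) ν :=
    fun r => by
      refine Integrable.of_bound (Continuous.aestronglyMeasurable (by fun_prop)) 1
        (Eventually.of_forall fun x => ?_)
      have := Complex.norm_exp_ofReal_mul_I (t * (x + r))
      push_cast at this ⊢
      rw [this]
  have h0 : Integrable (fun x : ℝ => Complex.exp (t * x * Complex.I)) ν := by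
    simpa using hint 0
  have e : ∀ r : ℝ, ∫ x : ℝ, Complex.exp (t * (x + r : ℝ) * Complex.I) ∂ν =
      Complex.exp (t * r * Complex.I) * ∫ x : ℝ, Complex.exp (t * x * Complex.I) ∂ν := fun r => by
    rw [← integral_const_mul]
    refine integral_congr_ae (Eventually.of_forall fun x => ?_)
    simp only [← Complex.exp_add]
    congr 1; push_cast; ring
  rw [charFun_apply_real, charFun_apply_real, integral_walkMeasure ha hb hc h0 (hint 1) (hint (-1)),
    e, e]
  simp only [Complex.real_smul]
  push_cast
  rw [mul_one, mul_neg_one, neg_mul]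
  ring

theorem charFun_iterate_walkMeasure (ha : 0 ≤ a) (hb : 0 ≤ b) (hc : 0 ≤ c) (hs : a + b + c = 1)
    (ν : Measure ℝ) [IsProbabilityMeasure ν] (t : ℝ) (n : ℕ) :
    charFun ((walkMeasure a b c)^[n] ν) t =
      (a + b * Complex.exp (t * Complex.I) + c * Complex.exp (-(t * Complex.I))) ^ n *
        charFun ν t := by
  induction n with
  | zero => simp
  | succ n ih =>
    have := isProbabilityMeasure_walk ha hb hc hs ν n
    rw [Function.iterate_succ_apply', charFun_walkMeasure ha hb hc, ih, pow_succ']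
    ring

theorem charFun_map_affine (μ : Measure ℝ) (k r t : ℝ) :
    charFun (μ.map fun x => r * (x - k)) t =
      Complex.exp (-(r * t * k * Complex.I)) * charFun μ (r * t) := by
  have h : (μ.map fun x => r * (x - k)) = (μ.map (fun x => x + (-k))).map (fun y => r * y) := by
    rw [Measure.map_map (by fun_prop) (by fun_prop)]
    rfl
  rw [h, charFun_map_mul, charFun_map_add_const, mul_comm]
  congr 2
  simp

theorem integral_walkMeasure_dirac (ha : 0 ≤ a) (hb : 0 ≤ b) (hc : 0 ≤ c) (f : ℝ → ℝ) :
    ∫ x, f x ∂(walkMeasure a b c (Measure.dirac 0)) = a * f 0 + b * f 1 + c * f (-1) := by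
  have h : ∀ g : ℝ → ℝ, Integrable g (Measure.dirac 0) := fun g => integrable_dirac (by simp)
  rw [integral_walkMeasure ha hb hc (h _) (h _) (h _)]
  simp

/-- The characteristic function factors into that of a standardised sum of `n` independent steps,
handled by the classical theorem with `κ` the law of one step, and that of the initial law at an
argument of order `n ^ (-1/2)`. -/
theorem tendsto_charFun_walk (ha : 0 ≤ a) (hb : 0 ≤ b) (hc : 0 ≤ c) (hs : a + b + c = 1)
    (hv : 0 < b + c - (b - c) ^ 2) {ν : ℕ → Measure ℝ} [∀ n, IsProbabilityMeasure (ν n)]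
    (hν : ∀ t : ℕ → ℝ, Tendsto t atTop (𝓝 0) → Tendsto (fun n => charFun (ν n) (t n)) atTop (𝓝 1))
    (t : ℝ) :
    Tendsto (fun n : ℕ => charFun (((walkMeasure a b c)^[n] (ν n)).map
      fun x => (Real.sqrt ((b + c - (b - c) ^ 2) * n))⁻¹ * (x - n * (b - c))) t) atTop
      (𝓝 (Complex.exp (-t ^ 2 / 2))) := by
  set σ := Real.sqrt (b + c - (b - c) ^ 2) with hσ
  have hσ0 : 0 < σ := Real.sqrt_pos.2 hv
  have hσ2 : σ ^ 2 = b + c - (b - c) ^ 2 := Real.sq_sqrt hv.le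
  let κ := walkMeasure a b c (Measure.dirac 0)
  have hκ : IsProbabilityMeasure κ :=
    ⟨by rw [walkMeasure_univ ha hb hc hs, measure_univ]⟩
  have hclt := ProbabilityTheory.tendsto_charFun_inv_sqrt_mul_pow (P := κ)
    (X := fun x => σ⁻¹ * (x - (b - c))) (by fun_prop) (by
      rw [integral_walkMeasure_dirac ha hb hc]
      linear_combination (-σ⁻¹ * (b - c)) * hs) (by
      simp only [Pi.pow_apply]
      rw [integral_walkMeasure_dirac ha hb hc (fun x => (σ⁻¹ * (x - (b - c))) ^ 2)]
      have : (σ⁻¹) ^ 2 * (b + c - (b - c) ^ 2) = 1 := by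
        rw [← hσ2, ← mul_pow, inv_mul_cancel₀ hσ0.ne', one_pow]
      linear_combination this + ((σ⁻¹) ^ 2 * (b - c) ^ 2) * hs) t
  have ht : Tendsto (fun n : ℕ => (Real.sqrt ((b + c - (b - c) ^ 2) * n))⁻¹ * t) atTop (𝓝 0) := by
    rw [← zero_mul t]
    refine Tendsto.mul_const t (tendsto_inv_atTop_zero.comp (Real.tendsto_sqrt_atTop.comp ?_))
    exact tendsto_natCast_atTop_atTop.const_mul_atTop hv
  have hmul := hclt.mul (hν _ ht)
  rw [mul_one] at hmul
  refine hmul.congr fun n => ?_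
  rw [charFun_map_affine, charFun_map_affine, charFun_iterate_walkMeasure ha hb hc hs,
    charFun_walkMeasure ha hb hc, charFun_dirac, Real.sqrt_mul hv.le, ← hσ]
  rw [mul_pow, ← Complex.exp_nat_mul, ← mul_assoc]
  simp only [inner_zero_left, Complex.ofReal_zero, zero_mul, Complex.exp_zero, mul_one, mul_inv,
    Complex.ofReal_mul, Complex.ofReal_inv, Complex.ofReal_sub, Complex.ofReal_natCast, mul_assoc]
  congr 2
  ring

theorem tendsto_integral_walk (ha : 0 ≤ a) (hb : 0 ≤ b) (hc : 0 ≤ c) (hs : a + b + c = 1)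
    (hv : 0 < b + c - (b - c) ^ 2) {ν : ℕ → Measure ℝ} [∀ n, IsProbabilityMeasure (ν n)]
    (hν : ∀ t : ℕ → ℝ, Tendsto t atTop (𝓝 0) → Tendsto (fun n => charFun (ν n) (t n)) atTop (𝓝 1))
    {f : ℝ → ℝ} (hf : Continuous f) {C : ℝ} (hC : ∀ x, |f x| ≤ C) :
    Tendsto (fun n : ℕ => ∫ x, f ((x - n * (b - c)) / Real.sqrt ((b + c - (b - c) ^ 2) * n))
      ∂((walkMeasure a b c)^[n] (ν n))) atTop
      (𝓝 (∫ x, f x * (Real.exp (-x ^ 2 / 2) / Real.sqrt (2 * Real.pi)))) := by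
  have hp := fun n => isProbabilityMeasure_walk ha hb hc hs (ν n) n
  have hm : ∀ n : ℕ, Measurable fun x : ℝ =>
      (Real.sqrt ((b + c - (b - c) ^ 2) * n))⁻¹ * (x - n * (b - c)) := fun n => by fun_prop
  let P : ℕ → ProbabilityMeasure ℝ := fun n =>
    ⟨_, Measure.isProbabilityMeasure_map (μ := (walkMeasure a b c)^[n] (ν n)) (hm n).aemeasurable⟩
  let G : ProbabilityMeasure ℝ := ⟨ProbabilityTheory.gaussianReal 0 1, inferInstance⟩
  have hPG : Tendsto P atTop (𝓝 G) := by
    refine ProbabilityMeasure.tendsto_iff_tendsto_charFun.2 fun t => ?_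
    have := tendsto_charFun_walk ha hb hc hs hv hν t
    have e : charFun (G : Measure ℝ) t = Complex.exp (-t ^ 2 / 2) := by
      change charFun (ProbabilityTheory.gaussianReal 0 1) t = _
      rw [ProbabilityTheory.charFun_gaussianReal]
      congr 1
      simp
      ring
    rw [e]
    exact this
  let fb : BoundedContinuousFunction ℝ ℝ := BoundedContinuousFunction.ofNormedAddCommGroup f hf C hC
  have h := (ProbabilityMeasure.tendsto_iff_forall_integral_tendsto.1 hPG) fb
  have e1 : ∫ x, fb x ∂(G : Measure ℝ) =
      ∫ x, f x * (Real.exp (-x ^ 2 / 2) / Real.sqrt (2 * Real.pi)) := by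
    change ∫ x, f x ∂(ProbabilityTheory.gaussianReal 0 1) = _
    rw [ProbabilityTheory.integral_gaussianReal_eq_integral_smul one_ne_zero]
    refine integral_congr_ae (Eventually.of_forall fun x => ?_)
    simp [ProbabilityTheory.gaussianPDFReal]
    ring
  rw [e1] at h
  refine h.congr fun n => ?_
  change ∫ x, f x ∂(((walkMeasure a b c)^[n] (ν n)).map _) = _
  rw [integral_map (hm n).aemeasurable hf.aestronglyMeasurable]
  refine integral_congr_ae (Eventually.of_forall fun x => ?_)
  simp only [div_eq_inv_mul]

end CentralLimit

/-! ## Moments -/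

section Moments

variable {a b c : ℝ}

theorem integrable_sub_sq {ν : Measure ℝ} [IsFiniteMeasure ν] (h1 : Integrable (fun x => x) ν)
    (h2 : Integrable (fun x => x ^ 2) ν) (r : ℝ) : Integrable (fun x => (x - r) ^ 2) ν := by
  have : (fun x : ℝ => (x - r) ^ 2) = fun x => x ^ 2 - (2 * r) * x + r ^ 2 := by
    funext x; ring
  rw [this]
  exact (h2.sub (h1.const_mul _)).add (integrable_const _)

theorem isFiniteMeasure_walk (ha : 0 ≤ a) (hb : 0 ≤ b) (hc : 0 ≤ c) (hs : a + b + c = 1)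
    (ν : Measure ℝ) [IsFiniteMeasure ν] (n : ℕ) :
    IsFiniteMeasure ((walkMeasure a b c)^[n] ν) :=
  ⟨by rw [iterate_walkMeasure_univ ha hb hc hs]; exact measure_lt_top _ _⟩

/-- The mass of `ν` is kept in the formulas because the large deviation argument applies them to
tilted measures that are not normalised. -/
theorem moments_iterate_walkMeasure (ha : 0 ≤ a) (hb : 0 ≤ b) (hc : 0 ≤ c) (hs : a + b + c = 1)
    (ν : Measure ℝ) [IsFiniteMeasure ν] (h1 : Integrable (fun x => x) ν)
    (h2 : Integrable (fun x => x ^ 2) ν) (n : ℕ) :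
    Integrable (fun x => x) ((walkMeasure a b c)^[n] ν) ∧
    Integrable (fun x => x ^ 2) ((walkMeasure a b c)^[n] ν) ∧
    ∫ x, x ∂((walkMeasure a b c)^[n] ν) = ∫ x, x ∂ν + n * (b - c) * ν.real Set.univ ∧
    ∫ x, (x - n * (b - c)) ^ 2 ∂((walkMeasure a b c)^[n] ν) =
      ∫ x, x ^ 2 ∂ν + n * (b + c - (b - c) ^ 2) * ν.real Set.univ := by
  induction n with
  | zero => simpa using ⟨h1, h2⟩
  | succ n ih =>
    obtain ⟨i1, i2, e1, e2⟩ := ih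
    have hfin := isFiniteMeasure_walk ha hb hc hs ν n
    have hmass : ((walkMeasure a b c)^[n] ν).real Set.univ = ν.real Set.univ := by
      rw [measureReal_def, measureReal_def, iterate_walkMeasure_univ ha hb hc hs]
    rw [Function.iterate_succ_apply']
    set ν' := (walkMeasure a b c)^[n] ν
    have k1 : ∀ r : ℝ, Integrable (fun x => x + r) ν' := fun r => i1.add (integrable_const r)
    have k2 : ∀ r : ℝ, Integrable (fun x => (x - r) ^ 2) ν' := integrable_sub_sq i1 i2
    have k2' : ∀ r s : ℝ, Integrable (fun x => (x + r - s) ^ 2) ν' := fun r s => by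
      simpa [add_sub_assoc, sub_sub_eq_add_sub, ← sub_eq_add_neg] using
        (k2 (s - r)).congr (Eventually.of_forall fun x => by ring)
    refine ⟨integrable_walkMeasure _ _ _ i1 (k1 1) (k1 (-1)),
      integrable_walkMeasure _ _ _ i2 (by simpa using k2' 1 0) (by simpa using k2' (-1) 0), ?_, ?_⟩
    · rw [integral_walkMeasure ha hb hc i1 (k1 1) (k1 (-1)),
        integral_add i1 (integrable_const _), integral_add i1 (integrable_const _), integral_const,
        integral_const, hmass, e1]
      simp only [smul_eq_mul]
      push_cast
      linear_combination (∫ x, x ∂ν + n * (b - c) * ν.real Set.univ) * hs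
    · set r : ℝ := n * (b - c)
      set m := b - c with hm
      have hr : ((n + 1 : ℕ) : ℝ) * m = r + m := by push_cast; ring
      have e : ∀ s : ℝ, ∫ x, (x + s - (r + m)) ^ 2 ∂ν' =
          ∫ x, (x - r) ^ 2 ∂ν' + 2 * (s - m) * ∫ x, (x - r) ∂ν' +
            (s - m) ^ 2 * ν.real Set.univ := fun s => by
        have : (fun x : ℝ => (x + s - (r + m)) ^ 2) =
            fun x => (x - r) ^ 2 + 2 * (s - m) * (x - r) + (s - m) ^ 2 := by
          funext x; ring
        have j : Integrable (fun x => x - r) ν' := i1.sub (integrable_const r)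
        have j2 : Integrable (fun x => (x - r) ^ 2 + 2 * (s - m) * (x - r)) ν' :=
          (k2 r).add (j.const_mul _)
        rw [this, integral_add j2 (integrable_const _),
          integral_add (k2 r) (j.const_mul _), integral_const_mul, integral_const, hmass,
          smul_eq_mul]
        ring
      have e0 := e 0
      simp only [add_zero] at e0
      rw [hr, integral_walkMeasure ha hb hc (k2 _) (k2' 1 _) (k2' (-1) _), e 1, e (-1), e0, e2]
      simp only [smul_eq_mul]
      push_cast
      rw [hm]
      -- The first-order term `Z` need not vanish, but its coefficient does: it is twice the mean of
      -- a centred step.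
      generalize ∫ x, (x - r) ∂ν' = Z
      generalize ν.real Set.univ = M
      generalize ∫ x, x ^ 2 ∂ν = Q
      have ha' : a = 1 - b - c := by linarith
      subst ha'
      ring

end Moments

/-! ## Large deviations: the rate function -/

/-- The moment generating function of one step of the walk. -/
def walkMGF (a b c α : ℝ) : ℝ := a + b * Real.exp α + c * Real.exp (-α)

/-- The Legendre transform of the logarithm of the moment generating function. -/
def walkRate (a b c x : ℝ) : EReal := ⨆ α : ℝ, ((α * x - Real.log (walkMGF a b c α) : ℝ) : EReal)

section Rate

variable {a b c : ℝ}

theorem walkMGF_pos (ha : 0 ≤ a) (hb : 0 < b) (hc : 0 < c) (α : ℝ) : 0 < walkMGF a b c α := by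
  unfold walkMGF; positivity

/-- Jensen's inequality, obtained by averaging the tangent line of `exp` at the mean exponent `α *
m`. -/
theorem mul_mean_le_log_walkMGF (ha : 0 ≤ a) (hb : 0 < b) (hc : 0 < c) (hs : a + b + c = 1)
    (α : ℝ) : α * (b - c) ≤ Real.log (walkMGF a b c α) := by
  rw [Real.le_log_iff_exp_le (walkMGF_pos ha hb hc α)]
  set m := b - c with hm
  have key : ∀ y, Real.exp (α * m) * (1 + (y - α * m)) ≤ Real.exp y := fun y => by
    have h := Real.add_one_le_exp (y - α * m)
    calc _ ≤ Real.exp (α * m) * Real.exp (y - α * m) := by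
          gcongr; linarith
      _ = Real.exp y := by rw [← Real.exp_add]; ring_nf
  have k0 := key 0
  have k1 := mul_le_mul_of_nonneg_left (key α) hb.le
  have k2 := mul_le_mul_of_nonneg_left (key (-α)) hc.le
  have k0' := mul_le_mul_of_nonneg_left k0 ha
  rw [Real.exp_zero, mul_one] at k0'
  unfold walkMGF
  have e : Real.exp (α * m) = a * (Real.exp (α * m) * (1 + (0 - α * m))) +
      b * (Real.exp (α * m) * (1 + (α - α * m))) +
      c * (Real.exp (α * m) * (1 + (-α - α * m))) := by
    rw [hm]
    linear_combination (Real.exp (α * (b - c)) * (α * (b - c) - 1)) * hs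
  linarith

theorem log_walkMGF_le_abs (ha : 0 ≤ a) (hb : 0 < b) (hc : 0 < c) (hs : a + b + c = 1) (α : ℝ) :
    Real.log (walkMGF a b c α) ≤ |α| := by
  rw [Real.log_le_iff_le_exp (walkMGF_pos ha hb hc α)]
  have h0 : (1 : ℝ) ≤ Real.exp |α| := Real.one_le_exp (abs_nonneg α)
  have h1 : Real.exp α ≤ Real.exp |α| := Real.exp_le_exp.2 (le_abs_self α)
  have h2 : Real.exp (-α) ≤ Real.exp |α| := Real.exp_le_exp.2 (neg_le_abs α)
  calc walkMGF a b c α ≤ a * Real.exp |α| + b * Real.exp |α| + c * Real.exp |α| := by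
        unfold walkMGF
        have := mul_le_mul_of_nonneg_left h0 ha
        gcongr
        linarith
    _ = _ := by rw [← add_mul, ← add_mul, hs, one_mul]

/-- Keeping only the larger exponential gives growth at least `|α|` up to a constant. Hence the rate
function is bounded on `[-1, 1]`; the matching upper bound `log_walkMGF_le_abs` makes it infinite
outside. -/
theorem abs_add_log_min_le (ha : 0 ≤ a) (hb : 0 < b) (hc : 0 < c) (α : ℝ) :
    |α| + Real.log (min b c) ≤ Real.log (walkMGF a b c α) := by
  have hmin : 0 < min b c := lt_min hb hc
  rw [← Real.log_exp |α|, ← Real.log_mul (Real.exp_pos _).ne' hmin.ne']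
  refine Real.log_le_log (by positivity) ?_
  have hbe := mul_pos hb (Real.exp_pos α)
  have hce := mul_pos hc (Real.exp_pos (-α))
  unfold walkMGF
  rcases abs_cases α with ⟨h, -⟩ | ⟨h, -⟩ <;> rw [h]
  · have := mul_le_mul_of_nonneg_left (min_le_left b c) (Real.exp_pos α).le
    linarith
  · have := mul_le_mul_of_nonneg_left (min_le_right b c) (Real.exp_pos (-α)).le
    linarith

/-- Every speed in `(-1, 1)` is the mean of an exponentially tilted step. -/
theorem exists_tilt (ha : 0 ≤ a) (hb : 0 < b) (hc : 0 < c) {x : ℝ} (hx : x ∈ Set.Ioo (-1 : ℝ) 1) :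
    ∃ α, b * Real.exp α / walkMGF a b c α - c * Real.exp (-α) / walkMGF a b c α = x := by
  -- Clearing the denominator gives `b(1 - x)e^α - c(1 + x)e^(-α) - ax = 0`; both exponential
  -- coefficients have the right sign exactly because `-1 < x < 1`, so the intermediate value
  -- theorem applies.
  have hb' : 0 < b * (1 - x) := mul_pos hb (by linarith [hx.2])
  have hc' : 0 < c * (1 + x) := mul_pos hc (by linarith [hx.1])
  have hcont : Continuous fun α : ℝ =>
      b * (1 - x) * Real.exp α + -(c * (1 + x) * Real.exp (-α)) + -(a * x) := by fun_prop
  have htop : Tendsto (fun α : ℝ =>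
      b * (1 - x) * Real.exp α + -(c * (1 + x) * Real.exp (-α)) + -(a * x)) atTop atTop := by
    refine Tendsto.atTop_add (C := -(a * x)) (Tendsto.atTop_add (C := -(c * (1 + x) * 0))
      (Real.tendsto_exp_atTop.const_mul_atTop hb') ?_) tendsto_const_nhds
    exact ((Real.tendsto_exp_neg_atTop_nhds_zero).const_mul _).neg
  have hbot : Tendsto (fun α : ℝ =>
      b * (1 - x) * Real.exp α + -(c * (1 + x) * Real.exp (-α)) + -(a * x)) atBot atBot := by
    refine Tendsto.atBot_add (C := -(a * x)) (Tendsto.add_atBot (C := b * (1 - x) * 0)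
      ((Real.tendsto_exp_atBot).const_mul _) ?_) tendsto_const_nhds
    exact tendsto_neg_atTop_atBot.comp
      ((Real.tendsto_exp_atTop.comp tendsto_neg_atBot_atTop).const_mul_atTop hc')
  obtain ⟨α, hα⟩ := hcont.surjective htop hbot 0
  refine ⟨α, ?_⟩
  rw [← sub_div, div_eq_iff (walkMGF_pos ha hb hc α).ne', walkMGF]
  linear_combination hα

theorem le_walkRate (x α : ℝ) :
    ((α * x - Real.log (walkMGF a b c α) : ℝ) : EReal) ≤ walkRate a b c x :=
  le_iSup (fun α : ℝ => ((α * x - Real.log (walkMGF a b c α) : ℝ) : EReal)) α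

theorem walkRate_le_coe {x r : ℝ} :
    walkRate a b c x ≤ (r : EReal) ↔ ∀ α : ℝ, α * x - Real.log (walkMGF a b c α) ≤ r := by
  simp only [walkRate, iSup_le_iff, EReal.coe_le_coe_iff]

theorem walkRate_nonneg (hs : a + b + c = 1) (x : ℝ) : 0 ≤ walkRate a b c x := by
  have := le_walkRate (a := a) (b := b) (c := c) x 0
  simpa [walkMGF, hs] using this

theorem walkRate_mean_le (ha : 0 ≤ a) (hb : 0 < b) (hc : 0 < c) (hs : a + b + c = 1) :
    walkRate a b c (b - c) ≤ ((0 : ℝ) : EReal) :=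
  walkRate_le_coe.2 fun α => by linarith [mul_mean_le_log_walkMGF ha hb hc hs α]

theorem walkRate_eq_top (ha : 0 ≤ a) (hb : 0 < b) (hc : 0 < c) (hs : a + b + c = 1) {x : ℝ}
    (hx : 1 < |x|) : walkRate a b c x = ⊤ := by
  rw [EReal.eq_top_iff_forall_lt]
  intro r
  have hx' : 0 < |x| - 1 := by linarith
  obtain ⟨s, hs0, hs1⟩ : ∃ s : ℝ, 0 ≤ s ∧ r < s * (|x| - 1) := by
    refine ⟨(|r| + 1) / (|x| - 1), by positivity, ?_⟩
    rw [div_mul_cancel₀ _ hx'.ne']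
    linarith [le_abs_self r]
  have key : ∀ α, |α| = s → α * x = s * |x| → (r : EReal) < walkRate a b c x := fun α h1 h2 => by
    refine lt_of_lt_of_le (EReal.coe_lt_coe_iff.2 ?_) (le_walkRate x α)
    have := log_walkMGF_le_abs ha hb hc hs α
    rw [h1] at this
    rw [h2]
    linarith
  rcases abs_cases x with ⟨h, -⟩ | ⟨h, -⟩
  · exact key s (abs_of_nonneg hs0) (by rw [h])
  · exact key (-s) (by rw [abs_neg, abs_of_nonneg hs0]) (by rw [h]; ring)

theorem walkRate_le_of_abs_le (ha : 0 ≤ a) (hb : 0 < b) (hc : 0 < c) {x : ℝ} (hx : |x| ≤ 1) :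
    walkRate a b c x ≤ ((-Real.log (min b c) : ℝ) : EReal) := by
  refine walkRate_le_coe.2 fun α => ?_
  have h1 := abs_add_log_min_le ha hb hc α
  have h2 : α * x ≤ |α| * |x| := by rw [← abs_mul]; exact le_abs_self _
  have h3 : |α| * |x| ≤ |α| := mul_le_of_le_one_right (abs_nonneg _) hx
  linarith

/-- A supremum of affine functions is convex. Stating convexity through real upper bounds avoids
sums of infinite values. -/
theorem walkRate_combo_le {x y r s t : ℝ} (hx : walkRate a b c x ≤ (r : EReal))
    (hy : walkRate a b c y ≤ (s : EReal)) (ht0 : 0 ≤ t) (ht1 : t ≤ 1) :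
    walkRate a b c ((1 - t) * x + t * y) ≤ (((1 - t) * r + t * s : ℝ) : EReal) := by
  rw [walkRate_le_coe] at *
  intro α
  have h1 := mul_le_mul_of_nonneg_left (hx α) (sub_nonneg.2 ht1)
  have h2 := mul_le_mul_of_nonneg_left (hy α) ht0
  linarith

theorem exists_coe_walkRate (hs : a + b + c = 1) {x : ℝ} (h : walkRate a b c x ≠ ⊤) :
    ∃ r : ℝ, walkRate a b c x = (r : EReal) := by
  have h' : walkRate a b c x ≠ ⊥ := fun hb => by
    have := walkRate_nonneg hs x
    rw [hb] at this
    exact absurd this (by simp)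
  exact ⟨_, (EReal.coe_toReal h h').symm⟩

/-- From a point of the closure with finite rate, move slightly towards an interior point in `(-1,
1)`. The segment enters the interior at once, and convexity with finiteness at the target makes the
increase arbitrarily small. -/
theorem iInf_interior_le_iInf_closure (ha : 0 ≤ a) (hb : 0 < b) (hc : 0 < c) (hs : a + b + c = 1)
    {J : Set ℝ} (hJ : J.OrdConnected) (hne : (interior J ∩ Set.Ioo (-1) 1).Nonempty) :
    ⨅ x ∈ interior J, walkRate a b c x ≤ ⨅ x ∈ closure J, walkRate a b c x := by
  obtain ⟨y, hy, hy'⟩ := hne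
  refine le_iInf₂ fun x hx => ?_
  by_cases htop : walkRate a b c x = ⊤
  · rw [htop]; exact le_top
  obtain ⟨r, hr⟩ := exists_coe_walkRate hs htop
  rw [hr]
  have hys := walkRate_le_of_abs_le ha hb hc (abs_le.2 ⟨hy'.1.le, hy'.2.le⟩)
  set s := -Real.log (min b c)
  refine EReal.le_of_forall_lt_iff_le.1 fun z hz => ?_
  rw [EReal.coe_lt_coe_iff] at hz
  obtain ⟨t, ht, ht'⟩ : ∃ t : ℝ, t ∈ Set.Ioo (0 : ℝ) 1 ∧ (1 - t) * r + t * s < z := by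
    have h1 : Tendsto (fun t : ℝ => (1 - t) * r + t * s) (𝓝[>] 0) (𝓝 r) := by
      have : Tendsto (fun t : ℝ => (1 - t) * r + t * s) (𝓝 0) (𝓝 ((1 - 0) * r + 0 * s)) :=
        Continuous.tendsto (by fun_prop) 0
      simp only [sub_zero, one_mul, zero_mul, add_zero] at this
      exact this.mono_left nhdsWithin_le_nhds
    exact (Filter.Eventually.and (Ioo_mem_nhdsGT zero_lt_one)
      (h1.eventually (gt_mem_nhds hz))).exists
  have hmem : (1 - t) * x + t * y ∈ interior J :=
    hJ.convex.combo_closure_interior_mem_interior (𝕜 := ℝ) hx hy (by linarith [ht.2]) ht.1 (by ring)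
  refine (iInf₂_le _ hmem).trans ((walkRate_combo_le hr.le hys ht.1.le ht.2.le).trans ?_)
  exact EReal.coe_le_coe_iff.2 ht'.le

end Rate

/-! ## Large deviations: the bounds -/

theorem logProb_le {μ : Measure ℝ} {J : Set ℝ} {n : ℕ} (hn : 0 < n) {r : ℝ}
    (h : μ ((n : ℝ) • J) ≤ ENNReal.ofReal (Real.exp (n * r))) : logProb μ J n ≤ (r : EReal) := by
  have hn' : (0 : ℝ) < n := by exact_mod_cast hn
  have h1 : ENNReal.log (μ ((n : ℝ) • J)) ≤ ((n * r : ℝ) : EReal) := by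
    have := ENNReal.log_le_log h
    rwa [ENNReal.log_ofReal_of_pos (Real.exp_pos _), Real.log_exp] at this
  have h2 : logProb μ J n ≤ (((n : ℝ)⁻¹ : ℝ) : EReal) * ((n * r : ℝ) : EReal) := by
    unfold logProb
    have : (0 : EReal) ≤ (((n : ℝ)⁻¹ : ℝ) : EReal) := EReal.coe_nonneg.2 (by positivity)
    gcongr
  refine h2.trans (le_of_eq ?_)
  rw [← EReal.coe_mul, inv_mul_cancel_left₀ hn'.ne']

theorem le_logProb {μ : Measure ℝ} {J : Set ℝ} {n : ℕ} (hn : 0 < n) {r : ℝ}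
    (h : ENNReal.ofReal (Real.exp (n * r)) ≤ μ ((n : ℝ) • J)) : (r : EReal) ≤ logProb μ J n := by
  have hn' : (0 : ℝ) < n := by exact_mod_cast hn
  have h1 : ((n * r : ℝ) : EReal) ≤ ENNReal.log (μ ((n : ℝ) • J)) := by
    have := ENNReal.log_le_log h
    rwa [ENNReal.log_ofReal_of_pos (Real.exp_pos _), Real.log_exp] at this
  have h2 : (((n : ℝ)⁻¹ : ℝ) : EReal) * ((n * r : ℝ) : EReal) ≤ logProb μ J n := by
    unfold logProb
    have : (0 : EReal) ≤ (((n : ℝ)⁻¹ : ℝ) : EReal) := EReal.coe_nonneg.2 (by positivity)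
    gcongr
  refine (le_of_eq ?_).trans h2
  rw [← EReal.coe_mul, inv_mul_cancel_left₀ hn'.ne']

section Tilt

variable {a b c : ℝ}

/-- The exponential weight `exp (α x)`. -/
def expWeight (α x : ℝ) : ℝ≥0∞ := ENNReal.ofReal (Real.exp (α * x))

theorem measurable_expWeight (α : ℝ) : Measurable (expWeight α) :=
  Measurable.ennreal_ofReal (by fun_prop)

theorem expWeight_add (α x r : ℝ) :
    expWeight α (x + r) = ENNReal.ofReal (Real.exp (α * r)) * expWeight α x := by
  rw [expWeight, expWeight, ← ENNReal.ofReal_mul (Real.exp_pos _).le, ← Real.exp_add, mul_add,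
    add_comm]

/-- The exponential weight is multiplicative over steps, so reweighting a step of the walk equals a
step of the tilted walk from the reweighted law, up to the normalisation `walkMGF`. -/
theorem withDensity_walkMeasure (ha : 0 ≤ a) (hb : 0 < b) (hc : 0 < c) (α : ℝ) (ν : Measure ℝ) :
    (walkMeasure a b c ν).withDensity (expWeight α) = ENNReal.ofReal (walkMGF a b c α) •
      walkMeasure (a / walkMGF a b c α) (b * Real.exp α / walkMGF a b c α)
        (c * Real.exp (-α) / walkMGF a b c α) (ν.withDensity (expWeight α)) := by
  have hM := walkMGF_pos ha hb hc α
  have hmul : ∀ r, ENNReal.ofReal (walkMGF a b c α) * ENNReal.ofReal (r / walkMGF a b c α) =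
      ENNReal.ofReal r := fun r => by
    rw [← ENNReal.ofReal_mul hM.le, mul_div_cancel₀ _ hM.ne']
  have hE := measurable_expWeight α
  refine Measure.ext_of_lintegral _ fun f hf => ?_
  rw [lintegral_smul_measure, lintegral_walkMeasure _ _ _ _ hf,
    lintegral_withDensity_eq_lintegral_mul _ hE hf, lintegral_walkMeasure _ _ _ _ (hE.mul hf),
    lintegral_withDensity_eq_lintegral_mul _ hE hf,
    lintegral_withDensity_eq_lintegral_mul _ hE (g := fun x => f (x + 1))
      (hf.comp (measurable_add_const 1)),
    lintegral_withDensity_eq_lintegral_mul _ hE (g := fun x => f (x + (-1)))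
      (hf.comp (measurable_add_const (-1)))]
  simp only [Pi.mul_apply, expWeight_add, mul_assoc, smul_eq_mul, mul_add]
  rw [lintegral_const_mul (f := fun x => expWeight α x * f (x + 1)) _
      (hE.mul (hf.comp (measurable_add_const 1))),
    lintegral_const_mul (f := fun x => expWeight α x * f (x + -1)) _
      (hE.mul (hf.comp (measurable_add_const (-1))))]
  simp only [← mul_assoc, hmul, ENNReal.ofReal_mul hb.le, ENNReal.ofReal_mul hc.le, mul_one,
    mul_neg_one]

theorem withDensity_iterate_walkMeasure (ha : 0 ≤ a) (hb : 0 < b) (hc : 0 < c) (α : ℝ)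
    (ν : Measure ℝ) (n : ℕ) :
    ((walkMeasure a b c)^[n] ν).withDensity (expWeight α) = ENNReal.ofReal (walkMGF a b c α) ^ n •
      (walkMeasure (a / walkMGF a b c α) (b * Real.exp α / walkMGF a b c α)
        (c * Real.exp (-α) / walkMGF a b c α))^[n] (ν.withDensity (expWeight α)) := by
  induction n with
  | zero => simp
  | succ n ih =>
    rw [Function.iterate_succ_apply', withDensity_walkMeasure ha hb hc, ih, walkMeasure_smul,
      smul_smul, pow_succ', Function.iterate_succ_apply']

theorem tilt_sum (ha : 0 ≤ a) (hb : 0 < b) (hc : 0 < c) (α : ℝ) :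
    a / walkMGF a b c α + b * Real.exp α / walkMGF a b c α +
      c * Real.exp (-α) / walkMGF a b c α = 1 := by
  rw [← add_div, ← add_div]
  exact div_self (walkMGF_pos ha hb hc α).ne'

/-- Total masses in the tilting identity; in extended nonnegative reals no integrability is needed.
-/
theorem lintegral_expWeight_iterate (ha : 0 ≤ a) (hb : 0 < b) (hc : 0 < c) (α : ℝ)
    (ν : Measure ℝ) (n : ℕ) :
    ∫⁻ x, expWeight α x ∂((walkMeasure a b c)^[n] ν) =
      ENNReal.ofReal (walkMGF a b c α) ^ n * ∫⁻ x, expWeight α x ∂ν := by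
  have hM := (walkMGF_pos ha hb hc α).le
  have h := congrArg (fun μ => μ Set.univ) (withDensity_iterate_walkMeasure ha hb hc α ν n)
  have key := iterate_walkMeasure_univ (div_nonneg ha hM)
    (div_nonneg (mul_nonneg hb.le (Real.exp_pos α).le) hM)
    (div_nonneg (mul_nonneg hc.le (Real.exp_pos (-α)).le) hM) (tilt_sum ha hb hc α)
    (ν.withDensity (expWeight α)) n
  simpa only [Measure.smul_apply, key, withDensity_apply _ MeasurableSet.univ,
    Measure.restrict_univ, smul_eq_mul] using h

/-- Chernoff's bound: `x` minimises the tilt on `J`, and Markov's inequality is applied to the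
exponential weight. The initial bound `B` is independent of `n`, so the strict gap in `r` absorbs
it. -/
theorem eventually_logProb_le (ha : 0 ≤ a) (hb : 0 < b) (hc : 0 < c) {ν : ℕ → Measure ℝ} {α B : ℝ}
    (hB : ∀ n, ∫⁻ x, expWeight α x ∂(ν n) ≤ ENNReal.ofReal B) {J : Set ℝ} {x : ℝ}
    (hx : ∀ y ∈ J, α * x ≤ α * y) {r : ℝ} (hr : -(α * x - Real.log (walkMGF a b c α)) < r) :
    ∀ᶠ n : ℕ in atTop, logProb ((walkMeasure a b c)^[n] (ν n)) J n ≤ (r : EReal) := by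
  set L := Real.log (walkMGF a b c α) with hL
  have hM := walkMGF_pos ha hb hc α
  have hlim : Tendsto (fun n : ℕ => (n : ℝ) * (r + (α * x - L))) atTop atTop :=
    tendsto_natCast_atTop_atTop.atTop_mul_const (by linarith)
  filter_upwards [eventually_gt_atTop 0, hlim.eventually_ge_atTop (Real.log (max B 1))] with n hn hn2
  refine logProb_le hn ?_
  have hBp : 0 < max B 1 := lt_max_of_lt_right one_pos
  have hsub : ((n : ℝ) • J) ⊆ {y | expWeight α (n * x) ≤ expWeight α y} := by
    rintro _ ⟨y, hy, rfl⟩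
    refine ENNReal.ofReal_le_ofReal (Real.exp_le_exp.2 ?_)
    have := mul_le_mul_of_nonneg_left (hx y hy) (Nat.cast_nonneg (α := ℝ) n)
    simp only [smul_eq_mul]
    linarith
  have hmarkov := mul_meas_ge_le_lintegral (μ := (walkMeasure a b c)^[n] (ν n))
    (measurable_expWeight α) (expWeight α (n * x))
  rw [lintegral_expWeight_iterate ha hb hc] at hmarkov
  have h1 : expWeight α (n * x) * ((walkMeasure a b c)^[n] (ν n)) ((n : ℝ) • J) ≤
      ENNReal.ofReal (Real.exp (n * L) * max B 1) := by
    refine (mul_le_mul_right (measure_mono hsub) _).trans (hmarkov.trans ?_)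
    rw [ENNReal.ofReal_mul (Real.exp_pos _).le, Real.exp_nat_mul, ENNReal.ofReal_pow (Real.exp_pos _).le, hL,
      Real.exp_log hM]
    exact mul_le_mul_right ((hB n).trans (ENNReal.ofReal_le_ofReal (le_max_left _ _))) _
  have h2 : ENNReal.ofReal (Real.exp (n * L) * max B 1) ≤
      expWeight α (n * x) * ENNReal.ofReal (Real.exp (n * r)) := by
    rw [expWeight, ← ENNReal.ofReal_mul (Real.exp_pos _).le, ← Real.exp_add]
    refine ENNReal.ofReal_le_ofReal ?_
    rw [← Real.exp_log hBp, ← Real.exp_add]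
    refine Real.exp_le_exp.2 ?_
    linarith
  refine (ENNReal.mul_le_mul_iff_right ?_ ?_).1 (h1.trans h2)
  · exact (ENNReal.ofReal_pos.2 (Real.exp_pos _)).ne'
  · exact ENNReal.ofReal_ne_top

/-- A weak law of large numbers for the walk started in `[-K, K]`, with an explicit error. -/
theorem half_le_iterate_walkMeasure (ha : 0 ≤ a) (hb : 0 ≤ b) (hc : 0 ≤ c) (hs : a + b + c = 1)
    {ν : Measure ℝ} [IsFiniteMeasure ν] {K : ℝ} (hK : ∀ᵐ y ∂ν, y ∈ Set.Icc (-K) K) {δ : ℝ}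
    (hδ : 0 < δ) {n : ℕ} (hn : 0 < n) (hn2 : 2 * (K ^ 2 + n) ≤ (n * δ) ^ 2) :
    ν.real Set.univ / 2 ≤ ((walkMeasure a b c)^[n] ν).real
      (Set.Ioo (n * (b - c - δ)) (n * (b - c + δ))) := by
  have hn' : (0 : ℝ) < n := by exact_mod_cast hn
  have hK' : ∀ᵐ y ∂ν, |y| ≤ K := hK.mono fun y hy => abs_le.2 hy
  have i1 : Integrable (fun x => x) ν := Integrable.of_bound (by fun_prop) K hK'
  have hsq : ∀ᵐ y ∂ν, y ^ 2 ≤ K ^ 2 := hK'.mono fun y hy => by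
    rw [← sq_abs]; exact pow_le_pow_left₀ (abs_nonneg _) hy 2
  have i2 : Integrable (fun x => x ^ 2) ν := Integrable.of_bound (by fun_prop) (K ^ 2)
    (hsq.mono fun y hy => by rwa [Real.norm_of_nonneg (sq_nonneg y)])
  obtain ⟨j1, j2, -, e⟩ := moments_iterate_walkMeasure ha hb hc hs ν i1 i2 n
  have hfin := isFiniteMeasure_walk ha hb hc hs ν n
  have hmass : ((walkMeasure a b c)^[n] ν).real Set.univ = ν.real Set.univ := by
    rw [measureReal_def, measureReal_def, iterate_walkMeasure_univ ha hb hc hs]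
  set μ := (walkMeasure a b c)^[n] ν
  set M := ν.real Set.univ with hM
  have hM0 : 0 ≤ M := measureReal_nonneg
  have hQ : ∫ x, x ^ 2 ∂ν ≤ K ^ 2 * M := by
    have := integral_mono_ae i2 (integrable_const (K ^ 2)) hsq
    rwa [integral_const, smul_eq_mul, mul_comm] at this
  have hch := mul_meas_ge_le_integral_of_nonneg (μ := μ)
    (f := fun x => (x - n * (b - c)) ^ 2) (Eventually.of_forall fun x => sq_nonneg _)
    (integrable_sub_sq j1 j2 _) ((n * δ) ^ 2)
  rw [e] at hch
  -- A step has variance at most one, so the centred second moment is at most `(K ^ 2 + n) * M`;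
  -- `hn2` makes Chebyshev's bound at most `M / 2`.
  have hv : b + c - (b - c) ^ 2 ≤ 1 := by nlinarith [sq_nonneg (b - c)]
  have hcompl : (Set.Ioo (n * (b - c - δ)) (n * (b - c + δ)))ᶜ ⊆
      {x | (n * δ) ^ 2 ≤ (x - n * (b - c)) ^ 2} := by
    intro y hy
    rw [Set.mem_compl_iff, Set.mem_Ioo, not_and_or, not_lt, not_lt] at hy
    have hnd : 0 < n * δ := mul_pos hn' hδ
    change (n * δ) ^ 2 ≤ (y - n * (b - c)) ^ 2
    rw [sq_le_sq, abs_of_pos hnd]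
    rcases hy with hy | hy
    · rw [le_abs]; right; linarith
    · rw [le_abs]; left; linarith
  have h1 : μ.real (Set.Ioo (n * (b - c - δ)) (n * (b - c + δ)))ᶜ ≤ M / 2 := by
    refine (measureReal_mono hcompl).trans ?_
    have hpos : 0 < (n * δ) ^ 2 := by positivity
    refine le_of_mul_le_mul_left (hch.trans ?_) hpos
    have h3 : n * (b + c - (b - c) ^ 2) * M ≤ n * M := by
      rw [mul_assoc]
      exact mul_le_mul_of_nonneg_left (mul_le_of_le_one_left hM0 hv) hn'.le
    have h4 := mul_le_mul_of_nonneg_right hn2 hM0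
    linarith
  rw [measureReal_compl measurableSet_Ioo, hmass] at h1
  linarith

/-- Cramér's lower bound: tilting moves the mean step to `x`, where the weak law leaves a fixed
fraction of the mass near `n * x`; removing the tilt costs at most `exp (n (α x + |α| δ))`. -/
theorem eventually_le_logProb (ha : 0 ≤ a) (hb : 0 < b) (hc : 0 < c) {ν : ℕ → Measure ℝ}
    [∀ n, IsProbabilityMeasure (ν n)] {K : ℝ}
    (hK : ∀ n, ENNReal.ofReal (1 / 2) ≤ ν n (Set.Icc (-K) K)) {J : Set ℝ} {x α : ℝ}
    (hx : b * Real.exp α / walkMGF a b c α - c * Real.exp (-α) / walkMGF a b c α = x)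
    (hJ : x ∈ interior J) {r : ℝ} (hr : r < -(α * x - Real.log (walkMGF a b c α))) :
    ∀ᶠ n : ℕ in atTop, (r : EReal) ≤ logProb ((walkMeasure a b c)^[n] (ν n)) J n := by
  set L := Real.log (walkMGF a b c α) with hL
  have hM := walkMGF_pos ha hb hc α
  obtain ⟨δ₁, hδ₁, hball⟩ := Metric.isOpen_iff.1 isOpen_interior x hJ
  obtain ⟨δ, hδ, hδle, hδα⟩ : ∃ δ : ℝ, 0 < δ ∧ δ ≤ δ₁ ∧ |α| * δ < L - α * x - r := by
    have hgap : 0 < L - α * x - r := by linarith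
    -- The denominator `|α| + 1` keeps the loss `|α| * δ` strictly below the gap and also covers `α
    -- = 0`.
    refine ⟨min δ₁ ((L - α * x - r) / (|α| + 1)), lt_min hδ₁ (by positivity), min_le_left _ _, ?_⟩
    calc |α| * min δ₁ ((L - α * x - r) / (|α| + 1))
        ≤ |α| * ((L - α * x - r) / (|α| + 1)) := by gcongr; exact min_le_right _ _
      _ = (L - α * x - r) * (|α| / (|α| + 1)) := by ring
      _ < (L - α * x - r) * 1 := by
        gcongr
        rw [div_lt_one (by positivity)]; linarith
      _ = _ := mul_one _
  have hsubJ : Set.Ioo (x - δ) (x + δ) ⊆ J := fun y hy => interior_subset (hball (by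
    rw [Metric.mem_ball, Real.dist_eq, abs_lt]; constructor <;> linarith [hy.1, hy.2]))
  have hlim1 : Tendsto (fun n : ℕ => (n : ℝ) * (L - α * x - |α| * δ - r)) atTop atTop :=
    tendsto_natCast_atTop_atTop.atTop_mul_const (by linarith)
  have hlim2 : Tendsto (fun n : ℕ => (n : ℝ) * (n * δ ^ 2 - 2)) atTop atTop :=
    tendsto_natCast_atTop_atTop.atTop_mul_atTop₀ (tendsto_atTop_add_const_right _ _
      (tendsto_natCast_atTop_atTop.atTop_mul_const (by positivity)))
  -- The `4` collects two halves, the mass kept by restriction to `[-K, K]` and that kept by the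
  -- weak law; `|α| * K` bounds the tilt on this interval.
  filter_upwards [eventually_gt_atTop 0, hlim1.eventually_ge_atTop (|α| * K + Real.log 4),
    hlim2.eventually_ge_atTop (2 * K ^ 2)] with n hn hn1 hn2
  have hn' : (0 : ℝ) < n := by exact_mod_cast hn
  refine le_logProb hn ?_
  set U : Set ℝ := Set.Ioo (n * (x - δ)) (n * (x + δ)) with hU
  have hUJ : U ⊆ (n : ℝ) • J := by
    intro y hy
    refine ⟨y / n, hsubJ ⟨?_, ?_⟩, ?_⟩
    · rw [lt_div_iff₀ hn']; linarith [hy.1]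
    · rw [div_lt_iff₀ hn']; linarith [hy.2]
    · simp only [smul_eq_mul]; field_simp
  -- Restriction only lowers the probability to be bounded below, while making the tilted measure
  -- finite and compactly supported.
  set ν₁ := (ν n).restrict (Set.Icc (-K) K) with hν₁
  set ν' := ν₁.withDensity (expWeight α) with hν'
  have hsupp : ∀ᵐ y ∂ν₁, y ∈ Set.Icc (-K) K := ae_restrict_mem measurableSet_Icc
  have hbd : ∀ y ∈ Set.Icc (-K) K, -(|α| * K) ≤ α * y ∧ α * y ≤ |α| * K := fun y hy => by
    rw [← abs_le, abs_mul]
    exact mul_le_mul_of_nonneg_left (abs_le.2 hy) (abs_nonneg _)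
  have hν'univ : ν' Set.univ = ∫⁻ y, expWeight α y ∂ν₁ := by
    rw [hν', withDensity_apply _ MeasurableSet.univ, Measure.restrict_univ]
  have hlow : ENNReal.ofReal (Real.exp (-(|α| * K)) / 2) ≤ ν' Set.univ := by
    rw [hν'univ]
    calc ENNReal.ofReal (Real.exp (-(|α| * K)) / 2)
        = ENNReal.ofReal (Real.exp (-(|α| * K))) * ENNReal.ofReal (1 / 2) := by
          rw [← ENNReal.ofReal_mul (Real.exp_pos _).le]; congr 1; ring
      _ ≤ ENNReal.ofReal (Real.exp (-(|α| * K))) * ν₁ Set.univ := by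
          rw [hν₁, Measure.restrict_apply_univ]
          exact mul_le_mul_right (hK n) _
      _ = ∫⁻ y, ENNReal.ofReal (Real.exp (-(|α| * K))) ∂ν₁ := (lintegral_const _).symm
      _ ≤ _ := lintegral_mono_ae (hsupp.mono fun y hy =>
          ENNReal.ofReal_le_ofReal (Real.exp_le_exp.2 (hbd y hy).1))
  have hfin : IsFiniteMeasure ν' := ⟨by
    rw [hν'univ]
    refine lt_of_le_of_lt (lintegral_mono_ae (g := fun _ => ENNReal.ofReal (Real.exp (|α| * K)))
      (hsupp.mono fun y hy => ENNReal.ofReal_le_ofReal (Real.exp_le_exp.2 (hbd y hy).2))) ?_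
    rw [lintegral_const]
    exact ENNReal.mul_lt_top ENNReal.ofReal_lt_top (measure_lt_top _ _)⟩
  have hsupp' : ∀ᵐ y ∂ν', y ∈ Set.Icc (-K) K := (withDensity_absolutelyContinuous _ _).ae_le hsupp
  have hlln := half_le_iterate_walkMeasure (div_nonneg ha hM.le)
    (div_nonneg (mul_nonneg hb.le (Real.exp_pos α).le) hM.le)
    (div_nonneg (mul_nonneg hc.le (Real.exp_pos (-α)).le) hM.le) (tilt_sum ha hb hc α)
    (ν := ν') hsupp' hδ hn (by linarith [mul_pow (n : ℝ) δ 2])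
  rw [hx, ← hU] at hlln
  set μ' := (walkMeasure (a / walkMGF a b c α) (b * Real.exp α / walkMGF a b c α)
        (c * Real.exp (-α) / walkMGF a b c α))^[n] ν' with hμ'
  have hμ'U : ENNReal.ofReal (Real.exp (-(|α| * K)) / 4) ≤ μ' U := by
    refine ENNReal.ofReal_le_of_le_toReal (le_trans ?_ hlln)
    have := (ENNReal.ofReal_le_iff_le_toReal (measure_ne_top _ _)).1 hlow
    rw [measureReal_def]
    linarith
  have htilt := congrArg (fun μ => μ U) (withDensity_iterate_walkMeasure ha hb hc α ν₁ n)
  rw [Measure.smul_apply, smul_eq_mul, withDensity_apply _ measurableSet_Ioo] at htilt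
  have hup : ∫⁻ y in U, expWeight α y ∂((walkMeasure a b c)^[n] ν₁) ≤
      ENNReal.ofReal (Real.exp (n * (α * x + |α| * δ))) * (walkMeasure a b c)^[n] ν₁ U := by
    rw [← setLIntegral_const]
    refine setLIntegral_mono measurable_const fun y hy => ?_
    refine ENNReal.ofReal_le_ofReal (Real.exp_le_exp.2 ?_)
    have h1 : |y - n * x| ≤ n * δ := abs_le.2 ⟨by linarith [hy.1], by linarith [hy.2]⟩
    have h2 : α * (y - n * x) ≤ |α| * (n * δ) := by
      refine (le_abs_self _).trans ?_
      rw [abs_mul]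
      gcongr
    linarith
  rw [htilt] at hup
  have hmono : (walkMeasure a b c)^[n] ν₁ U ≤ (walkMeasure a b c)^[n] (ν n) ((n : ℝ) • J) :=
    (iterate_walkMeasure_mono a b c Measure.restrict_le_self n U).trans (measure_mono hUJ)
  have hchain : ENNReal.ofReal (walkMGF a b c α) ^ n * ENNReal.ofReal (Real.exp (-(|α| * K)) / 4) ≤
      ENNReal.ofReal (Real.exp (n * (α * x + |α| * δ))) *
        (walkMeasure a b c)^[n] (ν n) ((n : ℝ) • J) :=
    (mul_le_mul_right hμ'U _).trans (hup.trans (mul_le_mul_right hmono _))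
  refine (ENNReal.mul_le_mul_iff_right
    (a := ENNReal.ofReal (Real.exp (n * (α * x + |α| * δ)))) ?_ ?_).1 (le_trans ?_ hchain)
  · exact (ENNReal.ofReal_pos.2 (Real.exp_pos _)).ne'
  · exact ENNReal.ofReal_ne_top
  · rw [← ENNReal.ofReal_mul (Real.exp_pos _).le, ← Real.exp_add, ← ENNReal.ofReal_pow hM.le,
      ← ENNReal.ofReal_mul (pow_nonneg hM.le n)]
    refine ENNReal.ofReal_le_ofReal ?_
    rw [← Real.exp_log hM, ← hL, ← Real.exp_nat_mul,
      show Real.exp (-(|α| * K)) / 4 = Real.exp (-(|α| * K) - Real.log 4) by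
        rw [Real.exp_sub, Real.exp_log (by norm_num)], ← Real.exp_add]
    refine Real.exp_le_exp.2 ?_
    linarith

end Tilt

/-! ## Large deviations: the principle -/

section Principle

variable {a b c : ℝ} {ν : ℕ → Measure ℝ} {J : Set ℝ}

/-- A tilt exists only for speeds strictly inside `(-1, 1)`. The remaining finite-rate points `±1`
are moved slightly towards the mean `b - c`, where the rate is at most `0`; by convexity this does
not increase the rate, so no limit in `t` is required. -/
theorem neg_walkRate_le_liminf (ha : 0 ≤ a) (hb : 0 < b) (hc : 0 < c) (hs : a + b + c = 1)
    [∀ n, IsProbabilityMeasure (ν n)] {K : ℝ}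
    (hK : ∀ n, ENNReal.ofReal (1 / 2) ≤ ν n (Set.Icc (-K) K)) {x : ℝ} (hx : x ∈ interior J) :
    -walkRate a b c x ≤
      liminf (fun n : ℕ => logProb ((walkMeasure a b c)^[n] (ν n)) J n) atTop := by
  have inner : ∀ y ∈ interior J, y ∈ Set.Ioo (-1 : ℝ) 1 → -walkRate a b c y ≤
      liminf (fun n : ℕ => logProb ((walkMeasure a b c)^[n] (ν n)) J n) atTop := by
    intro y hyJ hy
    obtain ⟨α, hα⟩ := exists_tilt ha hb hc hy
    refine EReal.ge_of_forall_gt_iff_ge.1 fun r hr => ?_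
    have h1 := hr.trans_le (EReal.neg_le_neg_iff.2 (le_walkRate y α))
    rw [← EReal.coe_neg, EReal.coe_lt_coe_iff] at h1
    exact le_liminf_of_le (by isBoundedDefault) (eventually_le_logProb ha hb hc hK hα hyJ h1)
  by_cases htop : walkRate a b c x = ⊤
  · rw [htop, EReal.neg_top]; exact bot_le
  have hx1 : |x| ≤ 1 := not_lt.1 fun h => htop (walkRate_eq_top ha hb hc hs h)
  obtain ⟨r, hr⟩ := exists_coe_walkRate hs htop
  have hr0 : 0 ≤ r := by
    have := walkRate_nonneg hs x
    rw [hr] at this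
    exact EReal.coe_nonneg.1 this
  obtain ⟨t, ht, htJ⟩ : ∃ t : ℝ, t ∈ Set.Ioo (0 : ℝ) 1 ∧ (1 - t) * x + t * (b - c) ∈ interior J := by
    have h1 : Tendsto (fun t : ℝ => (1 - t) * x + t * (b - c)) (𝓝[>] 0) (𝓝 x) := by
      have : Tendsto (fun t : ℝ => (1 - t) * x + t * (b - c)) (𝓝 0)
          (𝓝 ((1 - 0) * x + 0 * (b - c))) := Continuous.tendsto (by fun_prop) 0
      simp only [sub_zero, one_mul, zero_mul, add_zero] at this
      exact this.mono_left nhdsWithin_le_nhds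
    exact (Filter.Eventually.and (Ioo_mem_nhdsGT zero_lt_one)
      (h1.eventually (isOpen_interior.mem_nhds hx))).exists
  have hle := walkRate_combo_le hr.le (walkRate_mean_le ha hb hc hs) ht.1.le ht.2.le
  rw [abs_le] at hx1
  have hm1 : b - c < 1 := by linarith
  have hm2 : -1 < b - c := by linarith
  have hmem : (1 - t) * x + t * (b - c) ∈ Set.Ioo (-1 : ℝ) 1 := by
    have h1 := mul_le_mul_of_nonneg_left hx1.1 (sub_nonneg.2 ht.2.le)
    have h2 := mul_le_mul_of_nonneg_left hx1.2 (sub_nonneg.2 ht.2.le)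
    have h3 := mul_lt_mul_of_pos_left hm1 ht.1
    have h4 := mul_lt_mul_of_pos_left hm2 ht.1
    constructor <;> linarith
  refine le_trans (EReal.neg_le_neg_iff.2 (hle.trans ?_)) (inner _ htJ hmem)
  rw [hr, EReal.coe_le_coe_iff]
  have := mul_nonneg ht.1.le hr0
  linarith

theorem limsup_le_neg_coe (ha : 0 ≤ a) (hb : 0 < b) (hc : 0 < c)
    (hB : ∀ α, ∃ B, ∀ n, ∫⁻ x, expWeight α x ∂(ν n) ≤ ENNReal.ofReal B) {x α : ℝ}
    (hx : ∀ y ∈ J, α * x ≤ α * y) :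
    limsup (fun n : ℕ => logProb ((walkMeasure a b c)^[n] (ν n)) J n) atTop ≤
      ((-(α * x - Real.log (walkMGF a b c α)) : ℝ) : EReal) := by
  obtain ⟨B, hB⟩ := hB α
  refine EReal.le_of_forall_lt_iff_le.1 fun r hr => ?_
  exact limsup_le_of_le (by isBoundedDefault)
    (eventually_logProb_le ha hb hc hB hx (EReal.coe_lt_coe_iff.1 hr))

theorem limsup_le_zero (ha : 0 ≤ a) (hb : 0 < b) (hc : 0 < c) (hs : a + b + c = 1)
    (hB : ∀ α, ∃ B, ∀ n, ∫⁻ x, expWeight α x ∂(ν n) ≤ ENNReal.ofReal B) :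
    limsup (fun n : ℕ => logProb ((walkMeasure a b c)^[n] (ν n)) J n) atTop ≤
      ((0 : ℝ) : EReal) := by
  have h0 : walkMGF a b c 0 = 1 := by simpa [walkMGF] using hs
  have h := limsup_le_neg_coe (J := J) ha hb hc hB (x := 0) (α := 0) fun y _ => by simp
  rwa [h0, Real.log_one, mul_zero, sub_zero, neg_zero] at h

/-- Chernoff's bound is needed only for tilts pointing from the mean towards `x`. For the others
Jensen gives `α x - log (walkMGF a b c α) ≤ 0`, and the trivial bound suffices. -/
theorem limsup_le_neg_walkRate (ha : 0 ≤ a) (hb : 0 < b) (hc : 0 < c) (hs : a + b + c = 1)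
    (hB : ∀ α, ∃ B, ∀ n, ∫⁻ x, expWeight α x ∂(ν n) ≤ ENNReal.ofReal B) {x : ℝ}
    (hx : ∀ α, α * (b - c) ≤ α * x → ∀ y ∈ J, α * x ≤ α * y) :
    limsup (fun n : ℕ => logProb ((walkMeasure a b c)^[n] (ν n)) J n) atTop ≤
      -walkRate a b c x := by
  rw [EReal.le_neg]
  refine iSup_le fun α => ?_
  rw [EReal.le_neg, ← EReal.coe_neg]
  rcases le_total (α * (b - c)) (α * x) with h | h
  · exact limsup_le_neg_coe ha hb hc hB (hx α h)
  · refine (limsup_le_zero ha hb hc hs hB).trans (EReal.coe_le_coe_iff.2 ?_)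
    linarith [mul_mean_le_log_walkMGF ha hb hc hs α]

theorem logProb_eq_bot {μ : Measure ℝ} {n : ℕ} (hn : 0 < n) (h : μ ((n : ℝ) • J) = 0) :
    logProb μ J n = ⊥ :=
  (EReal.eq_bot_iff_forall_lt _).2 fun r => by
    have := logProb_le (r := r - 1) hn (h.le.trans zero_le)
    exact lt_of_le_of_lt this (EReal.coe_lt_coe_iff.2 (by linarith))

theorem limsup_le_neg_iInf (ha : 0 ≤ a) (hb : 0 < b) (hc : 0 < c) (hs : a + b + c = 1)
    (hB : ∀ α, ∃ B, ∀ n, ∫⁻ x, expWeight α x ∂(ν n) ≤ ENNReal.ofReal B) (hJ : J.OrdConnected) :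
    limsup (fun n : ℕ => logProb ((walkMeasure a b c)^[n] (ν n)) J n) atTop ≤
      -⨅ x ∈ closure J, walkRate a b c x := by
  rcases J.eq_empty_or_nonempty with rfl | hne
  · refine limsup_le_of_le (by isBoundedDefault) ?_
    filter_upwards [eventually_gt_atTop 0] with n hn
    rw [logProb_eq_bot hn (by simp)]
    exact bot_le
  by_cases hm : b - c ∈ closure J
  · refine (limsup_le_zero ha hb hc hs hB).trans ?_
    rw [EReal.le_neg, ← EReal.coe_neg, neg_zero]
    exact (iInf₂_le _ hm).trans (walkRate_mean_le ha hb hc hs)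
  -- An interval whose closure misses the mean lies on one side of it, and its endpoint nearest the
  -- mean serves for every tilt in that direction.
  suffices h : ∃ x ∈ closure J, ∀ α, α * (b - c) ≤ α * x → ∀ y ∈ J, α * x ≤ α * y by
    obtain ⟨x, hx, h⟩ := h
    exact (limsup_le_neg_walkRate ha hb hc hs hB h).trans
      (EReal.neg_le_neg_iff.2 (iInf₂_le x hx))
  obtain ⟨y₀, hy₀⟩ := hne
  have hm' : b - c ∉ J := fun h => hm (subset_closure h)
  rcases lt_or_gt_of_ne (fun h : y₀ = b - c => hm' (h ▸ hy₀)) with hlt | hgt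
  · have hub : ∀ y ∈ J, y ≤ b - c := fun y hy => not_lt.1 fun h =>
      hm' (hJ.out hy₀ hy ⟨hlt.le, h.le⟩)
    have hcl := csSup_mem_closure ⟨y₀, hy₀⟩ ⟨b - c, hub⟩
    have hlt' : sSup J < b - c := lt_of_le_of_ne (csSup_le ⟨y₀, hy₀⟩ hub) fun h => hm (h ▸ hcl)
    refine ⟨sSup J, hcl, fun α hα y hy => ?_⟩
    have hα0 : α ≤ 0 := not_lt.1 fun h => absurd (mul_lt_mul_of_pos_left hlt' h) (not_lt.2 hα)
    exact mul_le_mul_of_nonpos_left (le_csSup ⟨b - c, hub⟩ hy) hα0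
  · have hlb : ∀ y ∈ J, b - c ≤ y := fun y hy => not_lt.1 fun h =>
      hm' (hJ.out hy hy₀ ⟨h.le, hgt.le⟩)
    have hcl := csInf_mem_closure ⟨y₀, hy₀⟩ ⟨b - c, hlb⟩
    have hgt' : b - c < sInf J := lt_of_le_of_ne (le_csInf ⟨y₀, hy₀⟩ hlb) fun h => hm (h ▸ hcl)
    refine ⟨sInf J, hcl, fun α hα y hy => ?_⟩
    have hα0 : 0 ≤ α := not_lt.1 fun h => absurd (mul_lt_mul_of_neg_left hgt' h) (not_lt.2 hα)
    exact mul_le_mul_of_nonneg_left (csInf_le ⟨b - c, hlb⟩ hy) hα0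

/-- The large deviation principle for a lattice walk whose initial law depends on the number of
steps. -/
theorem walk_largeDeviations (ha : 0 ≤ a) (hb : 0 < b) (hc : 0 < c) (hs : a + b + c = 1)
    [∀ n, IsProbabilityMeasure (ν n)] {K : ℝ}
    (hK : ∀ n, ENNReal.ofReal (1 / 2) ≤ ν n (Set.Icc (-K) K))
    (hB : ∀ α, ∃ B, ∀ n, ∫⁻ x, expWeight α x ∂(ν n) ≤ ENNReal.ofReal B) (hJ : J.OrdConnected) :
    (-(⨅ x ∈ interior J, walkRate a b c x) ≤
        liminf (fun n : ℕ => logProb ((walkMeasure a b c)^[n] (ν n)) J n) atTop ∧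
      limsup (fun n : ℕ => logProb ((walkMeasure a b c)^[n] (ν n)) J n) atTop ≤
        -(⨅ x ∈ closure J, walkRate a b c x)) ∧
    ((interior J ∩ Set.Ioo (-1) 1).Nonempty ∨ closure J ∩ Set.Icc (-1) 1 = ∅ →
      Tendsto (fun n : ℕ => logProb ((walkMeasure a b c)^[n] (ν n)) J n) atTop
        (𝓝 (-(⨅ x ∈ J, walkRate a b c x)))) := by
  have hlow : -(⨅ x ∈ interior J, walkRate a b c x) ≤
      liminf (fun n : ℕ => logProb ((walkMeasure a b c)^[n] (ν n)) J n) atTop := by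
    rw [EReal.neg_le]
    refine le_iInf₂ fun x hx => ?_
    rw [EReal.neg_le]
    exact neg_walkRate_le_liminf ha hb hc hs hK hx
  have hup := limsup_le_neg_iInf ha hb hc hs hB hJ
  refine ⟨⟨hlow, hup⟩, fun h => ?_⟩
  have h1 : ⨅ x ∈ closure J, walkRate a b c x ≤ ⨅ x ∈ J, walkRate a b c x :=
    biInf_mono fun x hx => subset_closure hx
  have h2 : ⨅ x ∈ J, walkRate a b c x ≤ ⨅ x ∈ interior J, walkRate a b c x :=
    biInf_mono fun x hx => interior_subset hx
  -- This closes the chain of infima: by convexity in the first case, and in the second because the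
  -- rate is infinite throughout the closure.
  have h3 : ⨅ x ∈ interior J, walkRate a b c x ≤ ⨅ x ∈ closure J, walkRate a b c x := by
    rcases h with h | h
    · exact iInf_interior_le_iInf_closure ha hb hc hs hJ h
    · refine le_iInf₂ fun x hx => ?_
      rw [walkRate_eq_top ha hb hc hs]
      · exact le_top
      · exact not_le.1 fun hx1 => Set.notMem_empty x (h ▸ ⟨hx, abs_le.1 hx1⟩)
  exact tendsto_of_le_liminf_of_limsup_le
    ((EReal.neg_le_neg_iff.2 (h3.trans h1)).trans hlow)
    (hup.trans (EReal.neg_le_neg_iff.2 (h2.trans h3)))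

end Principle

/-! ## Growth of the moments -/

section Moments

variable {a b c : ℝ}

theorem integrable_of_lintegral_ofReal_le {ν : Measure ℝ} {W : ℝ → ℝ} (hW : ∀ x, 0 ≤ W x)
    (hm : Measurable W) {G : ℝ} (hG : 0 ≤ G)
    (h : ∫⁻ x, ENNReal.ofReal (W x) ∂ν ≤ ENNReal.ofReal G) :
    Integrable W ν ∧ ∫ x, W x ∂ν ≤ G := by
  have hi : Integrable W ν := by
    rw [← lintegral_ofReal_ne_top_iff_integrable hm.aestronglyMeasurable (ae_of_all _ hW)]
    exact (h.trans_lt ENNReal.ofReal_lt_top).ne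
  refine ⟨hi, ?_⟩
  rw [← ofReal_integral_eq_lintegral_ofReal hi (ae_of_all _ hW)] at h
  exact (ENNReal.ofReal_le_ofReal_iff hG).1 h

/-- The initial moments enter the exact formulas additively and are bounded uniformly in `n`, so
division by `n` removes them. -/
theorem tendsto_moments_walk (ha : 0 ≤ a) (hb : 0 ≤ b) (hc : 0 ≤ c) (hs : a + b + c = 1)
    {ν : ℕ → Measure ℝ} [∀ n, IsProbabilityMeasure (ν n)] {G : ℝ} (hG : 0 ≤ G)
    (h : ∀ n, ∫⁻ x, ENNReal.ofReal ((1 + |x|) ^ 2) ∂(ν n) ≤ ENNReal.ofReal G) :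
    (∀ n, Integrable (fun x => x) ((walkMeasure a b c)^[n] (ν n)) ∧
      Integrable (fun x => x ^ 2) ((walkMeasure a b c)^[n] (ν n))) ∧
    Tendsto (fun n : ℕ => (∫ x, x ∂((walkMeasure a b c)^[n] (ν n))) / n) atTop (𝓝 (b - c)) ∧
    Tendsto (fun n : ℕ => (∫ x, (x - n * (b - c)) ^ 2 ∂((walkMeasure a b c)^[n] (ν n))) / n) atTop
      (𝓝 (b + c - (b - c) ^ 2)) := by
  have hW := fun n => integrable_of_lintegral_ofReal_le (W := fun x => (1 + |x|) ^ 2)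
    (fun x => sq_nonneg _) (by fun_prop) hG (h n)
  have hle1 : ∀ x : ℝ, ‖x‖ ≤ (1 + |x|) ^ 2 := fun x => by
    rw [Real.norm_eq_abs]; nlinarith [abs_nonneg x]
  have hle2 : ∀ x : ℝ, ‖x ^ 2‖ ≤ (1 + |x|) ^ 2 := fun x => by
    rw [Real.norm_eq_abs, abs_pow]; nlinarith [abs_nonneg x]
  have h1 : ∀ n, Integrable (fun x => x) (ν n) := fun n =>
    (hW n).1.mono' measurable_id.aestronglyMeasurable (ae_of_all _ hle1)
  have h2 : ∀ n, Integrable (fun x => x ^ 2) (ν n) := fun n =>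
    (hW n).1.mono' (by fun_prop : Measurable fun x : ℝ => x ^ 2).aestronglyMeasurable
      (ae_of_all _ hle2)
  have b1 : ∀ n, ‖∫ x, x ∂(ν n)‖ ≤ G := fun n =>
    (norm_integral_le_of_norm_le (hW n).1 (ae_of_all _ hle1)).trans (hW n).2
  have b2 : ∀ n, ‖∫ x, x ^ 2 ∂(ν n)‖ ≤ G := fun n =>
    (norm_integral_le_of_norm_le (hW n).1 (ae_of_all _ hle2)).trans (hW n).2
  have hmom := fun n => moments_iterate_walkMeasure ha hb hc hs (ν n) (h1 n) (h2 n) n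
  have lim : ∀ (u : ℕ → ℝ) (k : ℝ), (∀ n, ‖u n‖ ≤ G) →
      Tendsto (fun n : ℕ => (u n + n * k) / n) atTop (𝓝 k) := by
    intro u k hu
    have h0 : Tendsto (fun n : ℕ => u n / n) atTop (𝓝 0) := by
      refine squeeze_zero_norm (a := fun n : ℕ => G / n) (fun n => ?_)
        (tendsto_const_div_atTop_nhds_zero_nat G)
      rw [norm_div, Real.norm_natCast]
      gcongr
      exact hu n
    have h1 : Tendsto (fun n : ℕ => u n / n + k) atTop (𝓝 (0 + k)) := h0.add_const k
    rw [zero_add] at h1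
    refine h1.congr' ?_
    filter_upwards [eventually_gt_atTop 0] with n hn
    have : (n : ℝ) ≠ 0 := by exact_mod_cast hn.ne'
    field_simp
  refine ⟨fun n => ⟨(hmom n).1, (hmom n).2.1⟩, ?_, ?_⟩
  · refine (lim (fun n => ∫ x, x ∂(ν n)) (b - c) b1).congr fun n => ?_
    rw [(hmom n).2.2.1, probReal_univ, mul_one]
  · refine (lim (fun n => ∫ x, x ^ 2 ∂(ν n)) (b + c - (b - c) ^ 2) b2).congr fun n => ?_
    rw [(hmom n).2.2.2, probReal_univ, mul_one]

end Moments

/-! ## The parameters of the walk -/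

section Parameters

variable {E F lam β τ : ℝ}

theorem kickProb_pos (hlam : lam ≠ 0) (hres : ∀ m : ℤ, rabi E F lam * τ ≠ 2 * Real.pi * m) :
    0 < kickProb E F lam τ := by
  have hsin : Real.sin (rabi E F lam * τ / 2) ≠ 0 := fun h => by
    obtain ⟨m, hm⟩ := Real.sin_eq_zero_iff.1 h
    exact hres m (by linarith)
  have := rabi_pos E F hlam
  rw [kickProb_eq]
  positivity

theorem kickProb_le_one (hlam : lam ≠ 0) : kickProb E F lam τ ≤ 1 := by
  rw [kickProb_eq]
  refine mul_le_one₀ ?_ (sq_nonneg _) (Real.sin_sq_le_one _)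
  linarith [rabi_normalization E F hlam, sq_nonneg ((E - F) / rabi E F lam)]

theorem occ_sub_occ' (E β : ℝ) : occ E β - occ' E β = Real.tanh (β * E / 2) := by
  rw [occ, occ', ← sub_div, Real.tanh_eq_sinh_div_cosh, Real.sinh_eq]
  field_simp

theorem occ_pos (E β : ℝ) : 0 < occ E β := by
  have := Real.cosh_pos (β * E / 2)
  unfold occ; positivity

theorem occ'_pos (E β : ℝ) : 0 < occ' E β := by
  have := Real.cosh_pos (β * E / 2)
  unfold occ'; positivity

theorem probUp_add_probDown : probUp E F lam β τ + probDown E F lam β τ = kickProb E F lam τ := by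
  rw [probUp, probDown, ← mul_add, occ_add_occ', mul_one]

theorem probUp_sub_probDown : probUp E F lam β τ - probDown E F lam β τ =
    kickProb E F lam τ * Real.tanh (β * E / 2) := by
  rw [probUp, probDown, ← mul_sub, occ_sub_occ']

theorem drift_mul (hτ : 0 < τ) :
    drift E F lam β τ * τ = probUp E F lam β τ - probDown E F lam β τ := by
  rw [drift, probUp_sub_probDown]
  field_simp

theorem diffusion_mul (hτ : 0 < τ) : 2 * diffusion E F lam β τ * τ =
    probUp E F lam β τ + probDown E F lam β τ -
      (probUp E F lam β τ - probDown E F lam β τ) ^ 2 := by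
  rw [diffusion, probUp_sub_probDown, probUp_add_probDown]
  field_simp

/-- Since `a + b + c = 1`, the variance equals `a(b + c) + 4bc`. -/
theorem variance_pos {a b c : ℝ} (ha : 0 ≤ a) (hb : 0 < b) (hc : 0 < c) (hs : a + b + c = 1) :
    0 < b + c - (b - c) ^ 2 := by
  nlinarith [mul_pos hb hc, mul_nonneg ha hb.le, mul_nonneg ha hc.le]

theorem rate_eq (x : ℝ) : rate E F lam β τ x =
    walkRate (1 - kickProb E F lam τ) (probUp E F lam β τ) (probDown E F lam β τ) x := by
  have h : ∀ α, logMGF E F lam β τ α = Real.log (walkMGF (1 - kickProb E F lam τ)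
      (probUp E F lam β τ) (probDown E F lam β τ) α) := fun α => by
    have hc := Real.cosh_pos (β * E / 2)
    rw [logMGF, walkMGF, probUp, probDown, occ, occ', Real.cosh_eq (β * E / 2 + α), neg_add,
      Real.exp_add, Real.exp_add]
    congr 1
    field_simp
    ring
  simp only [rate, walkRate, h]

end Parameters

/-! ## The initial law of the walk -/

section InitialLaw

variable {F : ℝ} {ρ : HS →L[ℂ] HS}

/-- The distribution of the position at time `t` of the particle without the atoms. -/
def freeDiag (F : ℝ) (ρ : HS →L[ℂ] HS) (t : ℝ) : ℤ → ℝ := diag (stark F t * ρ * star (stark F t))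

theorem freeDiag_nonneg (hρ : ρ.IsPositive) (t : ℝ) (x : ℤ) : 0 ≤ freeDiag F ρ t x := by
  obtain ⟨R, hR, rfl⟩ := exists_sqrt hρ
  rw [freeDiag, diag_conj_sq hR]
  positivity

theorem hasSum_freeDiag (hρ : IsDensityMatrix ρ) (t : ℝ) : HasSum (freeDiag F ρ t) 1 :=
  hasSum_diag_conj hρ (stark_mem_unitary F t)

theorem lawAt_eq {E lam β τ : ℝ} (hF : F ≠ 0) (hlam : lam ≠ 0)
    (hres : ∀ m : ℤ, rabi E F lam * τ ≠ 2 * Real.pi * m) (hρ : ρ.IsPositive) (n : ℕ) :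
    lawAt E F lam β τ ρ n = (walkMeasure (1 - kickProb E F lam τ) (probUp E F lam β τ)
      (probDown E F lam β τ))^[n] (latticeLaw (freeDiag F ρ (n * τ))) := by
  have hp := kickProb_pos hlam hres
  rw [lawAt, iterate_reducedMap E hF hlam, positionLaw_eq, diag_iterate_randomShift]
  exact (latticeLaw_iterate_walkStep (sub_nonneg.2 (kickProb_le_one hlam))
    (mul_pos hp (occ_pos E β)).le (mul_pos hp (occ'_pos E β)).le (freeDiag_nonneg hρ _) n).2

theorem exists_summable_freeDiag_le (hF : 0 < F) (hρ : IsDensityMatrix ρ) :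
    ∃ g : ℤ → ℝ, Summable g ∧ ∀ t x, freeDiag F ρ t x ≤ g x := by
  obtain ⟨g, hg, h⟩ := exists_summable_bound hF hρ.1 (w := fun _ => 1) (C := 1) zero_le_one
    (fun _ => zero_le_one) (by simp) (by simp) (by simpa using hρ.2.summable)
  exact ⟨g, hg, fun t x => by simpa [freeDiag] using h t x⟩

theorem exists_lintegral_sq_le (hF : 0 < F) (hρ : IsDensityMatrix ρ)
    (h2 : Summable fun x : ℤ => (x : ℝ) ^ 2 * diag ρ x) :
    ∃ G : ℝ, 0 ≤ G ∧ ∀ t, ∫⁻ x, ENNReal.ofReal ((1 + |x|) ^ 2) ∂(latticeLaw (freeDiag F ρ t)) ≤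
      ENNReal.ofReal G := by
  have hs : Summable fun x : ℤ => (1 + |(x : ℝ)|) ^ 2 * diag ρ x := by
    refine Summable.of_nonneg_of_le (fun x => mul_nonneg (sq_nonneg _) (diag_nonneg hρ.1 x))
      (fun x => ?_) ((hρ.2.summable.add h2).mul_left 2)
    have h3 : (1 + |(x : ℝ)|) ^ 2 ≤ 2 * (1 + (x : ℝ) ^ 2) := by
      nlinarith [sq_nonneg (1 - |(x : ℝ)|), sq_abs (x : ℝ)]
    have := mul_le_mul_of_nonneg_right h3 (diag_nonneg hρ.1 x)
    linarith
  have hw : ∀ x y : ℝ, |x - y| ≤ 1 → 1 + |x| ≤ 2 * (1 + |y|) := fun x y hxy => by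
    linarith [abs_sub_abs_le_abs_sub x y, abs_nonneg y]
  -- The weight `|x|` vanishes at `0` and so is not comparable between neighbouring sites; `1 + |x|`
  -- is, with ratio at most `2`.
  obtain ⟨g, hg, h⟩ := exists_summable_bound hF hρ.1 (w := fun x => 1 + |(x : ℝ)|) (C := 2)
    zero_le_two (fun x => by positivity)
    (fun x => hw _ _ (by push_cast; simp)) (fun x => hw _ _ (by push_cast; simp)) hs
  have hg0 : ∀ x, 0 ≤ g x := fun x =>
    (mul_nonneg (sq_nonneg _) (freeDiag_nonneg (F := F) hρ.1 0 x)).trans (h 0 x)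
  exact ⟨∑' x, g x, tsum_nonneg hg0, fun t => lintegral_latticeLaw_le
    (W := fun x => (1 + |x|) ^ 2) (freeDiag_nonneg hρ.1 t) (fun x => sq_nonneg _) hg (h t)⟩

theorem exists_lintegral_expWeight_le (hF : 0 < F) (hρ : IsDensityMatrix ρ)
    (he : ∀ α : ℝ, 0 < α → Summable fun x : ℤ => Real.exp (α * |(x : ℝ)|) * diag ρ x) (α : ℝ) :
    ∃ G : ℝ, ∀ t, ∫⁻ x, expWeight α x ∂(latticeLaw (freeDiag F ρ t)) ≤ ENNReal.ofReal G := by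
  -- The `+ 1` keeps `γ` positive when `α = 0`. The weight below uses `γ / 2` because the domination
  -- result squares it.
  set γ := |α| + 1 with hγ
  have hγ0 : 0 < γ := by positivity
  have hsq : ∀ x : ℝ, Real.exp (γ / 2 * |x|) ^ 2 = Real.exp (γ * |x|) := fun x => by
    rw [← Real.exp_nat_mul]; congr 1; push_cast; ring
  have hw : ∀ x y : ℝ, |x - y| ≤ 1 →
      Real.exp (γ / 2 * |x|) ≤ Real.exp (γ / 2) * Real.exp (γ / 2 * |y|) := fun x y hxy => by
    rw [← Real.exp_add, Real.exp_le_exp]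
    have h1 : |x| ≤ 1 + |y| := by linarith [abs_sub_abs_le_abs_sub x y]
    have := mul_le_mul_of_nonneg_left h1 (by positivity : 0 ≤ γ / 2)
    linarith
  obtain ⟨g, hg, h⟩ := exists_summable_bound hF hρ.1
    (w := fun x => Real.exp (γ / 2 * |(x : ℝ)|)) (C := Real.exp (γ / 2))
    (Real.exp_pos _).le (fun x => (Real.exp_pos _).le)
    (fun x => hw _ _ (by push_cast; simp)) (fun x => hw _ _ (by push_cast; simp))
    (by simpa only [hsq] using he γ hγ0)
  simp only [hsq] at h
  refine ⟨∑' x, g x, fun t => le_trans (lintegral_mono fun x => ?_) (lintegral_latticeLaw_le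
    (W := fun x => Real.exp (γ * |x|)) (freeDiag_nonneg hρ.1 t)
    (fun x => (Real.exp_pos _).le) hg (h t))⟩
  refine ENNReal.ofReal_le_ofReal (Real.exp_le_exp.2 ?_)
  calc α * x ≤ |α| * |x| := by rw [← abs_mul]; exact le_abs_self _
    _ ≤ γ * |x| := by gcongr; linarith

end InitialLaw

end TightBinding

end

/-! ### Assembly: the walk parameters and the dominated initial laws enter the three limit theorems
-/

theorem mainTheorem8 (E F lam β τ : ℝ) (hE : 0 ≤ E) (hF : 0 < F) (hlam : lam ≠ 0) (hτ : 0 < τ)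
    (hres : ∀ m : ℤ, TightBinding.rabi E F lam * τ ≠ 2 * Real.pi * m)
    (ρ : TightBinding.HS →L[ℂ] TightBinding.HS) (hρ : TightBinding.IsDensityMatrix ρ) :
    let v : ℝ := TightBinding.drift E F lam β τ
    let D : ℝ := TightBinding.diffusion E F lam β τ
    let μ : ℕ → Measure ℝ := TightBinding.lawAt E F lam β τ ρ
    let I : ℝ → EReal := TightBinding.rate E F lam β τ
    (0 < TightBinding.kickProb E F lam τ ∧ TightBinding.kickProb E F lam τ ≤ 1) ∧
    (∀ n, IsProbabilityMeasure (μ n)) ∧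
    -- central limit theorem
    (∀ f : ℝ → ℝ, Continuous f → (∃ C, ∀ x, |f x| ≤ C) →
      Tendsto (fun n : ℕ => ∫ x, f ((x - v * n * τ) / Real.sqrt (2 * D * n * τ)) ∂(μ n)) atTop
        (𝓝 (∫ x, f x * (Real.exp (-x ^ 2 / 2) / Real.sqrt (2 * Real.pi))))) ∧
    -- convergence of the first two moments
    ((Summable fun x : ℤ => (x : ℝ) ^ 2 * TightBinding.diag ρ x) →
      (∀ n, Integrable (fun x => x) (μ n) ∧ Integrable (fun x => x ^ 2) (μ n)) ∧
      Tendsto (fun n : ℕ => (∫ x, x ∂(μ n)) / (n * τ)) atTop (𝓝 v) ∧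
      Tendsto (fun n : ℕ => (∫ x, (x - v * n * τ) ^ 2 ∂(μ n)) / (n * τ)) atTop (𝓝 (2 * D))) ∧
    -- large deviation principle
    ((∀ α : ℝ, 0 < α →
        Summable fun x : ℤ => Real.exp (α * |(x : ℝ)|) * TightBinding.diag ρ x) →
      ∀ J : Set ℝ, J.OrdConnected →
        (-(⨅ x ∈ interior J, I x) ≤
            liminf (fun n : ℕ => TightBinding.logProb (μ n) J n) atTop ∧
          limsup (fun n : ℕ => TightBinding.logProb (μ n) J n) atTop ≤
            -(⨅ x ∈ closure J, I x)) ∧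
        ((interior J ∩ Set.Ioo (-1) 1).Nonempty ∨ closure J ∩ Set.Icc (-1) 1 = ∅ →
          Tendsto (fun n : ℕ => TightBinding.logProb (μ n) J n) atTop
            (𝓝 (-(⨅ x ∈ J, I x))))) := by
  intro v D μ I
  set a := 1 - TightBinding.kickProb E F lam τ with ha_def
  set b := TightBinding.probUp E F lam β τ with hb_def
  set c := TightBinding.probDown E F lam β τ with hc_def
  have hp0 := TightBinding.kickProb_pos hlam hres
  have hp1 := TightBinding.kickProb_le_one (E := E) (F := F) (τ := τ) hlam
  have ha : 0 ≤ a := sub_nonneg.2 hp1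
  have hb : 0 < b := mul_pos hp0 (TightBinding.occ_pos E β)
  have hc : 0 < c := mul_pos hp0 (TightBinding.occ'_pos E β)
  have hs : a + b + c = 1 := by
    rw [add_assoc, hb_def, hc_def, TightBinding.probUp_add_probDown, ha_def, sub_add_cancel]
  have hv : v * τ = b - c := TightBinding.drift_mul hτ
  have hD : 2 * D * τ = b + c - (b - c) ^ 2 := TightBinding.diffusion_mul hτ
  set ν : ℕ → Measure ℝ := fun n =>
    TightBinding.latticeLaw (TightBinding.freeDiag F ρ (n * τ)) with hν_def
  have hμ : ∀ n, μ n = (TightBinding.walkMeasure a b c)^[n] (ν n) :=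
    TightBinding.lawAt_eq hF.ne' hlam hres hρ.1
  have hI : I = TightBinding.walkRate a b c := funext TightBinding.rate_eq
  have hν : ∀ n, IsProbabilityMeasure (ν n) := fun n =>
    ⟨TightBinding.latticeLaw_univ (TightBinding.freeDiag_nonneg hρ.1 _)
      (TightBinding.hasSum_freeDiag hρ _)⟩
  -- One dominating function for all times controls every `ν n`; both the central limit theorem and
  -- the tightness in the lower large deviation bound rest on it.
  obtain ⟨g, hg, hgle⟩ := TightBinding.exists_summable_freeDiag_le hF hρ
  clear_value μ I v D a b c
  obtain rfl : μ = fun n => (TightBinding.walkMeasure a b c)^[n] (ν n) := funext hμ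
  subst hI
  refine ⟨⟨hp0, hp1⟩, fun n => TightBinding.isProbabilityMeasure_walk ha hb.le hc.le hs (ν n) n,
    fun f hf ⟨C, hC⟩ => ?_, fun h2 => ?_, fun he J hJ => ?_⟩
  · have h := TightBinding.tendsto_integral_walk ha hb.le hc.le hs
      (TightBinding.variance_pos ha hb hc hs) (ν := ν) (fun t ht =>
        TightBinding.tendsto_charFun_latticeLaw (fun n => TightBinding.freeDiag_nonneg hρ.1 (n * τ))
          (fun n => TightBinding.hasSum_freeDiag hρ (n * τ)) hg (fun n => hgle (n * τ)) ht) hf hC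
    refine h.congr fun n => ?_
    rw [← hD, ← hv, show (n : ℝ) * (v * τ) = v * n * τ by ring,
      show 2 * D * τ * n = 2 * D * n * τ by ring]
  · obtain ⟨G, hG, hGle⟩ := TightBinding.exists_lintegral_sq_le hF hρ h2
    obtain ⟨hi, h1, h2⟩ := TightBinding.tendsto_moments_walk ha hb.le hc.le hs (ν := ν) hG
      fun n => hGle (n * τ)
    refine ⟨hi, ?_, ?_⟩
    · have h := h1.div_const τ
      rw [← hv, mul_div_cancel_right₀ _ hτ.ne'] at h
      exact h.congr fun n => div_div _ _ _
    · have h := h2.div_const τ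
      rw [← hD, mul_div_cancel_right₀ _ hτ.ne', ← hv] at h
      refine h.congr fun n => ?_
      rw [div_div, show (n : ℝ) * (v * τ) = v * n * τ by ring]
  · obtain ⟨K, -, hK⟩ := TightBinding.exists_half_le_latticeLaw_Icc
      (fun n : ℕ => TightBinding.freeDiag_nonneg (F := F) hρ.1 (n * τ))
      (fun n => TightBinding.hasSum_freeDiag hρ (n * τ)) hg (fun n => hgle (n * τ))
    refine TightBinding.walk_largeDeviations ha hb hc hs hK (fun α => ?_) hJ
    obtain ⟨G, hG⟩ := TightBinding.exists_lintegral_expWeight_le hF hρ he α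
    exact ⟨G, fun n => hG (n * τ)⟩
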